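/- Let $\varepsilon>0$. Let $f,y\in C^1_b([0,\infty))$ and $h\in C^2_b([0,\infty))$ (that is, $C^1$, resp. $C^2$, up to the boundary, bounded together with the first, resp. first two, derivatives), with $f(0)=0$. Define on $\mathbb R\times[0,\infty)\times\mathbb R$ the symmetrised Hamiltonian $$\tilde H^\varepsilon(x,t,\lambda)=\tfrac12\lambda^2+\lambda\, g(x)-\tilde V^\varepsilon(x,t),\qquad g(x)=\operatorname{sgn}(x)f(|x|),$$ $$\tilde V^\varepsilon(x,t)=\tfrac12 h(|x|)^2-\dot y(t)h(|x|)+\varepsilon f'(|x|)-\tfrac{\varepsilon}{2}y(t)h''(|x|),$$ which is locally Lipschitz in $\lambda$, uniformly in $(x,t)$. Let $\tilde w_0:\mathbb R\to\mathbb R$ be bounded and Lipschitz (in particular $\tilde w_0(x)=w_0(|x|)$ with $w_0$ bounded and Lipschitz on $[0,\infty)$). Then there exists $T>0$ such that the problem $$\partial_t\tilde w+\tilde H^\varepsilon(x,t,\partial_x\tilde w)=\tfrac{\varepsilon}{2}\,\partial^2_{xx}\tilde w\quad\text{on }\mathbb R\times(0,T],\qquad \tilde w(x,0)=\tilde w_0(x)\quad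 (x\in\mathbb R),$$ has a unique smooth (classical) solution on $\mathbb R\times[0,T]$, that is, a unique function $\tilde w$ that is continuous on $\mathbb R\times[0,T]$, has derivatives $\partial_t\tilde w,\partial_x\tilde w,\partial^2_{xx}\tilde w$ that are continuous on $\mathbb R\times(0,T]$ (with $\partial_t$ the left derivative at $t=T$), and satisfies the equation and the initial condition pointwise. Moreover, $\tilde w$ and $\partial_x\tilde w$ are bounded on $\mathbb R\times[0,T]$ and on $\mathbb R\times(0,T]$, respectively. -/

import Mathlib

open Set

namespace ViscousHJ

/-- `u ∈ C^n_b(ℝ₊)`: `u` is of class `C^n` on `[0, ∞)` (one-sided derivatives at `0`) and `u` and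
its derivatives up to order `n` are bounded there. Values of `u` on `(-∞, 0)` play no role. -/
def IsCb (n : ℕ) (u : ℝ → ℝ) : Prop :=
  ContDiffOn ℝ n u (Ici 0) ∧
    ∀ k ≤ n, ∃ C : ℝ, ∀ x ∈ Ici (0 : ℝ), |iteratedDerivWithin k u (Ici 0) x| ≤ C

/-- The Hamiltonian `H^ε(x, t, p)` on the half-line:
`p² / 2 + p f(x) - h(x)² / 2 - ε f'(x) + (ε / 2) y(t) h''(x) + y'(t) h(x)`. -/
noncomputable def hamiltonian (ε : ℝ) (f h y : ℝ → ℝ) (x t p : ℝ) : ℝ :=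
  1 / 2 * p ^ 2 + p * f x - 1 / 2 * (h x) ^ 2 - ε * derivWithin f (Ici 0) x
    + ε / 2 * y t * iteratedDerivWithin 2 h (Ici 0) x + derivWithin y (Ici 0) t * h x

/-- The odd extension `g(x) = sgn(x) f(|x|)` of the drift. -/
noncomputable def symDrift (f : ℝ → ℝ) (x : ℝ) : ℝ :=
  Real.sign x * f |x|

/-- The symmetrised potential
`V^ε(x, t) = h(|x|)² / 2 - y'(t) h(|x|) + ε f'(|x|) - (ε / 2) y(t) h''(|x|)`. -/
noncomputable def symPotential (ε : ℝ) (f h y : ℝ → ℝ) (x t : ℝ) : ℝ :=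
  1 / 2 * (h |x|) ^ 2 - derivWithin y (Ici 0) t * h |x| + ε * derivWithin f (Ici 0) |x|
    - ε / 2 * y t * iteratedDerivWithin 2 h (Ici 0) |x|

/-- The symmetrised Hamiltonian `p² / 2 + p g(x) - V^ε(x, t)`. -/
noncomputable def symHamiltonian (ε : ℝ) (f h y : ℝ → ℝ) (x t p : ℝ) : ℝ :=
  1 / 2 * p ^ 2 + p * symDrift f x - symPotential ε f h y x t

/-- The symmetrised Hamiltonian is `H^ε(|x|, t, sgn(x) p)`. -/
theorem symHamiltonian_eq (ε : ℝ) (f h y : ℝ → ℝ) {x : ℝ} (hx : x ≠ 0) (t p : ℝ) :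
    symHamiltonian ε f h y x t p = hamiltonian ε f h y |x| t (Real.sign x * p) := by
  rcases lt_or_gt_of_ne hx with h0 | h0
  · simp only [symHamiltonian, hamiltonian, symDrift, symPotential, Real.sign_of_neg h0]
    ring
  · simp only [symHamiltonian, hamiltonian, symDrift, symPotential, Real.sign_of_pos h0]
    ring

/-- The symmetrised Hamiltonian is locally Lipschitz in its last variable, uniformly in `(x, t)`,
as soon as `f` is bounded on `[0, ∞)`. -/
theorem symHamiltonian_locLipschitz (ε : ℝ) (f h y : ℝ → ℝ) (hf : IsCb 1 f) (R : ℝ) :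
    ∃ L : ℝ, ∀ x t p q : ℝ, |p| ≤ R → |q| ≤ R →
      |symHamiltonian ε f h y x t p - symHamiltonian ε f h y x t q| ≤ L * |p - q| := by
  obtain ⟨C, hC⟩ := hf.2 0 (Nat.zero_le _)
  refine ⟨R + C, fun x t p q hp hq => ?_⟩
  have hg : |symDrift f x| ≤ C := by
    have h1 := hC |x| (abs_nonneg x)
    rw [iteratedDerivWithin_zero] at h1
    have h2 : |Real.sign x| ≤ 1 := by
      rcases Real.sign_apply_eq x with h | h | h <;> simp [h]
    rw [symDrift, abs_mul]
    nlinarith [abs_nonneg (f |x|), abs_nonneg (Real.sign x)]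
  have e : symHamiltonian ε f h y x t p - symHamiltonian ε f h y x t q
      = ((p + q) / 2 + symDrift f x) * (p - q) := by
    simp only [symHamiltonian]; ring
  rw [e, abs_mul]
  refine mul_le_mul_of_nonneg_right ?_ (abs_nonneg _)
  rw [abs_le] at *
  constructor <;> linarith [hp.1, hp.2, hq.1, hq.2, hg.1, hg.2]

/-- `w` is a smooth (classical) solution on `ℝ × [0, T]` of
`∂ₜ w + H̃^ε(x, t, ∂ₓ w) = (ε / 2) ∂ₓₓ w`, `w(·, 0) = w₀`: it is continuous on `ℝ × [0, T]`, of
class `C²` in `x` and `C¹` in `t` on `ℝ × (0, T]` with `∂ₜ w`, `∂ₓ w`, `∂ₓₓ w` jointly continuous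
there, satisfies the equation pointwise on `ℝ × (0, T]`, and takes the initial value `w₀`.
The time derivative is relative to `[0, T]`, that is, two-sided for `t < T` and left at `t = T`. -/
structure IsSmoothSolution (ε : ℝ) (f h y w₀ : ℝ → ℝ) (T : ℝ) (w : ℝ → ℝ → ℝ) : Prop where
  continuousOn : ContinuousOn (fun q : ℝ × ℝ => w q.1 q.2) (univ ×ˢ Icc 0 T)
  contDiff_space : ∀ t ∈ Ioc 0 T, ContDiff ℝ 2 (fun x => w x t)
  differentiable_time : ∀ x, ∀ t ∈ Ioc 0 T,
    DifferentiableWithinAt ℝ (fun s => w x s) (Icc 0 T) t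
  continuousOn_dt : ContinuousOn
    (fun q : ℝ × ℝ => derivWithin (fun s => w q.1 s) (Icc 0 T) q.2) (univ ×ˢ Ioc 0 T)
  continuousOn_dx : ContinuousOn
    (fun q : ℝ × ℝ => deriv (fun x => w x q.2) q.1) (univ ×ˢ Ioc 0 T)
  continuousOn_dxx : ContinuousOn
    (fun q : ℝ × ℝ => iteratedDeriv 2 (fun x => w x q.2) q.1) (univ ×ˢ Ioc 0 T)
  equation : ∀ x, ∀ t ∈ Ioc 0 T,
    derivWithin (fun s => w x s) (Icc 0 T) t
        + symHamiltonian ε f h y x t (deriv (fun z => w z t) x)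
      = ε / 2 * iteratedDeriv 2 (fun z => w z t) x
  initial : ∀ x, w x 0 = w₀ x

end ViscousHJ

/-! ### Classical regularity class and a minimum principle on the line -/

namespace ViscousHJ

open Filter Topology

/-! Existence and uniqueness rest on separate arguments, each valid for small T.

Uniqueness. A competitor w' obeys no growth condition, so no maximum principle applies directly to
w' - w. The Cole-Hopf transform φ = exp(-w/ε) turns the equation into the linear one φ_t = (ε/2)
φ_xx - g φ_x - (V/ε) φ and makes every solution positive. Let ψ be the transform of w' minus that of
the bounded solution w. It is bounded below, hence nonnegative by `nonneg_of_bddBelow`. What remains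
is a Widder-type theorem, `HasC21.eq_zero_of_nonneg`: a nonnegative solution with zero initial value
vanishes. It has two halves. Testing against a backward Gaussian controls the Gaussian integrals of
ψ by its values on a compact set (`HasC21.exists_gaussian_integral_le`), so positivity replaces a
growth condition. Testing against a Gaussian whose exponent increases in time then shows that ψ
stays zero a little longer (`HasC21.exists_eq_zero_of_gaussian_integral_le`), and a connectedness
argument reaches T.

Existence. The potential contains f' and h'', which are merely continuous, and the heat potential of
a merely continuous source need not be twice differentiable in x. Both are removed by the corrector
Q = -2 ∫ g + y(t) k(x), with k a C² modification of h(|x|): (ε/2) Q_xx cancels them, and u = w - Q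
has a source F = -q²/2 - g q + S, where q = w_x and S is Lipschitz in x. Duhamel's formula,
differentiated once in x, is a fixed point equation for q. For small T it contracts the supremum
distance on the class of functions bounded by M with spatial Lipschitz constant N/√t
(`exists_picard_fixed`). This is the rate at which the heat flow smooths the derivative of a
Lipschitz datum. It also bounds the second space derivative inside the Duhamel integral by a
multiple of (t-s)^(-1/2) s^(-1/2), which is integrable, so the u rebuilt from q is classical
(`exists_hasC21`). Finally w is bounded although Q need not be, because the possibly unbounded part
of Q is independent of t. -/

/-- `ψ` is continuous on `ℝ × [0, T]` and has continuous derivatives `ψt`, `ψx`, `ψxx` on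
`ℝ × (0, T]`, the time derivative being relative to `[0, T]`. -/
structure HasC21 (T : ℝ) (ψ ψt ψx ψxx : ℝ → ℝ → ℝ) : Prop where
  cont : ContinuousOn (fun q : ℝ × ℝ => ψ q.1 q.2) (univ ×ˢ Icc 0 T)
  hasDeriv_t : ∀ x, ∀ t ∈ Ioc 0 T, HasDerivWithinAt (fun s => ψ x s) (ψt x t) (Icc 0 T) t
  hasDeriv_x : ∀ x, ∀ t ∈ Ioc 0 T, HasDerivAt (fun z => ψ z t) (ψx x t) x
  hasDeriv_xx : ∀ x, ∀ t ∈ Ioc 0 T, HasDerivAt (fun z => ψx z t) (ψxx x t) x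
  cont_t : ContinuousOn (fun q : ℝ × ℝ => ψt q.1 q.2) (univ ×ˢ Ioc 0 T)
  cont_x : ContinuousOn (fun q : ℝ × ℝ => ψx q.1 q.2) (univ ×ˢ Ioc 0 T)
  cont_xx : ContinuousOn (fun q : ℝ × ℝ => ψxx q.1 q.2) (univ ×ˢ Ioc 0 T)

theorem HasC21.sub {T : ℝ} {ψ ψt ψx ψxx χ χt χx χxx : ℝ → ℝ → ℝ} (h₁ : HasC21 T ψ ψt ψx ψxx)
    (h₂ : HasC21 T χ χt χx χxx) :
    HasC21 T (fun x t => ψ x t - χ x t) (fun x t => ψt x t - χt x t)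
      (fun x t => ψx x t - χx x t) (fun x t => ψxx x t - χxx x t) where
  cont := h₁.cont.sub h₂.cont
  hasDeriv_t x t ht := (h₁.hasDeriv_t x t ht).sub (h₂.hasDeriv_t x t ht)
  hasDeriv_x x t ht := (h₁.hasDeriv_x x t ht).sub (h₂.hasDeriv_x x t ht)
  hasDeriv_xx x t ht := (h₁.hasDeriv_xx x t ht).sub (h₂.hasDeriv_xx x t ht)
  cont_t := h₁.cont_t.sub h₂.cont_t
  cont_x := h₁.cont_x.sub h₂.cont_x
  cont_xx := h₁.cont_xx.sub h₂.cont_xx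

/-- If φ'' were negative, the point would also be a local maximum, so φ would be locally constant
and φ'' would be zero. -/
theorem second_deriv_nonneg_of_isLocalMin {φ φ' : ℝ → ℝ} {φ'' x : ℝ} (hmin : IsLocalMin φ x)
    (h₁ : ∀ z, HasDerivAt φ (φ' z) z) (h₂ : HasDerivAt φ' φ'' x) : 0 ≤ φ'' := by
  by_contra! hneg
  have e : deriv φ = φ' := funext fun z => (h₁ z).deriv
  have hd : deriv φ x = 0 := hmin.deriv_eq_zero
  have hmax : IsLocalMax φ x := by
    apply isLocalMax_of_deriv_deriv_neg _ hd (h₁ x).continuousAt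
    rw [e, h₂.deriv]; exact hneg
  have hconst : φ =ᶠ[𝓝 x] fun _ => φ x := by
    filter_upwards [hmin, hmax] with z hz1 hz2
    exact le_antisymm hz2 hz1
  have h3 : deriv φ =ᶠ[𝓝 x] deriv fun _ => φ x := hconst.deriv
  have h4 : φ' =ᶠ[𝓝 x] fun _ => (0 : ℝ) := by
    rw [e] at h3
    filter_upwards [h3] with z hz
    rw [hz]; simp
  have h5 := h4.deriv_eq
  rw [h₂.deriv] at h5
  simp at h5
  linarith

/-- Only the direction from t back to 0 is used. This is why t = T is allowed and why the conclusion
is an inequality rather than φ' = 0. -/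
theorem deriv_nonpos_of_isMinOn_Icc {φ : ℝ → ℝ} {φ' T t : ℝ} (ht : t ∈ Ioc 0 T)
    (hmin : ∀ s ∈ Icc 0 T, φ t ≤ φ s) (hd : HasDerivWithinAt φ φ' (Icc 0 T) t) : φ' ≤ 0 := by
  have hm : IsLocalMinOn φ (Icc 0 T) t := by
    filter_upwards [self_mem_nhdsWithin] with s hs using hmin s hs
  have hseg : segment ℝ t 0 ⊆ Icc 0 T :=
    (convex_Icc 0 T).segment_subset ⟨ht.1.le, ht.2⟩ ⟨le_rfl, ht.1.le.trans ht.2⟩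
  have h1 := hm.hasFDerivWithinAt_nonneg hd.hasFDerivWithinAt
    (sub_mem_posTangentConeAt_of_segment_subset hseg)
  simp at h1
  nlinarith [ht.1]

/-- A minimum principle on the line for solutions that are bounded below. -/
theorem nonneg_of_bddBelow {ε K G C T : ℝ} (hε : 0 < ε) {g : ℝ → ℝ} (hg : ∀ x, |g x| ≤ G)
    {c : ℝ → ℝ → ℝ} (hc : ∀ x, ∀ t ∈ Ioc 0 T, |c x t| ≤ K) {ψ ψt ψx ψxx : ℝ → ℝ → ℝ}
    (h : HasC21 T ψ ψt ψx ψxx)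
    (heq : ∀ x, ∀ t ∈ Ioc 0 T,
      ψt x t = ε / 2 * ψxx x t - g x * ψx x t - c x t * ψ x t)
    (h0 : ∀ x, 0 ≤ ψ x 0) (hC : 0 < C) (hlow : ∀ x, ∀ t ∈ Icc 0 T, -C ≤ ψ x t) :
    ∀ x, ∀ t ∈ Icc 0 T, 0 ≤ ψ x t := by
  intro x₁ t₁ ht₁
  have hG : 0 ≤ G := (abs_nonneg _).trans (hg 0)
  -- The rate l beats the zeroth order coefficient (|K|) and the action of the operator on cosh (ε/2
  -- + G, as cosh'' = cosh and |sinh| ≤ cosh), with 1 to spare for strictness.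
  obtain ⟨l, hl⟩ : ∃ l, l = ε / 2 + G + |K| + 1 := ⟨_, rfl⟩
  have hl0 : 0 < l := by rw [hl]; positivity
  have key : ∀ R, |x₁| ≤ R →
      0 ≤ Real.exp (-l * t₁) * ψ x₁ t₁ + C * Real.cosh x₁ / Real.cosh R := by
    intro R hR
    have hR0 : 0 ≤ R := (abs_nonneg _).trans hR
    -- The barrier equals C on the lateral boundary |x| = R, where it offsets the lower bound -C,
    -- and tends to 0 at a fixed point as R grows.
    set z : ℝ × ℝ → ℝ := fun q => Real.exp (-l * q.2) * ψ q.1 q.2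
      + C * Real.cosh q.1 / Real.cosh R with hz
    have hcR := Real.cosh_pos R
    have hzc : ContinuousOn z (Icc (-R) R ×ˢ Icc 0 T) := by
      have h1 := h.cont.mono (prod_mono (subset_univ (Icc (-R) R)) (le_refl (Icc 0 T)))
      refine ContinuousOn.add (ContinuousOn.mul (by fun_prop) h1) ?_
      have : Continuous fun q : ℝ × ℝ => Real.cosh q.1 := Real.continuous_cosh.comp continuous_fst
      exact ((continuous_const.mul this).div_const _).continuousOn
    have hmem : (x₁, t₁) ∈ Icc (-R) R ×ˢ Icc 0 T := ⟨abs_le.1 hR, ht₁⟩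
    obtain ⟨⟨x₀, t₀⟩, hq0, hmin⟩ :=
      (isCompact_Icc.prod isCompact_Icc).exists_isMinOn ⟨_, hmem⟩ hzc
    refine le_trans ?_ (hmin hmem)
    by_contra! hneg
    have hx0 : x₀ ∈ Icc (-R) R := hq0.1
    have ht0 : t₀ ∈ Icc 0 T := hq0.2
    have hB : 0 < C * Real.cosh x₀ / Real.cosh R := by
      have := Real.cosh_pos x₀; positivity
    simp only [hz] at hneg
    have ht0' : t₀ ≠ 0 := by
      rintro rfl
      have := h0 x₀
      have : 0 ≤ Real.exp (-l * 0) * ψ x₀ 0 := mul_nonneg (Real.exp_pos _).le this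
      linarith
    have htI : t₀ ∈ Ioc 0 T := ⟨lt_of_le_of_ne ht0.1 (Ne.symm ht0'), ht0.2⟩
    have habs : |x₀| ≠ R := by
      intro hx
      have e1 : Real.cosh x₀ = Real.cosh R := by rw [← hx, Real.cosh_abs]
      rw [e1, mul_div_cancel_right₀ _ hcR.ne'] at hneg
      have h1 := hlow x₀ t₀ ht0
      have h2 : Real.exp (-l * t₀) ≤ 1 := by
        rw [Real.exp_le_one_iff]; nlinarith [htI.1]
      nlinarith [Real.exp_pos (-l * t₀)]
    have hlt : |x₀| < R := lt_of_le_of_ne (abs_le.2 hx0) habs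
    -- derivatives at the minimum
    have hdx : ∀ x, HasDerivAt (fun x => z (x, t₀))
        (Real.exp (-l * t₀) * ψx x t₀ + C * Real.sinh x / Real.cosh R) x := fun x =>
      ((h.hasDeriv_x x t₀ htI).const_mul (Real.exp (-l * t₀))).fun_add
        (((Real.hasDerivAt_cosh x).const_mul C).div_const (Real.cosh R))
    have hdxx : HasDerivAt (fun x => Real.exp (-l * t₀) * ψx x t₀ + C * Real.sinh x / Real.cosh R)
        (Real.exp (-l * t₀) * ψxx x₀ t₀ + C * Real.cosh x₀ / Real.cosh R) x₀ :=
      ((h.hasDeriv_xx x₀ t₀ htI).const_mul _).fun_add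
        (((Real.hasDerivAt_sinh x₀).const_mul C).div_const _)
    have hloc : IsLocalMin (fun x => z (x, t₀)) x₀ := by
      have : Ioo (-R) R ∈ 𝓝 x₀ := Ioo_mem_nhds (abs_lt.1 hlt).1 (abs_lt.1 hlt).2
      filter_upwards [this] with x hx
      exact hmin (show (x, t₀) ∈ _ from ⟨⟨hx.1.le, hx.2.le⟩, ht0⟩)
    have hz1 := hloc.hasDerivAt_eq_zero (hdx x₀)
    have hz2 := second_deriv_nonneg_of_isLocalMin hloc hdx hdxx
    have hdt : HasDerivWithinAt (fun t => z (x₀, t))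
        ((Real.exp (-l * t₀) * (-l * 1)) * ψ x₀ t₀ + Real.exp (-l * t₀) * ψt x₀ t₀)
        (Icc 0 T) t₀ := by
      have h1 : HasDerivAt (fun t => Real.exp (-l * t)) (Real.exp (-l * t₀) * (-l * 1)) t₀ :=
        ((hasDerivAt_id t₀).const_mul (-l)).exp
      exact (h1.hasDerivWithinAt.fun_mul (h.hasDeriv_t x₀ t₀ htI)).add_const
        (C * Real.cosh x₀ / Real.cosh R)
    have hz3 := deriv_nonpos_of_isMinOn_Icc htI
      (fun s hs => hmin (show (x₀, s) ∈ _ from ⟨hx0, hs⟩)) hdt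
    rw [heq x₀ t₀ htI] at hz3
    have hc0 := abs_le.1 (hc x₀ t₀ htI)
    have hg0 := abs_le.1 (hg x₀)
    obtain ⟨B, hBdef⟩ : ∃ B, B = C * Real.cosh x₀ / Real.cosh R := ⟨_, rfl⟩
    obtain ⟨S, hS⟩ : ∃ S, S = C * Real.sinh x₀ / Real.cosh R := ⟨_, rfl⟩
    obtain ⟨P, hP⟩ : ∃ P, P = Real.exp (-l * t₀) * ψ x₀ t₀ := ⟨_, rfl⟩
    have hSB : |S| ≤ B := by
      have h1 : |Real.sinh x₀| ≤ Real.cosh x₀ := by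
        rw [Real.abs_sinh, ← Real.cosh_abs x₀]; exact (Real.sinh_lt_cosh _).le
      rw [hS, hBdef, abs_div, abs_mul, abs_of_pos hC, abs_of_pos hcR]
      gcongr
    rw [← hBdef] at hz2 hneg hB
    rw [← hS] at hz1
    rw [← hP] at hneg
    have hgS : |g x₀ * S| ≤ G * B := by
      rw [abs_mul]
      exact mul_le_mul (hg x₀) hSB (abs_nonneg _) hG
    have hgS' := (abs_le.1 hgS).1
    have e1 : Real.exp (-l * t₀) * (-l * 1) * ψ x₀ t₀ +
        Real.exp (-l * t₀) * (ε / 2 * ψxx x₀ t₀ - g x₀ * ψx x₀ t₀ - c x₀ t₀ * ψ x₀ t₀)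
        = -(l + c x₀ t₀) * P + ε / 2 * (Real.exp (-l * t₀) * ψxx x₀ t₀)
          - g x₀ * (Real.exp (-l * t₀) * ψx x₀ t₀) := by rw [hP]; ring
    have e2 : Real.exp (-l * t₀) * ψx x₀ t₀ = -S := by linarith
    rw [e1, e2] at hz3
    have hK : K ≤ |K| := le_abs_self K
    have hlc : ε / 2 + G + 1 ≤ l + c x₀ t₀ := by rw [hl]; linarith [hc0.1]
    have h7 : (ε / 2 + G + 1) * B ≤ (l + c x₀ t₀) * (-P) :=
      mul_le_mul hlc (by linarith) hB.le (by linarith)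
    nlinarith
  by_contra! hneg
  set A := -(Real.exp (-l * t₁) * ψ x₁ t₁) with hA
  have hApos : 0 < A := by
    rw [hA]; have := mul_neg_of_pos_of_neg (Real.exp_pos (-l * t₁)) hneg; linarith
  -- Since cosh (|x₁| + N) > N, the radius |x₁| + N already makes the barrier at x₁ smaller than A.
  set N := C * Real.cosh x₁ / A
  have hN : 0 < N := by have := Real.cosh_pos x₁; positivity
  have h1 := key (|x₁| + N) (by linarith)
  have h2 : N < Real.cosh (|x₁| + N) := by
    have h3 : |x₁| + N ≤ Real.sinh (|x₁| + N) := Real.self_le_sinh_iff.2 (by positivity)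
    have h4 := Real.sinh_lt_cosh (|x₁| + N)
    linarith [abs_nonneg x₁]
  have h5 : C * Real.cosh x₁ / Real.cosh (|x₁| + N) < A := by
    rw [div_lt_iff₀ (Real.cosh_pos _)]
    have : C * Real.cosh x₁ = A * N := by
      simp only [N]; field_simp
    rw [this]; gcongr
  linarith

end ViscousHJ

/-! ### Parameter integrals and integration by parts -/

namespace ViscousHJ

open Filter Topology MeasureTheory

theorem exists_bound_of_continuousOn_prod {Φ : ℝ → ℝ → ℝ} {p q a b : ℝ}
    (hΦ : ContinuousOn (fun z : ℝ × ℝ => Φ z.1 z.2) (Icc p q ×ˢ Icc a b)) :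
    ∃ M, 0 ≤ M ∧ ∀ y ∈ Icc p q, ∀ s ∈ Icc a b, |Φ y s| ≤ M := by
  obtain ⟨M, hM⟩ := (isCompact_Icc.prod isCompact_Icc).exists_bound_of_continuousOn hΦ
  exact ⟨max M 0, le_max_right _ _, fun y hy s hs => (hM (y, s) ⟨hy, hs⟩).trans (le_max_left _ _)⟩

theorem continuousOn_slice_fst {Φ : ℝ → ℝ → ℝ} {A B : Set ℝ}
    (hΦ : ContinuousOn (fun z : ℝ × ℝ => Φ z.1 z.2) (A ×ˢ B)) {s : ℝ} (hs : s ∈ B) :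
    ContinuousOn (fun y => Φ y s) A :=
  hΦ.comp (f := fun y => (y, s)) (by fun_prop) fun _ hy => ⟨hy, hs⟩

theorem continuousOn_slice_snd {Φ : ℝ → ℝ → ℝ} {A B : Set ℝ}
    (hΦ : ContinuousOn (fun z : ℝ × ℝ => Φ z.1 z.2) (A ×ˢ B)) {y : ℝ} (hy : y ∈ A) :
    ContinuousOn (fun s => Φ y s) B :=
  hΦ.comp (f := fun s => (y, s)) (by fun_prop) fun _ hs => ⟨hy, hs⟩

theorem continuousOn_intervalIntegral {Φ : ℝ → ℝ → ℝ} {p q a b : ℝ} (hpq : p ≤ q)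
    (hΦ : ContinuousOn (fun z : ℝ × ℝ => Φ z.1 z.2) (Icc p q ×ˢ Icc a b)) :
    ContinuousOn (fun s => ∫ y in p..q, Φ y s) (Icc a b) := by
  obtain ⟨M, -, hM⟩ := exists_bound_of_continuousOn_prod hΦ
  intro s hs
  have hsub : uIoc p q ⊆ Icc p q := by rw [uIoc_of_le hpq]; exact Ioc_subset_Icc_self
  refine intervalIntegral.continuousWithinAt_of_dominated_interval (bound := fun _ => M) ?_ ?_
    intervalIntegrable_const ?_
  · filter_upwards [self_mem_nhdsWithin] with r hr
    exact ((continuousOn_slice_fst hΦ hr).mono hsub).aestronglyMeasurable measurableSet_uIoc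
  · filter_upwards [self_mem_nhdsWithin] with r hr
    exact ae_of_all _ fun y hy => hM y (hsub hy) r hr
  · exact ae_of_all _ fun y hy => continuousOn_slice_snd hΦ (hsub hy) s hs

/-- The hypotheses hold only on an open time interval, because the weights used later are singular
at its end. Shrinking to a compact interval around s gives the uniform bound needed for domination.
-/
theorem hasDerivAt_intervalIntegral {Φ Φ' : ℝ → ℝ → ℝ} {p q a b : ℝ} (hpq : p ≤ q)
    (hΦ : ContinuousOn (fun z : ℝ × ℝ => Φ z.1 z.2) (Icc p q ×ˢ Ioo a b))
    (hΦ' : ContinuousOn (fun z : ℝ × ℝ => Φ' z.1 z.2) (Icc p q ×ˢ Ioo a b))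
    (hd : ∀ y ∈ Icc p q, ∀ s ∈ Ioo a b, HasDerivAt (fun s => Φ y s) (Φ' y s) s)
    {s : ℝ} (hs : s ∈ Ioo a b) :
    HasDerivAt (fun s => ∫ y in p..q, Φ y s) (∫ y in p..q, Φ' y s) s := by
  obtain ⟨a', ha'⟩ := exists_between hs.1
  obtain ⟨b', hb'⟩ := exists_between hs.2
  have hsubs : Icc a' b' ⊆ Ioo a b := fun r hr => ⟨ha'.1.trans_le hr.1, hr.2.trans_lt hb'.2⟩
  obtain ⟨M, -, hM⟩ := exists_bound_of_continuousOn_prod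
    (hΦ'.mono (prod_mono (le_refl (Icc p q)) hsubs))
  have hsub : uIoc p q ⊆ Icc p q := by rw [uIoc_of_le hpq]; exact Ioc_subset_Icc_self
  have hnhds : Icc a' b' ∈ 𝓝 s := Icc_mem_nhds ha'.2 hb'.1
  refine (intervalIntegral.hasDerivAt_integral_of_dominated_loc_of_deriv_le (μ := volume)
    (F := fun s y => Φ y s) (F' := fun s y => Φ' y s) (bound := fun _ => M)
    hnhds ?_ ?_ ?_ ?_ intervalIntegrable_const ?_).2
  · filter_upwards [hnhds] with r hr
    exact ((continuousOn_slice_fst hΦ (hsubs hr)).mono hsub).aestronglyMeasurable measurableSet_uIoc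
  · exact (continuousOn_slice_fst hΦ hs).intervalIntegrable_of_Icc hpq
  · exact ((continuousOn_slice_fst hΦ' hs).mono hsub).aestronglyMeasurable measurableSet_uIoc
  · exact ae_of_all _ fun y hy r hr => hM y (hsub hy) r hr
  · exact ae_of_all _ fun y hy r hr => hd y (hsub hy) r (hsubs hr)

/-- Integration by parts for the operator `ε / 2 ∂ₓₓ - g ∂ₓ` against a weight. -/
theorem integral_generator_mul_weight {ε p q : ℝ} {g g' φ φ' φ'' η η' η'' : ℝ → ℝ}
    (hg : ∀ x, HasDerivAt g (g' x) x) (hg' : Continuous g')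
    (hφ : ∀ x, HasDerivAt φ (φ' x) x) (hφ' : ∀ x, HasDerivAt φ' (φ'' x) x) (hφ'' : Continuous φ'')
    (hη : ∀ x, HasDerivAt η (η' x) x) (hη' : ∀ x, HasDerivAt η' (η'' x) x) (hη'' : Continuous η'')
    (hp : η p = 0) (hq : η q = 0) :
    ∫ x in p..q, (ε / 2 * φ'' x - g x * φ' x) * η x
      = (∫ x in p..q, φ x * (ε / 2 * η'' x + g' x * η x + g x * η' x))
        - ε / 2 * (φ q * η' q - φ p * η' p) := by
  have cg : Continuous g := continuous_iff_continuousAt.2 fun x => (hg x).continuousAt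
  have cφ : Continuous φ := continuous_iff_continuousAt.2 fun x => (hφ x).continuousAt
  have cφ' : Continuous φ' := continuous_iff_continuousAt.2 fun x => (hφ' x).continuousAt
  have cη : Continuous η := continuous_iff_continuousAt.2 fun x => (hη x).continuousAt
  have cη' : Continuous η' := continuous_iff_continuousAt.2 fun x => (hη' x).continuousAt
  -- The flux is a primitive of the difference of the two integrands, so the fundamental theorem of
  -- calculus performs all integrations by parts at once.
  have hJ : ∀ x, HasDerivAt (fun x => ε / 2 * (φ' x * η x - φ x * η' x) - g x * φ x * η x)
      ((ε / 2 * φ'' x - g x * φ' x) * η x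
        - φ x * (ε / 2 * η'' x + g' x * η x + g x * η' x)) x := by
    intro x
    have h1 := ((((hφ' x).fun_mul (hη x)).fun_sub ((hφ x).fun_mul (hη' x))).const_mul
      (ε / 2)).fun_sub (((hg x).fun_mul (hφ x)).fun_mul (hη x))
    refine h1.congr_deriv ?_
    ring
  have h2 := intervalIntegral.integral_eq_sub_of_hasDerivAt (a := p) (b := q)
    (fun x _ => hJ x) (Continuous.intervalIntegrable (by fun_prop) _ _)
  rw [intervalIntegral.integral_sub (Continuous.intervalIntegrable (by fun_prop) _ _)
    (Continuous.intervalIntegrable (by fun_prop) _ _)] at h2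
  rw [hp, hq] at h2
  linarith

end ViscousHJ

/-! ### Time derivatives of weighted integrals -/

namespace ViscousHJ

open Filter Topology MeasureTheory

/-- Space-time weights with the regularity needed to differentiate `∫ ψ η`. -/
structure IsWeight (a b : ℝ) (η ηs ηy ηyy : ℝ → ℝ → ℝ) : Prop where
  cont : ContinuousOn (fun q : ℝ × ℝ => η q.1 q.2) (univ ×ˢ Ioo a b)
  cont_s : ContinuousOn (fun q : ℝ × ℝ => ηs q.1 q.2) (univ ×ˢ Ioo a b)
  cont_yy : ∀ s ∈ Ioo a b, Continuous fun y => ηyy y s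
  hasDeriv_s : ∀ y, ∀ s ∈ Ioo a b, HasDerivAt (fun s => η y s) (ηs y s) s
  hasDeriv_y : ∀ y, ∀ s ∈ Ioo a b, HasDerivAt (fun y => η y s) (ηy y s) y
  hasDeriv_yy : ∀ y, ∀ s ∈ Ioo a b, HasDerivAt (fun y => ηy y s) (ηyy y s) y

section
variable {ε K G T : ℝ} {g g' : ℝ → ℝ} {ψ ψt ψx ψxx : ℝ → ℝ → ℝ}

/-- The derivative of a weighted integral, in terms of the dual operator and the defect. -/
theorem HasC21.hasDerivAt_weighted_integral (h : HasC21 T ψ ψt ψx ψxx)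
    (hg : ∀ x, HasDerivAt g (g' x) x) (hg' : Continuous g')
    {a b p q : ℝ} (hpq : p ≤ q) (ha : 0 ≤ a) (hb : b ≤ T)
    {η ηs ηy ηyy : ℝ → ℝ → ℝ} (hη : IsWeight a b η ηs ηy ηyy)
    {s : ℝ} (hs : s ∈ Ioo a b) (hp : η p s = 0) (hq : η q s = 0) :
    HasDerivAt (fun s => ∫ y in p..q, ψ y s * η y s)
      ((∫ y in p..q, (ψt y s - (ε / 2 * ψxx y s - g y * ψx y s)) * η y s)
        + (∫ y in p..q, ψ y s * (ε / 2 * ηyy y s + g' y * η y s + g y * ηy y s + ηs y s))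
        - ε / 2 * (ψ q s * ηy q s - ψ p s * ηy p s)) s := by
  have hsub : Ioo a b ⊆ Ioc 0 T := fun r hr => ⟨ha.trans_lt hr.1, hr.2.le.trans hb⟩
  have hsub' : Ioo a b ⊆ Icc 0 T := hsub.trans Ioc_subset_Icc_self
  have hsT : s ∈ Ioc 0 T := hsub hs
  have m1 : ∀ {B : Set ℝ}, Ioo a b ⊆ B → Icc p q ×ˢ Ioo a b ⊆ (univ : Set ℝ) ×ˢ B :=
    fun hB => prod_mono (subset_univ _) hB
  have c1 := h.cont.mono (m1 hsub')
  have c2 := h.cont_t.mono (m1 hsub)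
  have c3 := hη.cont.mono (m1 (le_refl _))
  have c4 := hη.cont_s.mono (m1 (le_refl _))
  have hd := hasDerivAt_intervalIntegral (Φ := fun y s => ψ y s * η y s)
    (Φ' := fun y s => ψt y s * η y s + ψ y s * ηs y s) hpq (c1.mul c3)
    ((c2.mul c3).add (c1.mul c4))
    (fun y _ r hr => ((h.hasDeriv_t y r (hsub hr)).hasDerivAt
      (Icc_mem_nhds (ha.trans_lt hr.1) (hr.2.trans_le hb))).mul (hη.hasDeriv_s y r hr)) hs
  refine hd.congr_deriv ?_
  have k0 : Continuous fun y => ψ y s := continuous_iff_continuousAt.2 fun x =>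
    (h.hasDeriv_x x s hsT).continuousAt
  have k1 : Continuous fun y => ψx y s := continuous_iff_continuousAt.2 fun x =>
    (h.hasDeriv_xx x s hsT).continuousAt
  have k2 : Continuous fun y => ψxx y s :=
    continuousOn_univ.1 (continuousOn_slice_fst h.cont_xx hsT)
  have k3 : Continuous fun y => ψt y s :=
    continuousOn_univ.1 (continuousOn_slice_fst h.cont_t hsT)
  have k4 : Continuous fun y => η y s := continuous_iff_continuousAt.2 fun x =>
    (hη.hasDeriv_y x s hs).continuousAt
  have k5 : Continuous fun y => ηy y s := continuous_iff_continuousAt.2 fun x =>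
    (hη.hasDeriv_yy x s hs).continuousAt
  have k6 := hη.cont_yy s hs
  have k7 : Continuous fun y => ηs y s :=
    continuousOn_univ.1 (continuousOn_slice_fst hη.cont_s hs)
  have kg : Continuous g := continuous_iff_continuousAt.2 fun x => (hg x).continuousAt
  have ibp := integral_generator_mul_weight (ε := ε) (p := p) (q := q) hg hg'
    (fun x => h.hasDeriv_x x s hsT) (fun x => h.hasDeriv_xx x s hsT) k2
    (fun x => hη.hasDeriv_y x s hs) (fun x => hη.hasDeriv_yy x s hs) k6 hp hq
  have e1 : (fun y => ψt y s * η y s + ψ y s * ηs y s) = fun y =>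
      ((ψt y s - (ε / 2 * ψxx y s - g y * ψx y s)) * η y s
      + (ε / 2 * ψxx y s - g y * ψx y s) * η y s) + ψ y s * ηs y s := by
    funext y; ring
  have e2 : (fun y => ψ y s * (ε / 2 * ηyy y s + g' y * η y s + g y * ηy y s + ηs y s))
      = fun y => ψ y s * (ε / 2 * ηyy y s + g' y * η y s + g y * ηy y s) + ψ y s * ηs y s := by
    funext y; ring
  rw [e1, e2, intervalIntegral.integral_add (Continuous.intervalIntegrable (by fun_prop) _ _)
    (Continuous.intervalIntegrable (by fun_prop) _ _),
    intervalIntegral.integral_add (Continuous.intervalIntegrable (by fun_prop) _ _)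
    (Continuous.intervalIntegrable (by fun_prop) _ _),
    intervalIntegral.integral_add (Continuous.intervalIntegrable (by fun_prop) _ _)
    (Continuous.intervalIntegrable (by fun_prop) _ _), ibp]
  ring

/-- One-sided bounds for the derivative of a weighted integral of a nonnegative function satisfying
a differential inequality; `σ = 1` gives lower and `σ = -1` upper bounds. -/
theorem HasC21.exists_hasDerivAt_ge (σ : ℝ) (h : HasC21 T ψ ψt ψx ψxx)
    (hg : ∀ x, HasDerivAt g (g' x) x) (hg' : Continuous g') (hε : 0 < ε)
    (hψ : ∀ x, ∀ t ∈ Icc 0 T, 0 ≤ ψ x t)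
    (hlow : ∀ x, ∀ t ∈ Ioc 0 T,
      -K * ψ x t ≤ σ * (ψt x t - (ε / 2 * ψxx x t - g x * ψx x t)))
    {a b p q : ℝ} (hpq : p ≤ q) (ha : 0 ≤ a) (hb : b ≤ T)
    {η ηs ηy ηyy : ℝ → ℝ → ℝ} (hη : IsWeight a b η ηs ηy ηyy)
    {s : ℝ} (hs : s ∈ Ioo a b) (hp : η p s = 0) (hq : η q s = 0)
    (hpos : ∀ y ∈ Icc p q, 0 ≤ η y s) (hbd : σ * (ψ q s * ηy q s - ψ p s * ηy p s) ≤ 0)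
    {ω : ℝ → ℝ} (hω : IntervalIntegrable (fun y => ψ y s * ω y) volume p q)
    (hL : ∀ y ∈ Icc p q, ω y ≤
      σ * (ε / 2 * ηyy y s + g' y * η y s + g y * ηy y s + ηs y s) - K * η y s) :
    ∃ m', HasDerivAt (fun s => ∫ y in p..q, ψ y s * η y s) m' s ∧
      ∫ y in p..q, ψ y s * ω y ≤ σ * m' := by
  refine ⟨_, h.hasDerivAt_weighted_integral (ε := ε) hg hg' hpq ha hb hη hs hp hq, ?_⟩
  have hsT : s ∈ Ioc 0 T := ⟨ha.trans_lt hs.1, hs.2.le.trans hb⟩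
  have hsT' := Ioc_subset_Icc_self hsT
  have k0 : Continuous fun y => ψ y s := continuous_iff_continuousAt.2 fun x =>
    (h.hasDeriv_x x s hsT).continuousAt
  have k1 : Continuous fun y => ψx y s := continuous_iff_continuousAt.2 fun x =>
    (h.hasDeriv_xx x s hsT).continuousAt
  have k2 : Continuous fun y => ψxx y s :=
    continuousOn_univ.1 (continuousOn_slice_fst h.cont_xx hsT)
  have k3 : Continuous fun y => ψt y s :=
    continuousOn_univ.1 (continuousOn_slice_fst h.cont_t hsT)
  have k4 : Continuous fun y => η y s := continuous_iff_continuousAt.2 fun x =>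
    (hη.hasDeriv_y x s hs).continuousAt
  have k5 : Continuous fun y => ηy y s := continuous_iff_continuousAt.2 fun x =>
    (hη.hasDeriv_yy x s hs).continuousAt
  have k6 := hη.cont_yy s hs
  have k7 : Continuous fun y => ηs y s :=
    continuousOn_univ.1 (continuousOn_slice_fst hη.cont_s hs)
  have kg : Continuous g := continuous_iff_continuousAt.2 fun x => (hg x).continuousAt
  have h3 : ∫ y in p..q, ψ y s * ω y ≤
      ∫ y in p..q, σ * ((ψt y s - (ε / 2 * ψxx y s - g y * ψx y s)) * η y s
      + ψ y s * (ε / 2 * ηyy y s + g' y * η y s + g y * ηy y s + ηs y s)) := by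
    refine intervalIntegral.integral_mono_on hpq hω
      (Continuous.intervalIntegrable (by fun_prop) _ _) fun y hy => ?_
    -- The defect inequality is multiplied by η ≥ 0 and the bound on the dual operator by ψ ≥ 0; the
    -- term -K ψ η of the second absorbs the loss in the first.
    have e1 := mul_le_mul_of_nonneg_right (hlow y s hsT) (hpos y hy)
    have e2 := mul_le_mul_of_nonneg_left (hL y hy) (hψ y s hsT')
    nlinarith
  rw [intervalIntegral.integral_const_mul,
    intervalIntegral.integral_add (Continuous.intervalIntegrable (by fun_prop) _ _)
    (Continuous.intervalIntegrable (by fun_prop) _ _)] at h3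
  nlinarith

end
end ViscousHJ

/-! ### Backward Gaussian test functions: nonnegative supersolutions have Gaussian integrals -/

namespace ViscousHJ

open Filter Topology MeasureTheory

/-- The subtracted constant in y makes the weight vanish at y = ±R with a favourable sign of its
slope there, so no boundary values of ψ need be known. The factor T - s makes the weighted integral
tend to 0 as s tends to T. -/
theorem isWeight_backward_gaussian (a R T : ℝ) :
    IsWeight 0 T
      (fun y s => (T - s) * (Real.exp (-(a * y ^ 2 * (T - s)⁻¹))
        - Real.exp (-(a * R ^ 2 * (T - s)⁻¹))))
      (fun y s => -(Real.exp (-(a * y ^ 2 * (T - s)⁻¹)) - Real.exp (-(a * R ^ 2 * (T - s)⁻¹)))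
        + (a * R ^ 2 * (T - s)⁻¹ * Real.exp (-(a * R ^ 2 * (T - s)⁻¹))
          - a * y ^ 2 * (T - s)⁻¹ * Real.exp (-(a * y ^ 2 * (T - s)⁻¹))))
      (fun y s => -(2 * a * y) * Real.exp (-(a * y ^ 2 * (T - s)⁻¹)))
      (fun y s => (4 * a ^ 2 * y ^ 2 * (T - s)⁻¹ - 2 * a) *
        Real.exp (-(a * y ^ 2 * (T - s)⁻¹))) := by
  have hne : ∀ q ∈ (univ : Set ℝ) ×ˢ Ioo 0 T, T - q.2 ≠ 0 := fun q hq =>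
    (sub_pos.2 hq.2.2).ne'
  have hinv : ContinuousOn (fun q : ℝ × ℝ => (T - q.2)⁻¹) (univ ×ˢ Ioo 0 T) :=
    ContinuousOn.inv₀ (by fun_prop) hne
  have hds : ∀ c s, s ∈ Ioo 0 T → HasDerivAt (fun s => Real.exp (-(c * (T - s)⁻¹)))
      (-(c * (T - s)⁻¹ ^ 2) * Real.exp (-(c * (T - s)⁻¹))) s := by
    intro c s hs
    have h0 : T - s ≠ 0 := (sub_pos.2 hs.2).ne'
    have h1 : HasDerivAt (fun s => T - s) (-1) s := (hasDerivAt_id s).const_sub T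
    refine (((h1.fun_inv h0).const_mul c).fun_neg.exp).congr_deriv ?_
    field_simp
  have hdy : ∀ y s, HasDerivAt (fun y => Real.exp (-(a * y ^ 2 * (T - s)⁻¹)))
      (-(2 * a * y * (T - s)⁻¹) * Real.exp (-(a * y ^ 2 * (T - s)⁻¹))) y := by
    intro y s
    refine ((((hasDerivAt_pow 2 y).const_mul a).mul_const (T - s)⁻¹).fun_neg.exp).congr_deriv ?_
    simp; ring
  refine ⟨by fun_prop, by fun_prop, fun s _ => by fun_prop, ?_, ?_, ?_⟩
  · intro y s hs
    have h0 : T - s ≠ 0 := (sub_pos.2 hs.2).ne'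
    have h1 : HasDerivAt (fun s => T - s) (-1) s := (hasDerivAt_id s).const_sub T
    refine (h1.fun_mul ((hds (a * y ^ 2) s hs).fun_sub (hds (a * R ^ 2) s hs))).congr_deriv ?_
    field_simp
    ring
  · intro y s hs
    have h0 : T - s ≠ 0 := (sub_pos.2 hs.2).ne'
    refine (((hdy y s).sub_const _).const_mul (T - s)).congr_deriv ?_
    field_simp
  · intro y s hs
    have h1 : HasDerivAt (fun y : ℝ => -(2 * a * y)) (-(2 * a * 1)) y :=
      ((hasDerivAt_id y).const_mul (2 * a)).fun_neg
    refine (h1.fun_mul (hdy y s)).congr_deriv ?_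
    ring

section
variable {ε K G T : ℝ} {g g' : ℝ → ℝ} {ψ ψt ψx ψxx : ℝ → ℝ → ℝ}

theorem integral_inv_one_add_sq_le (R : ℝ) : ∫ y in (-R)..R, (1 + y ^ 2)⁻¹ ≤ 4 := by
  rw [integral_inv_one_add_sq, Real.arctan_neg]
  have := Real.arctan_lt_pi_div_two R
  linarith [Real.pi_lt_four]

/-- With a = 1/ε the exponent is twice that of the backward heat kernel, so diffusion
overcompensates the time derivative and leaves a y²/τ · E. For |y| ≥ 1 and T small this dominates
all drift and zeroth order terms. Hence the dual operator is negative at most on a fixed compact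
set, independently of R. -/
theorem backward_weight_bound {ε a G K T τ E F g g' y R : ℝ} (ha : 0 < a) (haε : ε * a = 1)
    (hG : 0 ≤ G) (hK : 0 ≤ K) (hT1 : T ≤ 1) (hT : T * (2 + 2 * a * G + (G + K)) ≤ a)
    (hg : |g| ≤ G) (hg' : |g'| ≤ G) (h0 : 0 < τ) (hτT : τ ≤ T) (hEp : 0 < E) (hFp : 0 < F)
    (hE : F ≤ E) (hEle : E ≤ 1) :
    -(2 + 2 * a * G + (G + K)) * max 0 (2 - |y|) ≤
      1 * (ε / 2 * ((4 * a ^ 2 * y ^ 2 * τ⁻¹ - 2 * a) * E) + g' * (τ * (E - F))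
        + g * (-(2 * a * y) * E)
        + (-(E - F) + (a * R ^ 2 * τ⁻¹ * F - a * y ^ 2 * τ⁻¹ * E))) - K * (τ * (E - F)) := by
  obtain ⟨W, hW⟩ : ∃ W, W = τ⁻¹ := ⟨_, rfl⟩
  obtain ⟨C₀, hC₀⟩ : ∃ C, C = 2 + 2 * a * G + (G + K) := ⟨_, rfl⟩
  rw [← hC₀] at hT
  rw [← hC₀, ← hW]
  have haG : 0 ≤ a * G := by positivity
  have hC₀0 : 2 ≤ C₀ := by rw [hC₀]; linarith
  have hτW : τ * W = 1 := by rw [hW]; exact mul_inv_cancel₀ h0.ne'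
  have hWp : 0 < W := by rw [hW]; exact inv_pos.2 h0
  have haW : C₀ ≤ a * W := by
    have h1 : τ * C₀ ≤ a := (mul_le_mul_of_nonneg_right hτT (by linarith)).trans hT
    have h2 : τ * C₀ * W ≤ a * W := mul_le_mul_of_nonneg_right h1 hWp.le
    have h3 : τ * C₀ * W = C₀ := by linear_combination C₀ * hτW
    linarith
  have b1 : -(G * τ * E) ≤ g' * (τ * (E - F)) := by
    have h1 : 0 ≤ τ * (E - F) := mul_nonneg h0.le (by linarith)
    have h2 : τ * (E - F) ≤ τ * E := mul_le_mul_of_nonneg_left (by linarith) h0.le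
    have h3 := mul_le_mul_of_nonneg_right (abs_le.1 hg').1 h1
    have h4 := mul_le_mul_of_nonneg_left h2 hG
    linarith
  have b2 : K * (τ * (E - F)) ≤ K * τ * E := by
    have : 0 ≤ K * τ * F := by positivity
    linarith
  have b3 : -(2 * a * G * |y| * E) ≤ g * (-(2 * a * y) * E) := by
    have h1 : g * y ≤ G * |y| := by
      refine (le_abs_self _).trans ?_
      rw [abs_mul]
      exact mul_le_mul_of_nonneg_right hg (abs_nonneg _)
    linarith [mul_le_mul_of_nonneg_left h1 (by positivity : 0 ≤ 2 * a * E)]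
  have b4 : 0 ≤ a * R ^ 2 * W * F := by positivity
  have key : E * (a * W * y ^ 2 - 2 - 2 * a * G * |y| - (G + K) * τ) ≤
      1 * (ε / 2 * ((4 * a ^ 2 * y ^ 2 * W - 2 * a) * E) + g' * (τ * (E - F))
        + g * (-(2 * a * y) * E)
        + (-(E - F) + (a * R ^ 2 * W * F - a * y ^ 2 * W * E))) - K * (τ * (E - F)) := by
    have e1 : ε / 2 * ((4 * a ^ 2 * y ^ 2 * W - 2 * a) * E)
        = 2 * a * W * y ^ 2 * E - E := by
      linear_combination (2 * a * W * y ^ 2 * E - E) * haε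
    rw [e1]
    linarith
  refine le_trans ?_ key
  have hmax0 : 0 ≤ max 0 (2 - |y|) := le_max_left _ _
  have hτ1 : τ ≤ 1 := hτT.trans hT1
  rcases le_total 1 |y| with hy1 | hy1
  · have h1 : |y| ≤ y ^ 2 := by rw [← sq_abs y]; nlinarith
    have h2 : C₀ * y ^ 2 ≤ a * W * y ^ 2 := mul_le_mul_of_nonneg_right haW (sq_nonneg _)
    have h3 : 0 ≤ a * W * y ^ 2 - 2 - 2 * a * G * |y| - (G + K) * τ := by
      have h4 : 2 * a * G * |y| ≤ 2 * a * G * y ^ 2 :=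
        mul_le_mul_of_nonneg_left h1 (by positivity)
      have h5 : (G + K) * τ ≤ (G + K) * y ^ 2 :=
        mul_le_mul_of_nonneg_left (by linarith) (by positivity)
      rw [hC₀] at h2
      linarith
    have h6 := mul_nonneg hEp.le h3
    have h7 := mul_nonneg (by linarith : 0 ≤ C₀) hmax0
    linarith
  · have h1 : 1 ≤ max 0 (2 - |y|) := le_max_of_le_right (by linarith)
    have h2 : -C₀ ≤ a * W * y ^ 2 - 2 - 2 * a * G * |y| - (G + K) * τ := by
      have h4 : 2 * a * G * |y| ≤ 2 * a * G * 1 :=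
        mul_le_mul_of_nonneg_left hy1 (by positivity)
      have h5 : (G + K) * τ ≤ (G + K) * 1 :=
        mul_le_mul_of_nonneg_left (by linarith) (by positivity)
      have h6 : 0 ≤ a * W * y ^ 2 := by positivity
      rw [hC₀]; linarith
    have h3 := mul_le_mul_of_nonneg_left h2 hEp.le
    have h4 := mul_le_mul_of_nonneg_left h1 (by linarith : 0 ≤ C₀)
    have h5 := mul_le_mul_of_nonneg_left hEle (by linarith : 0 ≤ C₀)
    linarith

/-- Nonnegative supersolutions are integrable against a backward Gaussian. -/
theorem HasC21.exists_gaussian_integral_le (h : HasC21 T ψ ψt ψx ψxx) (hε : 0 < ε) (hK : 0 ≤ K)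
    (hg : ∀ x, HasDerivAt g (g' x) x) (hg' : Continuous g')
    (hgG : ∀ x, |g x| ≤ G) (hgG' : ∀ x, |g' x| ≤ G)
    (hψ : ∀ x, ∀ t ∈ Icc 0 T, 0 ≤ ψ x t)
    (hlow : ∀ x, ∀ t ∈ Ioc 0 T, -K * ψ x t ≤ ψt x t - (ε / 2 * ψxx x t - g x * ψx x t))
    (hT1 : T ≤ 1) (hT : T * (2 + 2 * ε⁻¹ * G + (G + K)) ≤ ε⁻¹) :
    ∃ C, 0 ≤ C ∧ ∀ s ∈ Ioo 0 T, ∀ ρ, 1 ≤ ρ →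
      ∫ y in (-ρ)..ρ, ψ y s * Real.exp (-(ε⁻¹ * y ^ 2 * (T - s)⁻¹)) ≤ C * (T - s)⁻¹ := by
  obtain ⟨a, haε⟩ : ∃ a, a = ε⁻¹ := ⟨_, rfl⟩
  have ha : 0 < a := haε ▸ inv_pos.2 hε
  have haε1 : ε * a = 1 := by rw [haε]; exact mul_inv_cancel₀ hε.ne'
  rw [← haε] at hT ⊢
  have hG : 0 ≤ G := (abs_nonneg _).trans (hgG 0)
  obtain ⟨M, hM0, hM⟩ := exists_bound_of_continuousOn_prod (p := -2) (q := 2)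
    (h.cont.mono (prod_mono (subset_univ _) (le_refl _)))
  set C₀ := 2 + 2 * a * G + (G + K) with hC₀
  have hC₀0 : 2 ≤ C₀ := by rw [hC₀]; have : 0 ≤ a * G := by positivity
                           linarith
  set D := 16 * C₀ * M with hD
  -- D bounds the possible rate of decrease of the weighted integral. It depends on ψ only through
  -- its bound M on [-2, 2] × [0, T], not on R.
  have hD0 : 0 ≤ D := by positivity
  have hgc : Continuous g := continuous_iff_continuousAt.2 fun x => (hg x).continuousAt
  have main : ∀ s ∈ Ioo 0 T, ∀ R, 0 < R →
      ∫ y in (-R)..R, ψ y s * ((T - s) * (Real.exp (-(a * y ^ 2 * (T - s)⁻¹))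
        - Real.exp (-(a * R ^ 2 * (T - s)⁻¹)))) ≤ D := by
    intro s hs R hR
    set m : ℝ → ℝ := fun s => ∫ y in (-R)..R, ψ y s * ((T - s) *
      (Real.exp (-(a * y ^ 2 * (T - s)⁻¹)) - Real.exp (-(a * R ^ 2 * (T - s)⁻¹)))) with hm
    have hw := isWeight_backward_gaussian a R T
    have hER : ∀ y ∈ Icc (-R) R, ∀ r ∈ Ioo 0 T, Real.exp (-(a * R ^ 2 * (T - r)⁻¹)) ≤
        Real.exp (-(a * y ^ 2 * (T - r)⁻¹)) := by
      intro y hy r hr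
      have h0 : 0 < T - r := sub_pos.2 hr.2
      have h1 : y ^ 2 ≤ R ^ 2 := sq_le_sq' hy.1 hy.2
      rw [Real.exp_le_exp]
      gcongr
    have hE1 : ∀ y, ∀ r ∈ Ioo 0 T, Real.exp (-(a * y ^ 2 * (T - r)⁻¹)) ≤ 1 := by
      intro y r hr
      have h0 : 0 < T - r := sub_pos.2 hr.2
      rw [Real.exp_le_one_iff, neg_nonpos]
      positivity
    have hderiv : ∀ r ∈ Ioo 0 T, ∃ m', HasDerivAt m m' r ∧ -D ≤ m' := by
      intro r hr
      have h0 : 0 < T - r := sub_pos.2 hr.2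
      have hrT : r ∈ Ioc 0 T := Ioo_subset_Ioc_self hr
      have k0 : Continuous fun y => ψ y r := continuous_iff_continuousAt.2 fun x =>
        (h.hasDeriv_x x r hrT).continuousAt
      obtain ⟨m', hm', hle⟩ := h.exists_hasDerivAt_ge (K := K) 1 hg hg' hε hψ
        (by simpa only [one_mul] using hlow) (p := -R) (q := R)
        (by linarith) le_rfl le_rfl hw hr (by simp) (by simp)
        (fun y hy => mul_nonneg h0.le (sub_nonneg.2 (hER y hy r hr)))
        (by
          -- The boundary term has the right sign: ψ ≥ 0, and the weight decreases at R and
          -- increases at -R.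
          have h1 := hψ R r (Ioc_subset_Icc_self hrT)
          have h2 := hψ (-R) r (Ioc_subset_Icc_self hrT)
          have h3 : 0 ≤ 2 * a * R * Real.exp (-(a * R ^ 2 * (T - r)⁻¹)) := by positivity
          have e : (-R) ^ 2 = R ^ 2 := by ring
          rw [e]
          nlinarith [mul_nonneg h1 h3, mul_nonneg h2 h3])
        (ω := fun y => -C₀ * max 0 (2 - |y|))
        (Continuous.intervalIntegrable (by fun_prop) _ _)
        (by
          intro y hy
          have hE := hER y hy r hr
          have hEle := hE1 y r hr
          exact backward_weight_bound ha haε1 hG hK hT1 hT (hgG y) (hgG' y) h0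
            (by linarith [hr.1]) (Real.exp_pos _) (Real.exp_pos _) hE hEle)
      rw [one_mul] at hle
      refine ⟨m', hm', le_trans ?_ hle⟩
      -- Comparison with the multiple 4/(1 + y²) of an integrable function gives one bound for every
      -- R, whether or not [-R, R] contains [-2, 2].
      have hlowω : ∀ y ∈ Icc (-R) R,
          -(4 * C₀ * M) * (1 + y ^ 2)⁻¹ ≤ ψ y r * (-C₀ * max 0 (2 - |y|)) := by
        intro y _
        have hy0 : 0 < 1 + y ^ 2 := by positivity
        have hpos : 0 ≤ (1 + y ^ 2)⁻¹ := by positivity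
        rcases le_total 2 |y| with hy2 | hy2
        · rw [max_eq_left (by linarith)]
          have : 0 ≤ 4 * C₀ * M * (1 + y ^ 2)⁻¹ := by positivity
          linarith
        · rw [max_eq_right (by linarith)]
          have h1 : ψ y r ≤ M := (le_abs_self _).trans
            (hM y (abs_le.1 hy2) r (Ioc_subset_Icc_self hrT))
          have h2 : 2 - |y| ≤ 4 * (1 + y ^ 2)⁻¹ := by
            rw [← div_eq_mul_inv, le_div_iff₀ hy0, ← sq_abs y]
            nlinarith [abs_nonneg y, mul_nonneg (abs_nonneg y) (sq_nonneg (|y| - 1))]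
          have h3 : ψ y r * (2 - |y|) ≤ M * (4 * (1 + y ^ 2)⁻¹) :=
            mul_le_mul h1 h2 (by linarith) hM0
          nlinarith
      have hI := intervalIntegral.integral_mono_on (μ := volume) (by linarith : -R ≤ R)
        (Continuous.intervalIntegrable (by
          have : Continuous fun y : ℝ => (1 + y ^ 2)⁻¹ :=
            Continuous.inv₀ (by fun_prop) fun y => by positivity
          fun_prop) _ _)
        (Continuous.intervalIntegrable (by fun_prop) _ _) hlowω
      rw [intervalIntegral.integral_const_mul] at hI
      have := integral_inv_one_add_sq_le R
      have h4 : 0 ≤ 4 * C₀ * M := by positivity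
      refine le_trans ?_ hI
      rw [hD]
      nlinarith
    have hmono : MonotoneOn (fun r => m r + D * r) (Ioo 0 T) := by
      refine monotoneOn_of_deriv_nonneg (convex_Ioo 0 T) ?_ ?_ ?_
      · intro r hr
        obtain ⟨m', hm', -⟩ := hderiv r hr
        exact (hm'.continuousAt.continuousWithinAt).add (by fun_prop)
      · intro r hr
        rw [interior_Ioo] at hr
        obtain ⟨m', hm', -⟩ := hderiv r hr
        exact (hm'.differentiableAt.differentiableWithinAt).add (by fun_prop)
      · intro r hr
        rw [interior_Ioo] at hr
        obtain ⟨m', hm', hle⟩ := hderiv r hr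
        have : HasDerivAt (fun r => m r + D * r) (m' + D * 1) r :=
          hm'.fun_add ((hasDerivAt_id r).const_mul D)
        rw [this.deriv]; linarith
    obtain ⟨N, hN0, hN⟩ := exists_bound_of_continuousOn_prod (p := -R) (q := R)
      (h.cont.mono (prod_mono (subset_univ _) (le_refl _)))
    -- The constant N depends on R, but it disappears in the limit r → T; only the monotonicity of m
    -- + D r survives.
    have hsmall : ∀ r ∈ Ioo 0 T, m r ≤ (T - r) * (N * (2 * R)) := by
      intro r hr
      have h0 : 0 < T - r := sub_pos.2 hr.2
      have k0 : Continuous fun y => ψ y r := continuous_iff_continuousAt.2 fun x =>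
        (h.hasDeriv_x x r (Ioo_subset_Ioc_self hr)).continuousAt
      have := intervalIntegral.integral_mono_on (μ := volume) (by linarith : -R ≤ R)
        (f := fun y => ψ y r * ((T - r) * (Real.exp (-(a * y ^ 2 * (T - r)⁻¹))
          - Real.exp (-(a * R ^ 2 * (T - r)⁻¹)))))
        (g := fun _ => (T - r) * N)
        (Continuous.intervalIntegrable (by fun_prop) _ _)
        (Continuous.intervalIntegrable (by fun_prop) _ _) (fun y hy => by
          have h1 : ψ y r ≤ N := (le_abs_self _).trans (hN y hy r (Ioo_subset_Icc_self hr))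
          have h2 := hER y hy r hr
          have h3 := hE1 y r hr
          have h4 := Real.exp_pos (-(a * R ^ 2 * (T - r)⁻¹))
          have h5 : (T - r) * (Real.exp (-(a * y ^ 2 * (T - r)⁻¹))
            - Real.exp (-(a * R ^ 2 * (T - r)⁻¹))) ≤ T - r := by nlinarith
          have h6 := mul_le_mul h1 h5 (mul_nonneg h0.le (sub_nonneg.2 h2)) hN0
          linarith)
      rw [intervalIntegral.integral_const, smul_eq_mul] at this
      calc m r ≤ _ := this
        _ = _ := by ring
    have hlim : ∀ r ∈ Ioo s T, m s ≤ (T - r) * (N * (2 * R)) + D := by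
      intro r hr
      have hr' : r ∈ Ioo 0 T := ⟨hs.1.trans hr.1, hr.2⟩
      have h1 := hmono hs hr' hr.1.le
      have h2 := hsmall r hr'
      simp only at h1
      have h3 : D * (r - s) ≤ D * 1 :=
        mul_le_mul_of_nonneg_left (by linarith [hs.1, hr.2]) hD0
      linarith
    have ht : Tendsto (fun r => (T - r) * (N * (2 * R)) + D) (𝓝[<] T) (𝓝 D) := by
      have : Continuous fun r => (T - r) * (N * (2 * R)) + D := by fun_prop
      have h1 := this.tendsto T
      simp only [sub_self, zero_mul, zero_add] at h1
      exact h1.mono_left nhdsWithin_le_nhds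
    exact ge_of_tendsto ht (by
      filter_upwards [Ioo_mem_nhdsLT hs.2] with r hr using hlim r hr)
  refine ⟨2 * D, by positivity, fun s hs ρ hρ => ?_⟩
  have h0 : 0 < T - s := sub_pos.2 hs.2
  have hsT : s ∈ Ioc 0 T := Ioo_subset_Ioc_self hs
  have k0 : Continuous fun y => ψ y s := continuous_iff_continuousAt.2 fun x =>
    (h.hasDeriv_x x s hsT).continuousAt
  have hp : ∀ y, 0 ≤ ψ y s := fun y => hψ y s (Ioc_subset_Icc_self hsT)
  -- At radius 2ρ the subtracted constant is at most half of the Gaussian on [-ρ, ρ], so the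
  -- truncated weight there is at least half of the full one.
  have h1 := main s hs (2 * ρ) (by linarith)
  obtain ⟨W, hW⟩ : ∃ W, W = (T - s)⁻¹ := ⟨_, rfl⟩
  have hWp : 0 < W := by rw [hW]; exact inv_pos.2 h0
  have hτW : (T - s) * W = 1 := by rw [hW]; exact mul_inv_cancel₀ h0.ne'
  rw [← hW] at h1 ⊢
  have haW : 1 ≤ a * W := by
    have h1 : (T - s) * C₀ ≤ a := (mul_le_mul_of_nonneg_right (by linarith [hs.1])
      (by linarith)).trans hT
    have h2 : (T - s) * C₀ * W ≤ a * W := mul_le_mul_of_nonneg_right h1 hWp.le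
    have h3 : (T - s) * C₀ * W = C₀ := by linear_combination C₀ * hτW
    linarith
  have hcont : Continuous fun y => ψ y s * ((T - s) * (Real.exp (-(a * y ^ 2 * W))
        - Real.exp (-(a * (2 * ρ) ^ 2 * W)))) := by fun_prop
  have h2 : ∫ y in (-ρ)..ρ, ψ y s * ((T - s) * (Real.exp (-(a * y ^ 2 * W))
        - Real.exp (-(a * (2 * ρ) ^ 2 * W)))) ≤ D := by
    refine le_trans (intervalIntegral.integral_mono_interval (by linarith) (by linarith)
      (by linarith) ?_ (hcont.intervalIntegrable _ _)) h1
    filter_upwards [ae_restrict_mem measurableSet_Ioc] with y hy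
    refine mul_nonneg (hp y) (mul_nonneg h0.le (sub_nonneg.2 ?_))
    rw [Real.exp_le_exp]
    have : y ^ 2 ≤ (2 * ρ) ^ 2 := sq_le_sq' (by linarith [hy.1]) hy.2
    gcongr
  have h3 : ∫ y in (-ρ)..ρ, (T - s) / 2 * (ψ y s * Real.exp (-(a * y ^ 2 * W))) ≤ D := by
    refine le_trans (intervalIntegral.integral_mono_on (by linarith)
      (Continuous.intervalIntegrable (by fun_prop) _ _) (hcont.intervalIntegrable _ _) ?_) h2
    intro y hy
    have h4 : Real.exp (-(a * (2 * ρ) ^ 2 * W)) ≤ Real.exp (-(a * y ^ 2 * W)) / 2 := by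
      have e1 : -(a * (2 * ρ) ^ 2 * W) = -(a * y ^ 2 * W) + -(a * W * (4 * ρ ^ 2 - y ^ 2)) := by
        ring
      rw [e1, Real.exp_add, div_eq_mul_inv]
      refine mul_le_mul_of_nonneg_left ?_ (Real.exp_pos _).le
      rw [Real.exp_neg]
      refine inv_anti₀ (by norm_num) ?_
      have h5 : y ^ 2 ≤ ρ ^ 2 := sq_le_sq' hy.1 hy.2
      have h6 : 1 ≤ a * W * (4 * ρ ^ 2 - y ^ 2) := by nlinarith
      linarith [Real.add_one_le_exp (a * W * (4 * ρ ^ 2 - y ^ 2))]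
    have h5 : (T - s) / 2 * (ψ y s * Real.exp (-(a * y ^ 2 * W)))
        = ψ y s * ((T - s) * (Real.exp (-(a * y ^ 2 * W)) / 2)) := by ring
    rw [h5]
    exact mul_le_mul_of_nonneg_left (mul_le_mul_of_nonneg_left (by linarith) h0.le) (hp y)
  rw [intervalIntegral.integral_const_mul] at h3
  set I := ∫ y in (-ρ)..ρ, ψ y s * Real.exp (-(a * y ^ 2 * W))
  have h6 := mul_le_mul_of_nonneg_right h3 hWp.le
  have h7 : (T - s) / 2 * I * W = I / 2 := by linear_combination I / 2 * hτW
  linarith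

end
end ViscousHJ

/-! ### Forward Gaussian test functions and uniqueness of nonnegative solutions -/

namespace ViscousHJ

open Filter Topology MeasureTheory

/-- With r = R⁻² the squared cut-off vanishes to second order at y = ±R, so there are no boundary
terms; the exponent increases linearly in time at rate k. -/
theorem isWeight_forward_gaussian (b k r s₀ s₁ : ℝ) :
    IsWeight s₀ s₁
      (fun y s => (1 - r * y ^ 2) ^ 2 * Real.exp (-((b + k * (s - s₀)) * y ^ 2)))
      (fun y s => -(k * y ^ 2) *
        ((1 - r * y ^ 2) ^ 2 * Real.exp (-((b + k * (s - s₀)) * y ^ 2))))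
      (fun y s => (-(4 * r * y * (1 - r * y ^ 2)) - 2 * (b + k * (s - s₀)) * y
        * (1 - r * y ^ 2) ^ 2) * Real.exp (-((b + k * (s - s₀)) * y ^ 2)))
      (fun y s => (4 * (b + k * (s - s₀)) ^ 2 * y ^ 2 * (1 - r * y ^ 2) ^ 2
        - 2 * (b + k * (s - s₀)) * (1 - r * y ^ 2) ^ 2
        + 16 * (b + k * (s - s₀)) * r * y ^ 2 * (1 - r * y ^ 2) - 4 * r * (1 - r * y ^ 2)
        + 8 * r ^ 2 * y ^ 2) * Real.exp (-((b + k * (s - s₀)) * y ^ 2))) := by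
  have hdy : ∀ y s, HasDerivAt (fun y => Real.exp (-((b + k * (s - s₀)) * y ^ 2)))
      (-(2 * (b + k * (s - s₀)) * y) * Real.exp (-((b + k * (s - s₀)) * y ^ 2))) y := by
    intro y s
    refine ((((hasDerivAt_pow 2 y).const_mul (b + k * (s - s₀)))).fun_neg.exp).congr_deriv ?_
    simp; ring
  have hp : ∀ y : ℝ, HasDerivAt (fun y => 1 - r * y ^ 2) (-(2 * r * y)) y := by
    intro y
    refine (((hasDerivAt_pow 2 y).const_mul r).const_sub 1).congr_deriv ?_
    simp; ring
  have hp2 : ∀ y : ℝ, HasDerivAt (fun y => (1 - r * y ^ 2) ^ 2)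
      (-(4 * r * y * (1 - r * y ^ 2))) y := by
    intro y
    refine ((hp y).fun_pow 2).congr_deriv ?_
    simp; ring
  refine ⟨by fun_prop, by fun_prop, fun s _ => by fun_prop, ?_, ?_, ?_⟩
  · intro y s _
    have h1 : HasDerivAt (fun s => -((b + k * (s - s₀)) * y ^ 2)) (-((k * 1) * y ^ 2)) s :=
      (((((hasDerivAt_id s).sub_const s₀).const_mul k).const_add b).mul_const _).fun_neg
    refine (h1.exp.const_mul _).congr_deriv ?_
    ring
  · intro y s _
    refine ((hp2 y).fun_mul (hdy y s)).congr_deriv ?_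
    ring
  · intro y s _
    have h1 : HasDerivAt (fun y : ℝ => 4 * r * y) (4 * r * 1) y :=
      (hasDerivAt_id y).const_mul _
    have h2 : HasDerivAt (fun y : ℝ => 2 * (b + k * (s - s₀)) * y)
      (2 * (b + k * (s - s₀)) * 1) y := (hasDerivAt_id y).const_mul _
    refine ((((h1.fun_mul (hp y)).fun_neg).fun_sub (h2.fun_mul (hp2 y))).fun_mul
      (hdy y s)).congr_deriv ?_
    ring

/-- While the exponent β stays in [b, 2b], the growth rate 8 ε b² + 4 G b produces a term that
absorbs every contribution quadratic in y from diffusion and drift. The remaining terms are a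
multiple of the weight itself, fit for Grönwall, and cut-off errors carrying the small factor r. -/
theorem forward_weight_bound {ε G K b β r p E g g' y : ℝ} (hε : 0 < ε) (hG : 0 ≤ G)
    (hb : 0 < b) (hg : |g| ≤ G) (hg' : |g'| ≤ G) (hE : 0 < E) (hr : 0 < r)
    (hp : p = 1 - r * y ^ 2) (hp0 : 0 ≤ p) (hβ1 : b ≤ β) (hβ2 : β ≤ 2 * b) :
    -((G + K + 4 * G * b) * (p ^ 2 * E) + r * (16 * ε * b + 4 * ε + 4 * G) * ((1 + y ^ 2) * E)) ≤
      -1 * (ε / 2 * ((4 * β ^ 2 * y ^ 2 * p ^ 2 - 2 * β * p ^ 2 + 16 * β * r * y ^ 2 * p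
        - 4 * r * p + 8 * r ^ 2 * y ^ 2) * E) + g' * (p ^ 2 * E)
        + g * ((-(4 * r * y * p) - 2 * β * y * p ^ 2) * E)
        + -((8 * ε * b ^ 2 + 4 * G * b) * y ^ 2) * (p ^ 2 * E)) - K * (p ^ 2 * E) := by
  have hβ : 0 < β := hb.trans_le hβ1
  have hp1 : p ≤ 1 := by rw [hp]; have : 0 ≤ r * y ^ 2 := by positivity
                         linarith
  have hry : r * y ^ 2 ≤ 1 := by linarith
  have hy1 : |y| ≤ 1 + y ^ 2 := by rw [← sq_abs y]; nlinarith [sq_nonneg (|y| - 1), abs_nonneg y]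
  have a1 : 2 * ε * β ^ 2 * y ^ 2 * p ^ 2 ≤ 8 * ε * b ^ 2 * y ^ 2 * p ^ 2 := by
    have : β ^ 2 ≤ (2 * b) ^ 2 := by gcongr
    have h2 := mul_le_mul_of_nonneg_left this (by positivity : 0 ≤ 2 * ε * y ^ 2 * p ^ 2)
    linarith
  have a2 : 0 ≤ ε * β * p ^ 2 := by positivity
  have a3 : 8 * ε * β * r * y ^ 2 * p ≤ r * (16 * ε * b) * (1 + y ^ 2) := by
    have h1 : β * p ≤ 2 * b * 1 := mul_le_mul hβ2 hp1 hp0 (by positivity)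
    have h2 := mul_le_mul_of_nonneg_left h1 (by positivity : 0 ≤ 8 * ε * r * y ^ 2)
    have h3 : 0 ≤ r * (16 * ε * b) := by positivity
    linarith
  have a4 : 0 ≤ 2 * ε * r * p := by positivity
  have a5 : 4 * ε * r ^ 2 * y ^ 2 ≤ r * (4 * ε) * (1 + y ^ 2) := by
    have h2 := mul_le_mul_of_nonneg_left hry (by positivity : 0 ≤ 4 * ε * r)
    have h3 : 0 ≤ r * (4 * ε) * y ^ 2 := by positivity
    linarith
  have a6 : g' * p ^ 2 ≤ G * p ^ 2 :=
    mul_le_mul_of_nonneg_right ((le_abs_self _).trans hg') (by positivity)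
  have hgy : -(g * y) ≤ G * (1 + y ^ 2) := by
    refine (neg_le_abs _).trans ?_
    rw [abs_mul]
    exact mul_le_mul hg hy1 (abs_nonneg _) hG
  have a7 : -(g * y) * (4 * r * p) ≤ r * (4 * G) * (1 + y ^ 2) := by
    have h1 := mul_le_mul_of_nonneg_right hgy (by positivity : 0 ≤ 4 * r * p)
    have h2 := mul_le_mul_of_nonneg_left hp1 (by positivity : 0 ≤ G * (1 + y ^ 2) * (4 * r))
    linarith
  have a8 : -(g * y) * (2 * β * p ^ 2) ≤ (4 * G * b) * p ^ 2 + 4 * G * b * y ^ 2 * p ^ 2 := by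
    have h1 := mul_le_mul_of_nonneg_right hgy (by positivity : 0 ≤ 2 * β * p ^ 2)
    have h2 := mul_le_mul_of_nonneg_left hβ2 (by positivity : 0 ≤ G * (1 + y ^ 2) * (2 * p ^ 2))
    linarith
  have := mul_le_mul_of_nonneg_right (a := E) (add_le_add (add_le_add (add_le_add a1 a3)
    (add_le_add a5 a6)) (add_le_add a7 a8)) hE.le
  have b2 := mul_nonneg a2 hE.le
  have b4 := mul_nonneg a4 hE.le
  linarith

section
variable {ε K G T : ℝ} {g g' : ℝ → ℝ} {ψ ψt ψx ψxx : ℝ → ℝ → ℝ}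

/-- A nonnegative subsolution which vanishes at time `s₀` and is integrable against a Gaussian
vanishes on a further time interval. -/
theorem HasC21.exists_eq_zero_of_gaussian_integral_le (h : HasC21 T ψ ψt ψx ψxx) (hε : 0 < ε)
    (hK : 0 ≤ K) (hg : ∀ x, HasDerivAt g (g' x) x) (hg' : Continuous g')
    (hgG : ∀ x, |g x| ≤ G) (hgG' : ∀ x, |g' x| ≤ G)
    (hψ : ∀ x, ∀ t ∈ Icc 0 T, 0 ≤ ψ x t)
    (hup : ∀ x, ∀ t ∈ Ioc 0 T, ψt x t - (ε / 2 * ψxx x t - g x * ψx x t) ≤ K * ψ x t)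
    {s₀ s₁ c B : ℝ} (hs₀ : 0 ≤ s₀) (hs : s₀ < s₁) (hs₁ : s₁ ≤ T) (hc : 0 < c) (hB : 0 ≤ B)
    (hI : ∀ s ∈ Ioo s₀ s₁, ∀ ρ, 1 ≤ ρ →
      ∫ y in (-ρ)..ρ, ψ y s * Real.exp (-(c * y ^ 2)) ≤ B)
    (hz : ∀ x, ψ x s₀ = 0) :
    ∃ s₂ ∈ Ioc s₀ s₁, ∀ s ∈ Icc s₀ s₂, ∀ x, ψ x s = 0 := by
  have hG : 0 ≤ G := (abs_nonneg _).trans (hgG 0)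
  -- Doubling c leaves two factors exp(-c y²): one absorbs the polynomial 1 + y² of the cut-off
  -- error, the other is integrable against ψ by `hI`.
  obtain ⟨b, hbc⟩ : ∃ b, b = 2 * c := ⟨_, rfl⟩
  have hb : 0 < b := by rw [hbc]; positivity
  obtain ⟨k, hk⟩ : ∃ k, k = 8 * ε * b ^ 2 + 4 * G * b := ⟨_, rfl⟩
  have hk0 : 0 < k := by rw [hk]; positivity
  -- Up to time s₀ + b/k the exponent b + k (s - s₀) does not exceed 2b.
  obtain ⟨s₂, hs₂⟩ : ∃ s₂, s₂ = min s₁ (s₀ + b / k) := ⟨_, rfl⟩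
  have h02 : s₀ < s₂ := by
    rw [hs₂]; exact lt_min hs (by have : 0 < b / k := by positivity
                                  linarith)
  have h21 : s₂ ≤ s₁ := hs₂ ▸ min_le_left _ _
  have hβ : ∀ s ∈ Icc s₀ s₂, b ≤ b + k * (s - s₀) ∧ b + k * (s - s₀) ≤ 2 * b := by
    intro s hs
    have h1 : 0 ≤ k * (s - s₀) := mul_nonneg hk0.le (by linarith [hs.1])
    have h2 : s - s₀ ≤ b / k := by
      have : s₂ ≤ s₀ + b / k := hs₂ ▸ min_le_right _ _
      linarith [hs.2]
    have h3 : k * (s - s₀) ≤ b := by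
      rw [le_div_iff₀ hk0] at h2; linarith
    constructor <;> linarith
  obtain ⟨C₃, hC₃⟩ : ∃ C, C = G + K + 4 * G * b := ⟨_, rfl⟩
  obtain ⟨C₄, hC₄⟩ : ∃ C, C = 16 * ε * b + 4 * ε + 4 * G := ⟨_, rfl⟩
  have hC₃0 : 0 ≤ C₃ := by rw [hC₃]; positivity
  have hC₄0 : 0 ≤ C₄ := by rw [hC₄]; positivity
  obtain ⟨D, hD⟩ : ∃ D, D = C₄ * ((1 + c⁻¹) * B) := ⟨_, rfl⟩
  have hD0 : 0 ≤ D := by rw [hD]; positivity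
  have hsub : Icc s₀ s₂ ⊆ Icc 0 T := Icc_subset_Icc hs₀ (h21.trans hs₁)
  -- weighted integrals are small
  have main : ∀ R, 1 ≤ R → ∀ s ∈ Icc s₀ s₂,
      ∫ y in (-R)..R, ψ y s * ((1 - (R ^ 2)⁻¹ * y ^ 2) ^ 2 *
        Real.exp (-((b + k * (s - s₀)) * y ^ 2)))
      ≤ Real.exp (C₃ * (s₂ - s₀)) * (D * (s₂ - s₀)) * (R ^ 2)⁻¹ := by
    intro R hR
    have hR0 : 0 < R := by linarith
    obtain ⟨r, hrd⟩ : ∃ r, r = (R ^ 2)⁻¹ := ⟨_, rfl⟩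
    have hr : 0 < r := by rw [hrd]; positivity
    have hrR : r * R ^ 2 = 1 := by rw [hrd]; exact inv_mul_cancel₀ (by positivity)
    rw [← hrd]
    set n : ℝ → ℝ := fun s => ∫ y in (-R)..R, ψ y s * ((1 - r * y ^ 2) ^ 2 *
        Real.exp (-((b + k * (s - s₀)) * y ^ 2))) with hn
    have hw := isWeight_forward_gaussian b k r s₀ s₂
    have hpnn : ∀ y ∈ Icc (-R) R, 0 ≤ 1 - r * y ^ 2 := by
      intro y hy
      have h1 : y ^ 2 ≤ R ^ 2 := sq_le_sq' hy.1 hy.2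
      have := mul_le_mul_of_nonneg_left h1 hr.le
      linarith
    have hderiv : ∀ s ∈ Ioo s₀ s₂, ∃ n', HasDerivAt n n' s ∧ n' ≤ C₃ * n s + r * D := by
      intro s hs
      have hsT : s ∈ Ioc 0 T := ⟨hs₀.trans_lt hs.1, (hs.2.le.trans h21).trans hs₁⟩
      have hβs := hβ s (Ioo_subset_Icc_self hs)
      have k0 : Continuous fun y => ψ y s := continuous_iff_continuousAt.2 fun x =>
        (h.hasDeriv_x x s hsT).continuousAt
      have hp0 : ∀ y, 0 ≤ ψ y s := fun y => hψ y s (Ioc_subset_Icc_self hsT)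
      have e1 : 1 - r * R ^ 2 = 0 := by linarith
      have e2 : 1 - r * (-R) ^ 2 = 0 := by rw [neg_sq]; exact e1
      obtain ⟨n', hn', hle⟩ := h.exists_hasDerivAt_ge (K := K) (-1) hg hg' hε hψ
        (fun x t ht => by linarith [hup x t ht]) (p := -R) (q := R)
        (by linarith) hs₀ (h21.trans hs₁) hw hs (by simp [e1]) (by simp [e1])
        (fun y hy => by positivity)
        (by simp [e1])
        (ω := fun y => -(C₃ * ((1 - r * y ^ 2) ^ 2 * Real.exp (-((b + k * (s - s₀)) * y ^ 2)))
          + r * C₄ * ((1 + y ^ 2) * Real.exp (-((b + k * (s - s₀)) * y ^ 2)))))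
        (Continuous.intervalIntegrable (by fun_prop) _ _)
        (by
          intro y hy
          have := forward_weight_bound (K := K) (E := Real.exp (-((b + k * (s - s₀)) * y ^ 2)))
            hε hG hb (hgG y) (hgG' y) (Real.exp_pos _) hr rfl (hpnn y hy) hβs.1 hβs.2
          rw [hC₃, hC₄]
          rw [← hk] at this
          exact this)
      refine ⟨n', hn', ?_⟩
      have e3 : (fun y => ψ y s * -(C₃ * ((1 - r * y ^ 2) ^ 2 *
          Real.exp (-((b + k * (s - s₀)) * y ^ 2)))
          + r * C₄ * ((1 + y ^ 2) * Real.exp (-((b + k * (s - s₀)) * y ^ 2)))))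
          = fun y => -(C₃ * (ψ y s * ((1 - r * y ^ 2) ^ 2 *
          Real.exp (-((b + k * (s - s₀)) * y ^ 2))))
          + r * C₄ * (ψ y s * ((1 + y ^ 2) * Real.exp (-((b + k * (s - s₀)) * y ^ 2))))) := by
        funext y; ring
      rw [e3, intervalIntegral.integral_neg, intervalIntegral.integral_add
        (Continuous.intervalIntegrable (by fun_prop) _ _)
        (Continuous.intervalIntegrable (by fun_prop) _ _),
        intervalIntegral.integral_const_mul, intervalIntegral.integral_const_mul] at hle
      have h5 : ∫ y in (-R)..R, ψ y s * ((1 + y ^ 2) * Real.exp (-((b + k * (s - s₀)) * y ^ 2)))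
          ≤ ∫ y in (-R)..R, (1 + c⁻¹) * (ψ y s * Real.exp (-(c * y ^ 2))) := by
        refine intervalIntegral.integral_mono_on (by linarith)
          (Continuous.intervalIntegrable (by fun_prop) _ _)
          (Continuous.intervalIntegrable (by fun_prop) _ _) fun y hy => ?_
        have h6 : Real.exp (-((b + k * (s - s₀)) * y ^ 2)) ≤
            Real.exp (-(c * y ^ 2)) * Real.exp (-(c * y ^ 2)) := by
          rw [← Real.exp_add, Real.exp_le_exp]
          have := mul_le_mul_of_nonneg_right hβs.1 (sq_nonneg y)
          rw [hbc] at this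
          nlinarith
        have h7 : (1 + y ^ 2) * Real.exp (-(c * y ^ 2)) ≤ 1 + c⁻¹ := by
          have h8 := Real.add_one_le_exp (c * y ^ 2)
          rw [Real.exp_neg, ← div_eq_mul_inv, div_le_iff₀ (Real.exp_pos _)]
          have h9 : 1 + y ^ 2 ≤ (1 + c⁻¹) * (c * y ^ 2 + 1) := by
            have : (1 + c⁻¹) * (c * y ^ 2 + 1) = 1 + y ^ 2 + c * y ^ 2 + c⁻¹ := by
              field_simp; ring
            rw [this]
            have : 0 ≤ c * y ^ 2 + c⁻¹ := by positivity
            linarith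
          exact h9.trans (mul_le_mul_of_nonneg_left h8 (by positivity))
        calc ψ y s * ((1 + y ^ 2) * Real.exp (-((b + k * (s - s₀)) * y ^ 2)))
            ≤ ψ y s * ((1 + y ^ 2) * (Real.exp (-(c * y ^ 2)) * Real.exp (-(c * y ^ 2)))) := by
              gcongr; exact hp0 y
          _ = ((1 + y ^ 2) * Real.exp (-(c * y ^ 2))) * (ψ y s * Real.exp (-(c * y ^ 2))) := by
              ring
          _ ≤ _ := mul_le_mul_of_nonneg_right h7 (mul_nonneg (hp0 y) (Real.exp_pos _).le)
      rw [intervalIntegral.integral_const_mul] at h5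
      have h6 := hI s ⟨hs.1, hs.2.trans_le h21⟩ R hR
      have h7 := h5.trans (mul_le_mul_of_nonneg_left h6 (by positivity))
      have h8 := mul_le_mul_of_nonneg_left h7 (by positivity : 0 ≤ r * C₄)
      rw [hD]
      change n' ≤ C₃ * n s + _
      have e4 : ∫ y in (-R)..R, ψ y s * ((1 - r * y ^ 2) ^ 2 *
        Real.exp (-((b + k * (s - s₀)) * y ^ 2))) = n s := rfl
      rw [e4] at hle
      linarith
    have hcont : ContinuousOn n (Icc s₀ s₂) := by
      refine continuousOn_intervalIntegral (Φ := fun y s => ψ y s * ((1 - r * y ^ 2) ^ 2 *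
        Real.exp (-((b + k * (s - s₀)) * y ^ 2)))) (by linarith) ?_
      exact (h.cont.mono (prod_mono (subset_univ _) hsub)).mul (by fun_prop)
    -- Grönwall's inequality by an integrating factor: this quantity is nonincreasing and vanishes
    -- at s₀.
    have hder2 : ∀ s n', HasDerivAt n n' s → HasDerivAt
        (fun s => Real.exp (-(C₃ * (s - s₀))) * n s - r * D * (s - s₀))
        (Real.exp (-(C₃ * (s - s₀))) * (n' - C₃ * n s) - r * D) s := by
      intro s n' hn'
      have h1 : HasDerivAt (fun s => -(C₃ * (s - s₀))) (-(C₃ * 1)) s :=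
        (((hasDerivAt_id s).sub_const s₀).const_mul C₃).fun_neg
      have h2 : HasDerivAt (fun s => r * D * (s - s₀)) (r * D * 1) s :=
        ((hasDerivAt_id s).sub_const s₀).const_mul _
      refine ((h1.exp.fun_mul hn').fun_sub h2).congr_deriv ?_
      ring
    have hanti : AntitoneOn (fun s => Real.exp (-(C₃ * (s - s₀))) * n s - r * D * (s - s₀))
        (Icc s₀ s₂) := by
      refine antitoneOn_of_deriv_nonpos (convex_Icc _ _) ?_ ?_ ?_
      · exact ContinuousOn.sub (ContinuousOn.mul (by fun_prop) hcont) (by fun_prop)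
      · intro s hs
        rw [interior_Icc] at hs
        obtain ⟨n', hn', -⟩ := hderiv s hs
        exact (hder2 s n' hn').differentiableAt.differentiableWithinAt
      · intro s hs
        rw [interior_Icc] at hs
        obtain ⟨n', hn', hle⟩ := hderiv s hs
        rw [(hder2 s n' hn').deriv]
        have h1 : Real.exp (-(C₃ * (s - s₀))) ≤ 1 := by
          rw [Real.exp_le_one_iff, neg_nonpos]
          exact mul_nonneg hC₃0 (by linarith [hs.1])
        have h2 : 0 ≤ r * D := by positivity
        have h3 := mul_le_mul_of_nonneg_left (by linarith : n' - C₃ * n s ≤ r * D)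
          (Real.exp_pos (-(C₃ * (s - s₀)))).le
        have h4 := mul_le_mul_of_nonneg_right h1 h2
        linarith
    intro s hs
    have h1 := hanti (left_mem_Icc.2 h02.le) hs hs.1
    have hn0 : n s₀ = 0 := by
      simp [hn, hz]
    simp only [hn0, sub_self, mul_zero] at h1
    have h2 : Real.exp (-(C₃ * (s - s₀))) * n s ≤ r * D * (s₂ - s₀) := by
      have : r * D * (s - s₀) ≤ r * D * (s₂ - s₀) :=
        mul_le_mul_of_nonneg_left (by linarith [hs.2]) (by positivity)
      linarith
    have h3 := mul_le_mul_of_nonneg_left h2 (Real.exp_pos (C₃ * (s - s₀))).le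
    rw [← mul_assoc, ← Real.exp_add, add_neg_cancel, Real.exp_zero, one_mul] at h3
    have h4 : Real.exp (C₃ * (s - s₀)) ≤ Real.exp (C₃ * (s₂ - s₀)) := by
      rw [Real.exp_le_exp]
      exact mul_le_mul_of_nonneg_left (by linarith [hs.2]) hC₃0
    have h5 : 0 ≤ r * D * (s₂ - s₀) := mul_nonneg (by positivity) (by linarith)
    have h6 := mul_le_mul_of_nonneg_right h4 h5
    change n s ≤ _
    linarith
  refine ⟨s₂, ⟨h02, h21⟩, fun s hs x => ?_⟩
  have hsT := hsub hs
  have k0 : Continuous fun y => ψ y s := continuousOn_univ.1 (continuousOn_slice_fst h.cont hsT)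
  have hp0 : ∀ y, 0 ≤ ψ y s := fun y => hψ y s hsT
  by_contra hne
  have hpos : 0 < ψ x s := lt_of_le_of_ne (hp0 x) (Ne.symm hne)
  obtain ⟨ρ, hρ⟩ : ∃ ρ, ρ = |x| + 1 := ⟨_, rfl⟩
  have hρ1 : 1 ≤ ρ := by rw [hρ]; linarith [abs_nonneg x]
  set I := ∫ y in (-ρ)..ρ, ψ y s * Real.exp (-((b + k * (s - s₀)) * y ^ 2)) with hIdef
  have hIpos : 0 < I := by
    refine intervalIntegral.integral_pos (by linarith) (by fun_prop)
      (fun y _ => mul_nonneg (hp0 y) (Real.exp_pos _).le)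
      ⟨x, ?_, mul_pos hpos (Real.exp_pos _)⟩
    constructor <;> [linarith [neg_abs_le x]; linarith [le_abs_self x]]
  set N := Real.exp (C₃ * (s₂ - s₀)) * (D * (s₂ - s₀)) with hN
  -- For R ≥ 2ρ the cut-off is at least (3/4)² ≥ 1/2 on [-ρ, ρ], so a fixed positive integral is
  -- bounded by a multiple of R⁻².
  have hbound : ∀ R, 2 * ρ ≤ R → I ≤ 2 * N * (R ^ 2)⁻¹ := by
    intro R hR
    have hR0 : 0 < R := by linarith
    have h1 := main R (by linarith) s hs
    have hcont : Continuous fun y => ψ y s * ((1 - (R ^ 2)⁻¹ * y ^ 2) ^ 2 *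
        Real.exp (-((b + k * (s - s₀)) * y ^ 2))) := by fun_prop
    have h2 : ∫ y in (-ρ)..ρ, ψ y s * ((1 - (R ^ 2)⁻¹ * y ^ 2) ^ 2 *
        Real.exp (-((b + k * (s - s₀)) * y ^ 2))) ≤ N * (R ^ 2)⁻¹ := by
      refine le_trans (intervalIntegral.integral_mono_interval (by linarith) (by linarith)
        (by linarith) ?_ (hcont.intervalIntegrable _ _)) h1
      exact ae_of_all _ fun y => mul_nonneg (hp0 y) (by positivity)
    have h3 : ∫ y in (-ρ)..ρ, (1 / 2) * (ψ y s * Real.exp (-((b + k * (s - s₀)) * y ^ 2)))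
        ≤ N * (R ^ 2)⁻¹ := by
      refine le_trans (intervalIntegral.integral_mono_on (by linarith)
        (Continuous.intervalIntegrable (by fun_prop) _ _) (hcont.intervalIntegrable _ _) ?_) h2
      intro y hy
      have h4 : (R ^ 2)⁻¹ * y ^ 2 ≤ 1 / 4 := by
        have : y ^ 2 ≤ ρ ^ 2 := sq_le_sq' hy.1 hy.2
        rw [inv_mul_le_iff₀ (by positivity)]
        nlinarith
      have h5 : 1 / 2 ≤ (1 - (R ^ 2)⁻¹ * y ^ 2) ^ 2 := by nlinarith
      have h6 := mul_le_mul_of_nonneg_right h5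
        (mul_nonneg (hp0 y) (Real.exp_pos (-((b + k * (s - s₀)) * y ^ 2))).le)
      linarith
    rw [intervalIntegral.integral_const_mul] at h3
    linarith
  have hlim : Tendsto (fun R : ℝ => 2 * N * (R ^ 2)⁻¹) atTop (𝓝 (2 * N * 0)) :=
    (tendsto_inv_atTop_zero.comp (tendsto_pow_atTop two_ne_zero)).const_mul _
  rw [mul_zero] at hlim
  have := ge_of_tendsto hlim ((eventually_ge_atTop (2 * ρ)).mono hbound)
  linarith

/-- Uniqueness for nonnegative solutions, without any growth condition. -/
theorem HasC21.eq_zero_of_nonneg (h : HasC21 T ψ ψt ψx ψxx) (hε : 0 < ε) (hK : 0 ≤ K)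
    (hg : ∀ x, HasDerivAt g (g' x) x) (hg' : Continuous g')
    (hgG : ∀ x, |g x| ≤ G) (hgG' : ∀ x, |g' x| ≤ G)
    (hψ : ∀ x, ∀ t ∈ Icc 0 T, 0 ≤ ψ x t)
    (hlu : ∀ x, ∀ t ∈ Ioc 0 T,
      |ψt x t - (ε / 2 * ψxx x t - g x * ψx x t)| ≤ K * ψ x t)
    (hT1 : T ≤ 1) (hT : T * (2 + 2 * ε⁻¹ * G + (G + K)) ≤ ε⁻¹) (hz : ∀ x, ψ x 0 = 0) :
    ∀ x, ∀ t ∈ Icc 0 T, ψ x t = 0 := by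
  obtain ⟨C, hC0, hC⟩ := h.exists_gaussian_integral_le hε hK hg hg' hgG hgG' hψ
    (fun x t ht => by linarith [(abs_le.1 (hlu x t ht)).1]) hT1 hT
  -- The vanishing times form a closed set containing 0 that can be extended to the right of each of
  -- its points before T, hence all of [0, T].
  have hclosed : IsClosed ({t | ∀ x, ψ x t = 0} ∩ Icc 0 T) := by
    have e : {t | ∀ x, ψ x t = 0} ∩ Icc 0 T = Icc 0 T ∩ ⋂ x, (Icc 0 T ∩ (fun t => ψ x t) ⁻¹' {0}) := by
      ext t; simp only [mem_inter_iff, mem_ofPred_eq, mem_iInter, mem_preimage, mem_singleton_iff]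
      constructor
      · rintro ⟨h1, h2⟩; exact ⟨h2, fun x => ⟨h2, h1 x⟩⟩
      · rintro ⟨h1, h2⟩; exact ⟨fun x => (h2 x).2, h1⟩
    rw [e]
    exact isClosed_Icc.inter (isClosed_iInter fun x =>
      (continuousOn_slice_snd h.cont (mem_univ x)).preimage_isClosed_of_isClosed isClosed_Icc
        isClosed_singleton)
  have := hclosed.Icc_subset_of_forall_exists_gt (show (0 : ℝ) ∈ {t | ∀ x, ψ x t = 0} from hz)
    (by
      rintro s₀ ⟨hs₀, hs₀'⟩ t ht
      -- The Gaussian bound degenerates at T, so s₁ is kept strictly below T; taking s₁ ≤ t places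
      -- the new vanishing time in (s₀, t].
      obtain ⟨s₁, hs₁⟩ : ∃ s₁, s₁ = min t ((s₀ + T) / 2) := ⟨_, rfl⟩
      have h01 : s₀ < s₁ := by rw [hs₁]; exact lt_min ht (by linarith [hs₀'.2])
      have h1T : s₁ ≤ (s₀ + T) / 2 := hs₁ ▸ min_le_right _ _
      have hlt : s₁ < T := by linarith [hs₀'.2]
      have hd : 0 < T - s₁ := by linarith
      obtain ⟨s₂, hs₂, h2⟩ := h.exists_eq_zero_of_gaussian_integral_le hε hK hg hg' hgG hgG' hψ
        (fun x t ht => (abs_le.1 (hlu x t ht)).2) hs₀'.1 h01 hlt.le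
        (c := ε⁻¹ * (T - s₁)⁻¹) (B := C * (T - s₁)⁻¹) (by positivity) (by positivity)
        (by
          intro s hs ρ hρ
          have hsT : s ∈ Ioo 0 T := ⟨hs₀'.1.trans_lt hs.1, hs.2.trans hlt⟩
          have h0 : 0 < T - s := by linarith [hsT.2]
          have k0 : Continuous fun y => ψ y s :=
            continuousOn_univ.1 (continuousOn_slice_fst h.cont (Ioo_subset_Icc_self hsT))
          have hinv : (T - s)⁻¹ ≤ (T - s₁)⁻¹ := inv_anti₀ hd (by linarith [hs.2])
          refine le_trans ?_ ((hC s hsT ρ hρ).trans (mul_le_mul_of_nonneg_left hinv hC0))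
          refine intervalIntegral.integral_mono_on (by linarith)
            (Continuous.intervalIntegrable (by fun_prop) _ _)
            (Continuous.intervalIntegrable (by fun_prop) _ _) fun y _ => ?_
          refine mul_le_mul_of_nonneg_left ?_ (hψ y s (Ioo_subset_Icc_self hsT))
          rw [Real.exp_le_exp, neg_le_neg_iff]
          have := mul_le_mul_of_nonneg_left hinv (by positivity : 0 ≤ ε⁻¹ * y ^ 2)
          linarith) hs₀
      exact ⟨s₂, h2 s₂ ⟨hs₂.1.le, le_rfl⟩, hs₂.1, hs₂.2.trans (hs₁ ▸ min_le_left _ _)⟩)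
  intro x t ht
  exact this ht x

end
end ViscousHJ

/-! ### Odd and even extensions, and bounds for the symmetrised coefficients -/

namespace ViscousHJ

open Filter Topology

theorem sign_sq_of_ne_zero {x : ℝ} (hx : x ≠ 0) : Real.sign x * Real.sign x = 1 := by
  rcases lt_or_gt_of_ne hx with h | h
  · rw [Real.sign_of_neg h]; norm_num
  · rw [Real.sign_of_pos h]; norm_num

theorem hasDerivAt_abs_of_ne_zero {x : ℝ} (hx : x ≠ 0) :
    HasDerivAt (fun z : ℝ => |z|) (Real.sign x) x := by
  rcases lt_or_gt_of_ne hx with h | h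
  · rw [Real.sign_of_neg h]; exact hasDerivAt_abs_neg h
  · rw [Real.sign_of_pos h]; exact hasDerivAt_abs_pos h

theorem sign_eventuallyEq {x : ℝ} (hx : x ≠ 0) : Real.sign =ᶠ[𝓝 x] fun _ => Real.sign x := by
  rcases lt_or_gt_of_ne hx with h | h
  · filter_upwards [Iio_mem_nhds h] with z hz
    rw [Real.sign_of_neg h, Real.sign_of_neg hz]
  · filter_upwards [Ioi_mem_nhds h] with z hz
    rw [Real.sign_of_pos h, Real.sign_of_pos hz]

theorem hasDerivAt_comp_abs_of_ne_zero {φ φ' : ℝ → ℝ}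
    (h : ∀ x ∈ Ici (0 : ℝ), HasDerivWithinAt φ (φ' x) (Ici 0) x) {x : ℝ} (hx : x ≠ 0) :
    HasDerivAt (fun z => φ |z|) (Real.sign x * φ' |x|) x := by
  have h0 : 0 < |x| := abs_pos.2 hx
  have h1 : HasDerivAt φ (φ' |x|) |x| := (h |x| h0.le).hasDerivAt (Ici_mem_nhds h0)
  exact (h1.comp x (hasDerivAt_abs_of_ne_zero hx)).congr_deriv (mul_comm _ _)

theorem hasDerivWithinAt_comp_neg_Iic {φ : ℝ → ℝ} {d : ℝ}
    (h : HasDerivWithinAt φ d (Ici 0) 0) : HasDerivWithinAt (fun z => φ (-z)) (-d) (Iic 0) 0 := by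
  have h1 : HasDerivWithinAt φ d (Ici 0) (-0) := by rwa [neg_zero]
  exact (h1.comp (0 : ℝ) (hasDerivAt_neg (0 : ℝ)).hasDerivWithinAt
    (s := Iic 0) (fun z (hz : z ≤ 0) => by simpa using hz)).congr_deriv (mul_neg_one d)

/-- The odd extension of a function vanishing at `0` is differentiable. -/
theorem hasDerivAt_odd_extension {φ φ' : ℝ → ℝ}
    (h : ∀ x ∈ Ici (0 : ℝ), HasDerivWithinAt φ (φ' x) (Ici 0) x) (h0 : φ 0 = 0) (x : ℝ) :
    HasDerivAt (fun z => Real.sign z * φ |z|) (φ' |x|) x := by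
  rcases eq_or_ne x 0 with rfl | hx
  -- At the origin the right branch φ(z) and the left branch -φ(-z) have the same one-sided
  -- derivative, and φ 0 = 0 joins them.
  · have hd := h 0 self_mem_Ici
    rw [abs_zero]
    have e1 : EqOn (fun z => Real.sign z * φ |z|) φ (Ici 0) := by
      intro z hz
      rcases eq_or_lt_of_le (show 0 ≤ z from hz) with rfl | hz'
      · simp [h0]
      · simp [Real.sign_of_pos hz', abs_of_pos hz']
    have e2 : EqOn (fun z => Real.sign z * φ |z|) (fun z => -φ (-z)) (Iic 0) := by
      intro z hz
      rcases eq_or_lt_of_le (show z ≤ 0 from hz) with rfl | hz'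
      · simp [h0]
      · simp [Real.sign_of_neg hz', abs_of_neg hz']
    have d1 := hd.congr_of_mem e1 self_mem_Ici
    have d2 := ((hasDerivWithinAt_comp_neg_Iic hd).fun_neg).congr_of_mem e2 self_mem_Iic
    rw [neg_neg] at d2
    have := d1.union d2
    rw [union_comm, Iic_union_Ici] at this
    exact hasDerivWithinAt_univ.1 this
  · have h1 := (hasDerivAt_comp_abs_of_ne_zero h hx).const_mul (Real.sign x)
    rw [← mul_assoc, sign_sq_of_ne_zero hx, one_mul] at h1
    refine h1.congr_of_eventuallyEq ?_
    filter_upwards [sign_eventuallyEq hx] with z hz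
    rw [hz]

/-- The even extension of a function with vanishing derivative at `0` is differentiable. -/
theorem hasDerivAt_even_extension {φ φ' : ℝ → ℝ}
    (h : ∀ x ∈ Ici (0 : ℝ), HasDerivWithinAt φ (φ' x) (Ici 0) x) (h0 : φ' 0 = 0) (x : ℝ) :
    HasDerivAt (fun z => φ |z|) (Real.sign x * φ' |x|) x := by
  rcases eq_or_ne x 0 with rfl | hx
  · have hd := h 0 self_mem_Ici
    rw [h0] at hd
    rw [Real.sign_zero, zero_mul]
    have e1 : EqOn (fun z => φ |z|) φ (Ici 0) := fun z hz => by
      simp [abs_of_nonneg (show 0 ≤ z from hz)]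
    have e2 : EqOn (fun z => φ |z|) (fun z => φ (-z)) (Iic 0) := fun z hz => by
      simp [abs_of_nonpos (show z ≤ 0 from hz)]
    have d1 := hd.congr_of_mem e1 self_mem_Ici
    have d2 := (hasDerivWithinAt_comp_neg_Iic hd).congr_of_mem e2 self_mem_Iic
    rw [neg_zero] at d2
    have := d1.union d2
    rw [union_comm, Iic_union_Ici] at this
    exact hasDerivWithinAt_univ.1 this
  · exact hasDerivAt_comp_abs_of_ne_zero h hx

theorem continuous_comp_abs {φ : ℝ → ℝ} (h : ContinuousOn φ (Ici 0)) :
    Continuous fun x => φ |x| :=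
  h.comp_continuous continuous_abs fun x => abs_nonneg x

theorem abs_sign_mul_le {x a : ℝ} : |Real.sign x * a| ≤ |a| := by
  rcases Real.sign_apply_eq x with h | h | h <;> simp [h]

theorem IsCb.exists_bound {n : ℕ} {u : ℝ → ℝ} (hu : IsCb n u) {k : ℕ} (hk : k ≤ n) :
    ∃ C, 0 ≤ C ∧ ∀ x ∈ Ici (0 : ℝ), |iteratedDerivWithin k u (Ici 0) x| ≤ C := by
  obtain ⟨C, hC⟩ := hu.2 k hk
  exact ⟨max C 0, le_max_right _ _, fun x hx => (hC x hx).trans (le_max_left _ _)⟩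

theorem IsCb.bounded {n : ℕ} {u : ℝ → ℝ} (hu : IsCb n u) :
    ∃ C, 0 ≤ C ∧ ∀ x ∈ Ici (0 : ℝ), |u x| ≤ C := by
  obtain ⟨C, h0, hC⟩ := hu.exists_bound (Nat.zero_le n)
  exact ⟨C, h0, fun x hx => by simpa using hC x hx⟩

theorem IsCb.bounded_deriv {n : ℕ} {u : ℝ → ℝ} (hu : IsCb n u) (hn : 1 ≤ n) :
    ∃ C, 0 ≤ C ∧ ∀ x ∈ Ici (0 : ℝ), |derivWithin u (Ici 0) x| ≤ C := by
  obtain ⟨C, h0, hC⟩ := hu.exists_bound hn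
  exact ⟨C, h0, fun x hx => by simpa [iteratedDerivWithin_one] using hC x hx⟩

theorem IsCb.hasDerivWithinAt {n : ℕ} {u : ℝ → ℝ} (hu : IsCb n u) (hn : 1 ≤ n) :
    ∀ x ∈ Ici (0 : ℝ), HasDerivWithinAt u (derivWithin u (Ici 0) x) (Ici 0) x := fun x hx =>
  (hu.1.differentiableOn (by exact_mod_cast (Nat.one_le_iff_ne_zero.1 hn)) x hx).hasDerivWithinAt

theorem IsCb.continuousOn_deriv {n : ℕ} {u : ℝ → ℝ} (hu : IsCb n u) (hn : 1 ≤ n) :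
    ContinuousOn (derivWithin u (Ici 0)) (Ici 0) :=
  hu.1.continuousOn_derivWithin (uniqueDiffOn_Ici 0) (by exact_mod_cast hn)

theorem IsCb.hasDerivWithinAt_deriv {u : ℝ → ℝ} (hu : IsCb 2 u) :
    ∀ x ∈ Ici (0 : ℝ), HasDerivWithinAt (derivWithin u (Ici 0))
      (iteratedDerivWithin 2 u (Ici 0) x) (Ici 0) x := by
  intro x hx
  have h1 : ContDiffOn ℝ 1 (derivWithin u (Ici 0)) (Ici 0) :=
    hu.1.derivWithin (uniqueDiffOn_Ici 0) (by norm_num)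
  have h2 := (h1.differentiableOn (by norm_num) x hx).hasDerivWithinAt
  have e : iteratedDerivWithin 2 u (Ici 0) x
      = derivWithin (derivWithin u (Ici 0)) (Ici 0) x := by
    rw [iteratedDerivWithin_succ]
    congr 1
    exact iteratedDerivWithin_one
  rw [e]; exact h2

theorem IsCb.continuousOn_deriv_two {u : ℝ → ℝ} (hu : IsCb 2 u) :
    ContinuousOn (iteratedDerivWithin 2 u (Ici 0)) (Ici 0) :=
  hu.1.continuousOn_iteratedDerivWithin (by norm_num) (uniqueDiffOn_Ici 0)

section
variable {f : ℝ → ℝ}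

theorem hasDerivAt_symDrift (hf : IsCb 1 f) (hf0 : f 0 = 0) (x : ℝ) :
    HasDerivAt (symDrift f) (derivWithin f (Ici 0) |x|) x :=
  hasDerivAt_odd_extension (hf.hasDerivWithinAt le_rfl) hf0 x

theorem continuous_symDrift (hf : IsCb 1 f) (hf0 : f 0 = 0) : Continuous (symDrift f) :=
  continuous_iff_continuousAt.2 fun x => (hasDerivAt_symDrift hf hf0 x).continuousAt

theorem exists_bound_symDrift (hf : IsCb 1 f) :
    ∃ G, 0 ≤ G ∧ (∀ x, |symDrift f x| ≤ G) ∧ ∀ x, |(derivWithin f (Ici 0) |x|)| ≤ G := by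
  obtain ⟨A, hA0, hA⟩ := hf.bounded
  obtain ⟨B, hB0, hB⟩ := hf.bounded_deriv le_rfl
  exact ⟨max A B, hA0.trans (le_max_left _ _),
    fun x => (abs_sign_mul_le.trans (hA _ (abs_nonneg x))).trans (le_max_left _ _),
    fun x => (hB _ (abs_nonneg x)).trans (le_max_right _ _)⟩

theorem exists_bound_symPotential {h y : ℝ → ℝ} (ε : ℝ) (hf : IsCb 1 f) (hh : IsCb 2 h)
    (hy : IsCb 1 y) : ∃ K, 0 ≤ K ∧ ∀ x, ∀ t, 0 ≤ t → |symPotential ε f h y x t| ≤ K := by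
  obtain ⟨B, hB0, hB⟩ := hf.bounded_deriv le_rfl
  obtain ⟨H, hH0, hH⟩ := hh.bounded
  obtain ⟨J, hJ0, hJ⟩ := hh.exists_bound (le_refl 2)
  obtain ⟨Y, hY0, hY⟩ := hy.bounded
  obtain ⟨Z, hZ0, hZ⟩ := hy.bounded_deriv le_rfl
  refine ⟨1 / 2 * H ^ 2 + Z * H + |ε| * B + |ε| / 2 * Y * J, by positivity, fun x t ht => ?_⟩
  have hx : |x| ∈ Ici (0 : ℝ) := abs_nonneg x
  have ht' : t ∈ Ici (0 : ℝ) := ht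
  have b1 : |1 / 2 * (h |x|) ^ 2| ≤ 1 / 2 * H ^ 2 := by
    rw [abs_mul, abs_pow, abs_of_pos (by norm_num : (0 : ℝ) < 1 / 2)]
    gcongr; exact hH _ hx
  have b2 : |(derivWithin y (Ici 0) t * h |x|)| ≤ Z * H := by
    rw [abs_mul]; exact mul_le_mul (hZ _ ht') (hH _ hx) (abs_nonneg _) hZ0
  have b3 : |(ε * derivWithin f (Ici 0) |x|)| ≤ |ε| * B := by
    rw [abs_mul]; gcongr; exact hB _ hx
  have b4 : |(ε / 2 * y t * iteratedDerivWithin 2 h (Ici 0) |x|)| ≤ |ε| / 2 * Y * J := by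
    rw [abs_mul, abs_mul, abs_div, abs_two]
    have := hY _ ht'
    have := hJ _ hx
    gcongr
  rw [symPotential]
  refine (abs_sub _ _).trans (add_le_add ((abs_add_le _ _).trans (add_le_add
    ((abs_sub _ _).trans (add_le_add b1 b2)) b3)) b4)

end
end ViscousHJ

/-! ### Cole-Hopf transform and uniqueness -/

namespace ViscousHJ

open Filter Topology

section
variable {ε T : ℝ} {f h y w₀ : ℝ → ℝ} {w : ℝ → ℝ → ℝ}

theorem IsSmoothSolution.hasC21 (hw : IsSmoothSolution ε f h y w₀ T w) :
    HasC21 T w (fun x t => derivWithin (fun s => w x s) (Icc 0 T) t)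
      (fun x t => deriv (fun z => w z t) x) (fun x t => iteratedDeriv 2 (fun z => w z t) x) where
  cont := hw.continuousOn
  hasDeriv_t x t ht := (hw.differentiable_time x t ht).hasDerivWithinAt
  hasDeriv_x x t ht :=
    ((hw.contDiff_space t ht).differentiable (by norm_num) x).hasDerivAt
  hasDeriv_xx x t ht := by
    have h1 : ContDiff ℝ 1 (deriv fun z => w z t) :=
      ((contDiff_succ_iff_deriv (n := 1)).1 (hw.contDiff_space t ht)).2.2
    have h2 := (h1.differentiable (by norm_num) x).hasDerivAt
    have e : iteratedDeriv 2 (fun z => w z t) = deriv (deriv fun z => w z t) := by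
      rw [iteratedDeriv_succ, iteratedDeriv_one]
    simp only [e]
    exact h2
  cont_t := hw.continuousOn_dt
  cont_x := hw.continuousOn_dx
  cont_xx := hw.continuousOn_dxx

/-- The Cole-Hopf transform. -/
theorem HasC21.exp_mul {ψ ψt ψx ψxx : ℝ → ℝ → ℝ} (h : HasC21 T ψ ψt ψx ψxx) (a : ℝ) :
    HasC21 T (fun x t => Real.exp (a * ψ x t))
      (fun x t => Real.exp (a * ψ x t) * (a * ψt x t))
      (fun x t => Real.exp (a * ψ x t) * (a * ψx x t))
      (fun x t => Real.exp (a * ψ x t) * ((a * ψx x t) ^ 2 + a * ψxx x t)) := by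
  have hc := h.cont
  have hc' := h.cont.mono (prod_mono (le_refl (univ : Set ℝ)) Ioc_subset_Icc_self)
  have ht := h.cont_t
  have hx := h.cont_x
  have hxx := h.cont_xx
  have hdx : ∀ x, ∀ t ∈ Ioc 0 T, HasDerivAt (fun x => Real.exp (a * ψ x t))
      (Real.exp (a * ψ x t) * (a * ψx x t)) x := fun x t ht =>
    ((h.hasDeriv_x x t ht).const_mul a).exp
  refine ⟨by fun_prop, fun x t ht => ((h.hasDeriv_t x t ht).const_mul a).exp, hdx, ?_,
    by fun_prop, by fun_prop, by fun_prop⟩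
  intro x t ht
  refine ((hdx x t ht).fun_mul ((h.hasDeriv_xx x t ht).const_mul a)).congr_deriv ?_
  ring

/-- The scale 1/ε is the one for which the square of w_x produced by (ε/2) φ_xx cancels the
quadratic part of the Hamiltonian, leaving a linear equation. -/
theorem IsSmoothSolution.coleHopf (hw : IsSmoothSolution ε f h y w₀ T w) (hε : 0 < ε) :
    ∃ φt φx φxx, HasC21 T (fun x t => Real.exp (-ε⁻¹ * w x t)) φt φx φxx ∧
      ∀ x, ∀ t ∈ Ioc 0 T, φt x t = ε / 2 * φxx x t - symDrift f x * φx x t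
        - ε⁻¹ * symPotential ε f h y x t * Real.exp (-ε⁻¹ * w x t) := by
  refine ⟨_, _, _, hw.hasC21.exp_mul (-ε⁻¹), fun x t ht => ?_⟩
  have h1 := hw.equation x t ht
  rw [symHamiltonian] at h1
  have e : derivWithin (fun s => w x s) (Icc 0 T) t
    = ε / 2 * iteratedDeriv 2 (fun z => w z t) x - (1 / 2 * (deriv (fun z => w z t) x) ^ 2
      + deriv (fun z => w z t) x * symDrift f x - symPotential ε f h y x t) := by linarith
  rw [e]
  field_simp
  ring

/-- Uniqueness of classical solutions on short time intervals, without growth conditions. -/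
theorem IsSmoothSolution.unique {w' : ℝ → ℝ → ℝ} (hε : 0 < ε) (hf : IsCb 1 f) (hf0 : f 0 = 0)
    {G K B : ℝ} (hK : 0 ≤ K) (hG : ∀ x, |symDrift f x| ≤ G)
    (hG' : ∀ x, |(derivWithin f (Ici 0) |x|)| ≤ G)
    (hV : ∀ x, ∀ t, 0 ≤ t → |ε⁻¹ * symPotential ε f h y x t| ≤ K)
    (hT1 : T ≤ 1) (hT : T * (2 + 2 * ε⁻¹ * G + (G + K)) ≤ ε⁻¹)
    (hw : IsSmoothSolution ε f h y w₀ T w) (hB : ∀ x, ∀ t ∈ Icc 0 T, |w x t| ≤ B)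
    (hw' : IsSmoothSolution ε f h y w₀ T w') : ∀ x, ∀ t ∈ Icc 0 T, w' x t = w x t := by
  obtain ⟨φt, φx, φxx, hφ, eφ⟩ := hw.coleHopf hε
  obtain ⟨χt, χx, χxx, hχ, eχ⟩ := hw'.coleHopf hε
  have hψ := hχ.sub hφ
  have hz : ∀ x, Real.exp (-ε⁻¹ * w' x 0) - Real.exp (-ε⁻¹ * w x 0) = 0 := fun x => by
    rw [hw.initial, hw'.initial, sub_self]
  have heq : ∀ x, ∀ t ∈ Ioc 0 T, χt x t - φt x t = ε / 2 * (χxx x t - φxx x t)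
      - symDrift f x * (χx x t - φx x t) - ε⁻¹ * symPotential ε f h y x t *
        (Real.exp (-ε⁻¹ * w' x t) - Real.exp (-ε⁻¹ * w x t)) := fun x t ht => by
    rw [eφ x t ht, eχ x t ht]; ring
  -- Only w needs a bound: the transform of w' is positive, so the difference is at least -exp(B/ε).
  have hpos := nonneg_of_bddBelow hε hG (c := fun x t => ε⁻¹ * symPotential ε f h y x t)
    (fun x t ht => hV x t ht.1.le) hψ heq (fun x => (hz x).ge) (Real.exp_pos (ε⁻¹ * B))
    (fun x t ht => by
      have h1 : Real.exp (-ε⁻¹ * w x t) ≤ Real.exp (ε⁻¹ * B) := by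
        rw [Real.exp_le_exp]
        have := mul_le_mul_of_nonneg_left (neg_le_of_abs_le (hB x t ht)) (inv_pos.2 hε).le
        linarith
      linarith [Real.exp_pos (-ε⁻¹ * w' x t)])
  have hzero := hψ.eq_zero_of_nonneg hε hK (hasDerivAt_symDrift hf hf0)
    (continuous_comp_abs (hf.continuousOn_deriv le_rfl)) hG hG' hpos
    (fun x t ht => by
      rw [heq x t ht]
      have h1 := hpos x t (Ioc_subset_Icc_self ht)
      have h2 := mul_le_mul_of_nonneg_right (hV x t ht.1.le) h1
      rw [← abs_of_nonneg h1, ← abs_mul, abs_of_nonneg h1] at h2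
      refine le_trans (le_of_eq ?_) h2
      rw [← abs_neg]
      congr 1; ring) hT1 hT hz
  intro x t ht
  have h1 : Real.exp (-ε⁻¹ * w' x t) = Real.exp (-ε⁻¹ * w x t) := by
    linarith [hzero x t ht]
  exact mul_left_cancel₀ (neg_ne_zero.2 (inv_pos.2 hε).ne') (Real.exp_injective h1)

end
end ViscousHJ

/-! ### Averages against Gaussian weights and their derivatives -/

namespace ViscousHJ

open Filter Topology MeasureTheory

theorem integrable_exp_neg_abs : Integrable fun x : ℝ => Real.exp (-|x|) := by
  refine (integrable_inv_one_add_sq.const_mul 2).mono'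
    (by fun_prop : Continuous fun x : ℝ => Real.exp (-|x|)).aestronglyMeasurable
    (ae_of_all _ fun x => ?_)
  rw [Real.norm_of_nonneg (Real.exp_pos _).le, Real.exp_neg, ← div_eq_mul_inv,
    inv_le_comm₀ (Real.exp_pos _) (by positivity), inv_div]
  have := Real.quadratic_le_exp_of_nonneg (abs_nonneg x)
  rw [sq_abs] at this
  linarith [abs_nonneg x]

/-- Continuous weights with exponential decay of rate `4`. -/
structure IsRapid (m : ℝ → ℝ) : Prop where
  cont : Continuous m
  decay : ∃ C, 0 ≤ C ∧ ∀ ξ, |m ξ| ≤ C * Real.exp (-(4 * |ξ|))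

theorem one_add_abs_le_exp (x : ℝ) : 1 + |x| ≤ Real.exp |x| := by
  linarith [Real.add_one_le_exp |x|]

theorem IsRapid.integrable_growth {m : ℝ → ℝ} (hm : IsRapid m) :
    Integrable fun ξ => (1 + |ξ|) * |m ξ| := by
  obtain ⟨C, hC0, hC⟩ := hm.decay
  have hc := hm.cont
  refine (integrable_exp_neg_abs.const_mul C).mono'
    (by fun_prop : Continuous fun ξ => (1 + |ξ|) * |m ξ|).aestronglyMeasurable
    (ae_of_all _ fun ξ => ?_)
  rw [Real.norm_of_nonneg (by positivity)]
  calc (1 + |ξ|) * |m ξ| ≤ Real.exp |ξ| * (C * Real.exp (-(4 * |ξ|))) :=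
        mul_le_mul (one_add_abs_le_exp ξ) (hC ξ) (abs_nonneg _) (Real.exp_pos _).le
    _ = C * Real.exp (-(3 * |ξ|)) := by
        rw [mul_left_comm, ← Real.exp_add]; ring_nf
    _ ≤ C * Real.exp (-|ξ|) := by
        gcongr; linarith [abs_nonneg ξ]

theorem IsRapid.integrable_abs {m : ℝ → ℝ} (hm : IsRapid m) : Integrable fun ξ => |m ξ| := by
  have hc := hm.cont
  refine hm.integrable_growth.mono' (by fun_prop : Continuous fun ξ => |m ξ|).aestronglyMeasurable
    (ae_of_all _ fun ξ => ?_)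
  rw [Real.norm_of_nonneg (abs_nonneg _)]
  nlinarith [abs_nonneg ξ, abs_nonneg (m ξ), mul_nonneg (abs_nonneg ξ) (abs_nonneg (m ξ))]

theorem IsRapid.integrable_abs_mul {m : ℝ → ℝ} (hm : IsRapid m) :
    Integrable fun ξ => |ξ| * |m ξ| := by
  refine (hm.integrable_growth.sub hm.integrable_abs).congr (ae_of_all _ fun ξ => ?_)
  simp only [Pi.sub_apply]
  ring

theorem IsRapid.integrable {m : ℝ → ℝ} (hm : IsRapid m) : Integrable m :=
  (integrable_norm_iff hm.cont.aestronglyMeasurable).1 hm.integrable_abs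

/-- The average of `φ (x + a ξ)` against the weight `m`. -/
noncomputable def avg (m φ : ℝ → ℝ) (x a : ℝ) : ℝ := ∫ ξ, φ (x + a * ξ) * m ξ

/-- Linear growth. -/
def LinGrowth (φ : ℝ → ℝ) : Prop := ∃ A, 0 ≤ A ∧ ∀ z, |φ z| ≤ A * (1 + |z|)

theorem LinGrowth.comp_affine {φ : ℝ → ℝ} (h : LinGrowth φ) (x a : ℝ) :
    LinGrowth fun ξ => φ (x + a * ξ) := by
  obtain ⟨A, hA0, hA⟩ := h
  refine ⟨A * (1 + |x| + |a|), by positivity, fun z => (hA _).trans ?_⟩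
  rw [mul_assoc]
  refine mul_le_mul_of_nonneg_left ?_ hA0
  have h1 := abs_add_le x (a * z)
  rw [abs_mul] at h1
  nlinarith [abs_nonneg x, abs_nonneg a, abs_nonneg z, mul_nonneg (abs_nonneg x) (abs_nonneg z)]

theorem linGrowth_of_bounded {φ : ℝ → ℝ} {C : ℝ} (h : ∀ z, |φ z| ≤ C) : LinGrowth φ := by
  have hC : 0 ≤ C := (abs_nonneg _).trans (h 0)
  exact ⟨C, hC, fun z => (h z).trans (by nlinarith [abs_nonneg z])⟩

theorem linGrowth_of_lipschitz {φ : ℝ → ℝ} {l : ℝ} (hl : ∀ x y, |φ x - φ y| ≤ l * |x - y|) :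
    LinGrowth φ := by
  refine ⟨|φ 0| + |l|, by positivity, fun z => ?_⟩
  have h1 := hl z 0
  rw [sub_zero] at h1
  have h2 : |φ z| ≤ |φ z - φ 0| + |φ 0| := by
    simpa using abs_add_le (φ z - φ 0) (φ 0)
  nlinarith [abs_nonneg z, abs_nonneg (φ 0), abs_nonneg l, le_abs_self l,
    mul_le_mul_of_nonneg_right (le_abs_self l) (abs_nonneg z),
    mul_nonneg (abs_nonneg (φ 0)) (abs_nonneg z)]

theorem IsRapid.integrable_mul {m φ : ℝ → ℝ} (hm : IsRapid m) (hφ : Continuous φ)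
    (hg : LinGrowth φ) : Integrable fun ξ => φ ξ * m ξ := by
  obtain ⟨A, hA0, hA⟩ := hg
  have hc := hm.cont
  refine (hm.integrable_growth.const_mul A).mono' (by fun_prop : Continuous fun ξ => φ ξ * m ξ).aestronglyMeasurable
    (ae_of_all _ fun ξ => ?_)
  rw [Real.norm_eq_abs, abs_mul, ← mul_assoc]
  exact mul_le_mul_of_nonneg_right (hA ξ) (abs_nonneg _)

theorem IsRapid.integrable_avg {m φ : ℝ → ℝ} (hm : IsRapid m) (hφ : Continuous φ)
    (hg : LinGrowth φ) (x a : ℝ) : Integrable fun ξ => φ (x + a * ξ) * m ξ :=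
  hm.integrable_mul (φ := fun ξ => φ (x + a * ξ)) (by fun_prop) (hg.comp_affine x a)

theorem abs_avg_le_of_bounded {m φ : ℝ → ℝ} (hm : IsRapid m) {C : ℝ} (h : ∀ z, |φ z| ≤ C)
    (x a : ℝ) : |avg m φ x a| ≤ C * ∫ ξ, |m ξ| := by
  rw [← integral_const_mul]
  rw [← Real.norm_eq_abs]
  refine norm_integral_le_of_norm_le (hm.integrable_abs.const_mul C) (ae_of_all _ fun ξ => ?_)
  rw [Real.norm_eq_abs, abs_mul]
  exact mul_le_mul_of_nonneg_right (h _) (abs_nonneg _)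

/-- The factor a is the gain. For a weight of zero mean the average itself is O(a), which later
removes one power of the singularity of a differentiated heat kernel. -/
theorem abs_avg_sub_le_of_lipschitz {m φ : ℝ → ℝ} (hm : IsRapid m) (hφ : Continuous φ) {l : ℝ}
    (hl : ∀ x y, |φ x - φ y| ≤ l * |x - y|) (x : ℝ) {a : ℝ} (ha : 0 ≤ a) :
    |avg m φ x a - φ x * ∫ ξ, m ξ| ≤ a * l * ∫ ξ, |ξ| * |m ξ| := by
  have hg := linGrowth_of_lipschitz hl
  rw [avg, ← integral_const_mul, ← integral_sub (hm.integrable_avg hφ hg x a)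
    (hm.integrable.const_mul _), ← integral_const_mul, ← Real.norm_eq_abs]
  refine norm_integral_le_of_norm_le (hm.integrable_abs_mul.const_mul _) (ae_of_all _ fun ξ => ?_)
  rw [Real.norm_eq_abs, ← sub_mul, abs_mul, ← mul_assoc]
  refine mul_le_mul_of_nonneg_right ((hl _ _).trans (le_of_eq ?_)) (abs_nonneg _)
  rw [add_sub_cancel_left, abs_mul, abs_of_nonneg ha]; ring

/-- Continuity in parameters. -/
theorem IsRapid.continuousOn_integral {P : Type*} [TopologicalSpace P] [FirstCountableTopology P]
    {m : ℝ → ℝ} (hm : IsRapid m) {S : Set P} {Φ : P → ℝ → ℝ}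
    (hc : ∀ p ∈ S, Continuous (Φ p)) (hp : ∀ ξ, ContinuousOn (fun p => Φ p ξ) S)
    (hb : ∀ p₀ ∈ S, ∃ A, ∀ᶠ p in 𝓝[S] p₀, ∀ ξ, |Φ p ξ| ≤ A * (1 + |ξ|)) :
    ContinuousOn (fun p => ∫ ξ, Φ p ξ * m ξ) S := by
  intro p₀ hp₀
  obtain ⟨A, hA⟩ := hb p₀ hp₀
  have hmc := hm.cont
  refine continuousWithinAt_of_dominated (bound := fun ξ => A * ((1 + |ξ|) * |m ξ|)) ?_ ?_
    (hm.integrable_growth.const_mul A) ?_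
  · filter_upwards [self_mem_nhdsWithin] with p hpS
    exact ((hc p hpS).mul hmc).aestronglyMeasurable
  · filter_upwards [hA] with p hpA
    refine ae_of_all _ fun ξ => ?_
    rw [Real.norm_eq_abs, abs_mul, ← mul_assoc]
    exact mul_le_mul_of_nonneg_right (hpA ξ) (abs_nonneg _)
  · exact ae_of_all _ fun ξ => (hp ξ p₀ hp₀).mul continuousWithinAt_const

theorem IsRapid.continuous_avg {m φ : ℝ → ℝ} (hm : IsRapid m) (hφ : Continuous φ)
    (hg : LinGrowth φ) : Continuous fun p : ℝ × ℝ => avg m φ p.1 p.2 := by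
  rw [← continuousOn_univ]
  refine hm.continuousOn_integral (Φ := fun (p : ℝ × ℝ) ξ => φ (p.1 + p.2 * ξ)) (fun p _ => by fun_prop)
    (fun ξ => by fun_prop) fun p₀ _ => ?_
  obtain ⟨A, hA0, hA⟩ := hg
  refine ⟨A * (1 + (|p₀.1| + 1) + (|p₀.2| + 1)), ?_⟩
  rw [nhdsWithin_univ]
  have h1 : ∀ᶠ p : ℝ × ℝ in 𝓝 p₀, |p.1| < |p₀.1| + 1 :=
    (continuous_fst.abs.tendsto p₀).eventually (gt_mem_nhds (by linarith))
  have h2 : ∀ᶠ p : ℝ × ℝ in 𝓝 p₀, |p.2| < |p₀.2| + 1 :=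
    (continuous_snd.abs.tendsto p₀).eventually (gt_mem_nhds (by linarith))
  filter_upwards [h1, h2] with p hp1 hp2 ξ
  refine (hA _).trans ?_
  rw [mul_assoc]
  refine mul_le_mul_of_nonneg_left ?_ hA0
  have h3 := abs_add_le p.1 (p.2 * ξ)
  rw [abs_mul] at h3
  have h4 := mul_le_mul_of_nonneg_right hp2.le (abs_nonneg ξ)
  nlinarith [abs_nonneg p₀.1, abs_nonneg p₀.2, abs_nonneg ξ,
    mul_nonneg (abs_nonneg p₀.1) (abs_nonneg ξ)]

/-- A translation of the integration variable moves the derivative from φ, which is only continuous,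
onto the weight. -/
theorem hasDerivAt_avg_shift {m m' φ : ℝ → ℝ} (hm : IsRapid m) (hm' : IsRapid m')
    (hd : ∀ ξ, HasDerivAt m (m' ξ) ξ) (hφ : Continuous φ) (hg : LinGrowth φ) :
    HasDerivAt (fun x => ∫ ξ, φ (x + ξ) * m ξ) (-∫ ξ, φ ξ * m' ξ) 0 := by
  have e : (fun x => ∫ ξ, φ (x + ξ) * m ξ) = fun x => ∫ z, φ z * m (z - x) := by
    funext x
    have := integral_add_right_eq_self (μ := volume) (fun z => φ z * m (z - x)) x
    rw [← this]
    congr 1; funext ξ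
    rw [add_comm ξ x, add_sub_cancel_left]
  rw [e, ← integral_neg]
  obtain ⟨A, hA0, hA⟩ := hg
  obtain ⟨C, hC0, hC⟩ := hm'.decay
  have hmc := hm.cont
  have hmc' := hm'.cont
  have h := hasDerivAt_integral_of_dominated_loc_of_deriv_le (μ := (volume : Measure ℝ))
    (F := fun x z => φ z * m (z - x)) (F' := fun x z => -(φ z * m' (z - x))) (x₀ := 0)
    (s := Metric.ball 0 1) (bound := fun z => A * C * Real.exp 4 * Real.exp (-|z|))
    (Metric.ball_mem_nhds _ one_pos)
    (Eventually.of_forall fun x => Continuous.aestronglyMeasurable (by fun_prop))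
    (by simpa using hm.integrable_mul hφ ⟨A, hA0, hA⟩)
    (Continuous.aestronglyMeasurable (by fun_prop))
    (ae_of_all _ fun z x hx => by
      have hx1 : |x| ≤ 1 := by simpa using (Metric.mem_ball.1 hx).le
      rw [norm_neg, Real.norm_eq_abs, abs_mul]
      have h1 : |z| ≤ |z - x| + 1 := by
        have := abs_add_le (z - x) x
        rw [sub_add_cancel] at this
        linarith
      calc |φ z| * |m' (z - x)|
          ≤ (A * Real.exp |z|) * (C * Real.exp (-(4 * |z - x|))) :=
            mul_le_mul ((hA z).trans (mul_le_mul_of_nonneg_left (one_add_abs_le_exp z) hA0))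
              (hC _) (abs_nonneg _) (by positivity)
        _ = A * C * Real.exp (|z| - 4 * |z - x|) := by
            rw [sub_eq_add_neg |z|, Real.exp_add]; ring
        _ ≤ A * C * Real.exp (4 + -|z|) := by
            gcongr; linarith [abs_nonneg z]
        _ = _ := by rw [Real.exp_add]; ring)
    (integrable_exp_neg_abs.const_mul _)
    (ae_of_all _ fun z x _ => by
      have h1 : HasDerivAt (fun x => z - x) (-1) x := (hasDerivAt_id x).const_sub z
      refine (((hd (z - x)).comp x h1).const_mul (φ z)).congr_deriv ?_
      ring)
  simpa using h.2

/-- The dilation z = a ξ moves the a-dependence onto the weight; its Jacobian contributes the term m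
next to ξ m'. -/
theorem hasDerivAt_avg_scale {m m' φ : ℝ → ℝ} (hm : IsRapid m) (hm' : IsRapid fun ξ => ξ * m' ξ)
    (hd : ∀ ξ, HasDerivAt m (m' ξ) ξ) (hφ : Continuous φ) (hg : LinGrowth φ) :
    HasDerivAt (fun a => ∫ ξ, φ (a * ξ) * m ξ) (-∫ ξ, φ ξ * (m ξ + ξ * m' ξ)) 1 := by
  have e : (fun a => ∫ ξ, φ (a * ξ) * m ξ) =ᶠ[𝓝 1]
      fun a => a⁻¹ * ∫ z, φ z * m (a⁻¹ * z) := by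
    filter_upwards [Ioi_mem_nhds (zero_lt_one' ℝ)] with a ha
    have ha0 : (0 : ℝ) < a := ha
    have := Measure.integral_comp_mul_left (fun z => φ z * m (a⁻¹ * z)) a
    rw [abs_of_pos (inv_pos.2 ha0), smul_eq_mul] at this
    rw [← this]
    congr 1; funext ξ
    rw [← mul_assoc, inv_mul_cancel₀ ha0.ne', one_mul]
  obtain ⟨A, hA0, hA⟩ := hg
  obtain ⟨C, hC0, hC⟩ := hm'.decay
  have hmc := hm.cont
  have hm'm : Measurable m' := by
    have : m' = deriv m := funext fun ξ => (hd ξ).deriv.symm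
    rw [this]; exact measurable_deriv m
  have h := hasDerivAt_integral_of_dominated_loc_of_deriv_le (μ := (volume : Measure ℝ))
    (F := fun b z => φ z * m (b * z)) (F' := fun b z => φ z * (m' (b * z) * z)) (x₀ := 1)
    -- For b > 1/2 the decay rate 4 becomes at least 2; one unit pays for the growth of φ, bounded
    -- by a multiple of exp |z|, and one is left for integrability.
    (s := Ioi (1 / 2)) (bound := fun z => 2 * A * C * Real.exp (-|z|))
    (Ioi_mem_nhds (by norm_num))
    (Eventually.of_forall fun x => Continuous.aestronglyMeasurable (by fun_prop))
    (by simpa using hm.integrable_mul hφ ⟨A, hA0, hA⟩)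
    (Measurable.aestronglyMeasurable (by fun_prop))
    (ae_of_all _ fun z b hb => by
      have hb' : 1 / 2 < b := hb
      have hb0 : 0 < b := by linarith
      have e1 : m' (b * z) * z = b⁻¹ * (b * z * m' (b * z)) := by field_simp
      rw [Real.norm_eq_abs, abs_mul, e1, abs_mul, abs_of_pos (inv_pos.2 hb0)]
      have hb2 : b⁻¹ ≤ 2 := by rw [inv_le_comm₀ hb0 two_pos]; linarith
      have h1 := hC (b * z)
      calc |φ z| * (b⁻¹ * |b * z * m' (b * z)|)
          ≤ (A * Real.exp |z|) * (2 * (C * Real.exp (-(4 * |b * z|)))) :=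
            mul_le_mul ((hA z).trans (mul_le_mul_of_nonneg_left (one_add_abs_le_exp z) hA0))
              (mul_le_mul hb2 h1 (abs_nonneg _) (by norm_num)) (by positivity) (by positivity)
        _ = 2 * A * C * Real.exp (|z| - 4 * |b * z|) := by
            rw [sub_eq_add_neg |z|, Real.exp_add]; ring
        _ ≤ 2 * A * C * Real.exp (-|z|) := by
            gcongr
            rw [abs_mul, abs_of_pos hb0]
            nlinarith [abs_nonneg z])
    (integrable_exp_neg_abs.const_mul _)
    (ae_of_all _ fun z b _ => by
      have h1 : HasDerivAt (fun b => b * z) (1 * z) b := (hasDerivAt_id b).mul_const z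
      refine (((hd (b * z)).comp b h1).const_mul (φ z)).congr_deriv ?_
      ring)
  have hinv : HasDerivAt (fun a : ℝ => a⁻¹) (-1) 1 := by
    simpa using hasDerivAt_inv (one_ne_zero' ℝ)
  have h2 : HasDerivAt (fun a : ℝ => ∫ z, φ z * m (a⁻¹ * z))
      ((∫ z, φ z * (m' (1 * z) * z)) * -1) 1 := by
    have h3 := h.2
    rw [← inv_one] at h3
    have := h3.comp (1 : ℝ) hinv
    simpa [Function.comp_def] using this
  have h4 := (hinv.fun_mul h2).congr_of_eventuallyEq e
  refine h4.congr_deriv ?_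
  have e5 : ∫ ξ, φ ξ * (m ξ + ξ * m' ξ) = (∫ z, φ z * m z) + ∫ z, φ z * (m' z * z) := by
    rw [← integral_add (hm.integrable_mul hφ ⟨A, hA0, hA⟩) (by simpa using h.1)]
    congr 1; funext z; ring
  rw [e5]
  simp
  ring

/-- An affine change of variable in φ reduces a general base point and scale to a shift at 0. -/
theorem hasDerivAt_avg_left {m m' φ : ℝ → ℝ} (hm : IsRapid m) (hm' : IsRapid m')
    (hd : ∀ ξ, HasDerivAt m (m' ξ) ξ) (hφ : Continuous φ) (hg : LinGrowth φ) {a : ℝ}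
    (ha : 0 < a) (x₀ : ℝ) :
    HasDerivAt (fun x => avg m φ x a) (-avg m' φ x₀ a / a) x₀ := by
  have h := hasDerivAt_avg_shift hm hm' hd (φ := fun ξ => φ (x₀ + a * ξ)) (by fun_prop)
    (hg.comp_affine x₀ a)
  have h1 : HasDerivAt (fun x => (x - x₀) / a) (1 / a) x₀ :=
    ((hasDerivAt_id x₀).sub_const x₀).div_const a
  have h0 : (x₀ - x₀) / a = 0 := by simp
  rw [← h0] at h
  have := HasDerivAt.comp (h := fun x => (x - x₀) / a) x₀ h h1
  refine (this.congr_deriv ?_).congr_of_eventuallyEq (Eventually.of_forall fun x => ?_)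
  · rw [avg]; ring
  · simp only [avg, Function.comp]
    congr 1; funext ξ
    congr 2
    field_simp
    ring

theorem hasDerivAt_avg_right {m m' φ : ℝ → ℝ} (hm : IsRapid m) (hm' : IsRapid fun ξ => ξ * m' ξ)
    (hd : ∀ ξ, HasDerivAt m (m' ξ) ξ) (hφ : Continuous φ) (hg : LinGrowth φ) {a₀ : ℝ}
    (ha : 0 < a₀) (x : ℝ) :
    HasDerivAt (fun a => avg m φ x a) (-avg (fun ξ => m ξ + ξ * m' ξ) φ x a₀ / a₀) a₀ := by
  have h := hasDerivAt_avg_scale hm hm' hd (φ := fun ξ => φ (x + a₀ * ξ)) (by fun_prop)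
    (hg.comp_affine x a₀)
  have h1 : HasDerivAt (fun a => a / a₀) (1 / a₀) a₀ := (hasDerivAt_id a₀).div_const a₀
  have h0 : a₀ / a₀ = 1 := div_self ha.ne'
  rw [← h0] at h
  have := HasDerivAt.comp (h := fun a => a / a₀) a₀ h h1
  refine (this.congr_deriv ?_).congr_of_eventuallyEq (Eventually.of_forall fun a => ?_)
  · rw [avg]; ring
  · simp only [avg, Function.comp]
    congr 1; funext ξ
    congr 2
    field_simp

/-- The standard Gaussian density and its products with the first two Hermite polynomials. -/
noncomputable def gauss₀ (ξ : ℝ) : ℝ := (√(2 * Real.pi))⁻¹ * Real.exp (-(1 / 2) * ξ ^ 2)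
/-- First Hermite weight. -/
noncomputable def gauss₁ (ξ : ℝ) : ℝ := ξ * gauss₀ ξ
/-- Second Hermite weight. -/
noncomputable def gauss₂ (ξ : ℝ) : ℝ := (ξ ^ 2 - 1) * gauss₀ ξ

theorem gauss₀_nonneg (ξ : ℝ) : 0 ≤ gauss₀ ξ := by rw [gauss₀]; positivity

theorem continuous_gauss₀ : Continuous gauss₀ := by unfold gauss₀; fun_prop

theorem hasDerivAt_gauss₀ (ξ : ℝ) : HasDerivAt gauss₀ (-gauss₁ ξ) ξ := by
  refine ((((hasDerivAt_pow 2 ξ).const_mul (-(1 / 2))).exp).const_mul _).congr_deriv ?_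
  rw [gauss₁, gauss₀]; simp; ring

theorem hasDerivAt_gauss₁ (ξ : ℝ) : HasDerivAt gauss₁ (-gauss₂ ξ) ξ := by
  refine ((hasDerivAt_id ξ).fun_mul (hasDerivAt_gauss₀ ξ)).congr_deriv ?_
  rw [gauss₂, gauss₁]; simp; ring

theorem isRapid_poly_mul_gauss₀ {p : ℝ → ℝ} (hp : Continuous p)
    (hb : ∀ ξ, |p ξ| ≤ 1 + ξ ^ 2) : IsRapid fun ξ => p ξ * gauss₀ ξ := by
  have hc := continuous_gauss₀
  refine ⟨by fun_prop, 2 * Real.exp 18, by positivity, fun ξ => ?_⟩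
  rw [abs_mul, abs_of_nonneg (gauss₀_nonneg ξ)]
  -- From (|ξ| - 6)² ≥ 0. The rate 6 leaves the required 4 after the polynomial factor has used 2.
  have h1 : gauss₀ ξ ≤ Real.exp 18 * Real.exp (-(6 * |ξ|)) := by
    have h2 : (√(2 * Real.pi))⁻¹ ≤ 1 := by
      refine inv_le_one_of_one_le₀ ?_
      rw [Real.one_le_sqrt]
      linarith [Real.pi_gt_three]
    rw [gauss₀, ← Real.exp_add, ← one_mul (Real.exp (18 + _))]
    refine mul_le_mul h2 ?_ (Real.exp_pos _).le zero_le_one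
    rw [Real.exp_le_exp, ← sq_abs ξ]
    nlinarith [sq_nonneg (|ξ| - 6)]
  have h3 : 1 + ξ ^ 2 ≤ 2 * Real.exp (2 * |ξ|) := by
    have h4 := one_add_abs_le_exp ξ
    have h5 : Real.exp (2 * |ξ|) = Real.exp |ξ| * Real.exp |ξ| := by
      rw [← Real.exp_add]; ring_nf
    rw [h5, ← sq_abs ξ]
    nlinarith [abs_nonneg ξ]
  calc |p ξ| * gauss₀ ξ
      ≤ (2 * Real.exp (2 * |ξ|)) * (Real.exp 18 * Real.exp (-(6 * |ξ|))) :=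
        mul_le_mul ((hb ξ).trans h3) h1 (gauss₀_nonneg ξ) (by positivity)
    _ = 2 * Real.exp 18 * (Real.exp (2 * |ξ|) * Real.exp (-(6 * |ξ|))) := by ring
    _ = _ := by rw [← Real.exp_add]; ring_nf

theorem isRapid_gauss₀ : IsRapid gauss₀ := by
  simpa using isRapid_poly_mul_gauss₀ (p := fun _ => 1) (by fun_prop)
    (fun ξ => by rw [abs_one]; nlinarith [sq_nonneg ξ])

theorem isRapid_gauss₁ : IsRapid gauss₁ :=
  isRapid_poly_mul_gauss₀ (p := fun ξ => ξ) (by fun_prop)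
    (fun ξ => by rw [← sq_abs ξ]; nlinarith [sq_nonneg (|ξ| - 1), abs_nonneg ξ])

theorem isRapid_gauss₂ : IsRapid gauss₂ :=
  isRapid_poly_mul_gauss₀ (p := fun ξ => ξ ^ 2 - 1) (by fun_prop)
    (fun ξ => by rw [abs_le]; constructor <;> nlinarith [sq_nonneg ξ])

theorem IsRapid.neg {m : ℝ → ℝ} (hm : IsRapid m) : IsRapid fun ξ => -m ξ :=
  ⟨hm.cont.neg, by simpa using hm.decay⟩

theorem integral_gauss₀ : ∫ ξ, gauss₀ ξ = 1 := by
  simp only [gauss₀]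
  rw [integral_const_mul, integral_gaussian]
  have : Real.pi / (1 / 2) = 2 * Real.pi := by ring
  rw [this]
  exact inv_mul_cancel₀ (by positivity)

theorem integral_gauss₁ : ∫ ξ, gauss₁ ξ = 0 := by
  have := integral_eq_zero_of_hasDerivAt_of_integrable hasDerivAt_gauss₀
    isRapid_gauss₁.neg.integrable isRapid_gauss₀.integrable
  rwa [integral_neg, neg_eq_zero] at this

theorem integral_gauss₂ : ∫ ξ, gauss₂ ξ = 0 := by
  have := integral_eq_zero_of_hasDerivAt_of_integrable hasDerivAt_gauss₁
    isRapid_gauss₂.neg.integrable isRapid_gauss₁.integrable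
  rwa [integral_neg, neg_eq_zero] at this

section
variable {φ : ℝ → ℝ} {a : ℝ}

theorem avg_neg (m φ : ℝ → ℝ) (x a : ℝ) : avg (fun ξ => -m ξ) φ x a = -avg m φ x a := by
  simp only [avg, mul_neg, integral_neg]

theorem hasDerivAt_avg_gauss₀ (hφ : Continuous φ) (hg : LinGrowth φ) (ha : 0 < a) (x : ℝ) :
    HasDerivAt (fun x => avg gauss₀ φ x a) (avg gauss₁ φ x a / a) x := by
  have := hasDerivAt_avg_left isRapid_gauss₀ isRapid_gauss₁.neg hasDerivAt_gauss₀ hφ hg ha x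
  rwa [avg_neg, neg_neg] at this

theorem hasDerivAt_avg_gauss₁ (hφ : Continuous φ) (hg : LinGrowth φ) (ha : 0 < a) (x : ℝ) :
    HasDerivAt (fun x => avg gauss₁ φ x a) (avg gauss₂ φ x a / a) x := by
  have := hasDerivAt_avg_left isRapid_gauss₁ isRapid_gauss₂.neg hasDerivAt_gauss₁ hφ hg ha x
  rwa [avg_neg, neg_neg] at this

/-- Here m + ξ m' = -(ξ² - 1) m, so differentiation in the scale produces the same weight as two
space derivatives. This is the heat equation, once the scale is √(ε t). -/
theorem hasDerivAt_avg_gauss₀_right (hφ : Continuous φ) (hg : LinGrowth φ) (ha : 0 < a) (x : ℝ) :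
    HasDerivAt (fun a => avg gauss₀ φ x a) (avg gauss₂ φ x a / a) a := by
  have hr : IsRapid fun ξ => ξ * -gauss₁ ξ := by
    have := isRapid_poly_mul_gauss₀ (p := fun ξ => -ξ ^ 2) (by fun_prop)
      (fun ξ => by rw [abs_neg, abs_of_nonneg (sq_nonneg ξ)]; linarith)
    have e : (fun ξ => ξ * -gauss₁ ξ) = fun ξ => -ξ ^ 2 * gauss₀ ξ := by
      funext ξ; rw [gauss₁]; ring
    rwa [e]
  have := hasDerivAt_avg_right isRapid_gauss₀ hr hasDerivAt_gauss₀ hφ hg ha x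
  have e : (fun ξ => gauss₀ ξ + ξ * -gauss₁ ξ) = fun ξ => -gauss₂ ξ := by
    funext ξ; rw [gauss₁, gauss₂]; ring
  rwa [e, avg_neg, neg_neg] at this

end
end ViscousHJ

/-! ### Duhamel integrals with endpoint singularities -/

namespace ViscousHJ

open Filter Topology MeasureTheory

theorem inv_sqrt_eq_rpow {s : ℝ} (hs : 0 ≤ s) : (√s)⁻¹ = s ^ (-(1 / 2) : ℝ) := by
  rw [Real.rpow_neg hs, Real.sqrt_eq_rpow]

theorem intervalIntegrable_inv_sqrt {t : ℝ} (ht : 0 ≤ t) :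
    IntervalIntegrable (fun s => (√s)⁻¹) volume 0 t := by
  refine (intervalIntegral.intervalIntegrable_rpow' (r := -(1 / 2)) (by norm_num)).congr ?_
  rw [uIoc_of_le ht]
  intro s hs
  exact (inv_sqrt_eq_rpow hs.1.le).symm

theorem integral_inv_sqrt {t : ℝ} (ht : 0 ≤ t) : ∫ s in (0 : ℝ)..t, (√s)⁻¹ = 2 * √t := by
  rw [intervalIntegral.integral_congr (g := fun s => s ^ (-(1 / 2) : ℝ)) (fun s hs => by
    rw [uIcc_of_le ht] at hs; exact inv_sqrt_eq_rpow hs.1),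
    integral_rpow (Or.inl (by norm_num)), Real.sqrt_eq_rpow]
  norm_num
  ring

theorem intervalIntegrable_inv_sqrt_sub {t : ℝ} (ht : 0 ≤ t) :
    IntervalIntegrable (fun s => (√(t - s))⁻¹) volume 0 t := by
  have := ((intervalIntegrable_inv_sqrt ht).comp_sub_left t).symm
  simpa using this

theorem integral_inv_sqrt_sub {t : ℝ} (ht : 0 ≤ t) :
    ∫ s in (0 : ℝ)..t, (√(t - s))⁻¹ = 2 * √t := by
  have := intervalIntegral.integral_comp_sub_left (a := 0) (b := t) (fun s => (√s)⁻¹) t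
  rw [this, sub_self, sub_zero, integral_inv_sqrt ht]

/-- The singular weight dominating Duhamel integrals. -/
noncomputable def singWeight (r s : ℝ) : ℝ := (√r)⁻¹ * (√s)⁻¹

theorem singWeight_nonneg (r s : ℝ) : 0 ≤ singWeight r s := by unfold singWeight; positivity

/-- This is √(r + s) ≤ √r + √s divided by √r √s √(r + s); it splits the two singularities into
separately integrable terms. -/
theorem singWeight_le {r s : ℝ} (hr : 0 < r) (hs : 0 < s) :
    singWeight r s ≤ (√(r + s))⁻¹ * ((√s)⁻¹ + (√r)⁻¹) := by
  have h1 := Real.sqrt_pos.2 hr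
  have h2 := Real.sqrt_pos.2 hs
  have h3 : 0 < √(r + s) := Real.sqrt_pos.2 (by positivity)
  have h4 : √(r + s) ≤ √r + √s := Real.sqrt_le_iff.2
    ⟨by positivity, by nlinarith [Real.sq_sqrt hr.le, Real.sq_sqrt hs.le]⟩
  rw [singWeight, ← sub_nonneg]
  have e : (√(r + s))⁻¹ * ((√s)⁻¹ + (√r)⁻¹) - (√r)⁻¹ * (√s)⁻¹
      = (√r + √s - √(r + s)) * ((√(r + s))⁻¹ * (√r)⁻¹ * (√s)⁻¹) := by
    field_simp
  rw [e]
  exact mul_nonneg (by linarith) (by positivity)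

theorem intervalIntegrable_singWeight {t : ℝ} (ht : 0 < t) :
    IntervalIntegrable (fun s => singWeight (t - s) s) volume 0 t := by
  refine (((intervalIntegrable_inv_sqrt ht.le).add
    (intervalIntegrable_inv_sqrt_sub ht.le)).const_mul (√t)⁻¹).mono_fun'
    (Measurable.aestronglyMeasurable (by unfold singWeight; fun_prop)) ?_
  rw [uIoc_of_le ht.le, ← restrict_Ioo_eq_restrict_Ioc]
  filter_upwards [ae_restrict_mem measurableSet_Ioo] with s hs
  rw [Real.norm_of_nonneg (singWeight_nonneg _ _)]
  have := singWeight_le (sub_pos.2 hs.2) hs.1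
  rwa [sub_add_cancel] at this

/-- The integral is a Beta function value independent of t (namely π); only a bound uniform in t is
needed. -/
theorem integral_singWeight_le {t : ℝ} (ht : 0 < t) :
    ∫ s in (0 : ℝ)..t, singWeight (t - s) s ≤ 4 := by
  have h1 := intervalIntegral.integral_mono_on_of_le_Ioo ht.le (intervalIntegrable_singWeight ht)
    (((intervalIntegrable_inv_sqrt ht.le).add
    (intervalIntegrable_inv_sqrt_sub ht.le)).const_mul (√t)⁻¹) (fun s hs => by
      have := singWeight_le (sub_pos.2 hs.2) hs.1
      rwa [sub_add_cancel] at this)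
  refine h1.trans (le_of_eq ?_)
  rw [intervalIntegral.integral_const_mul]
  rw [intervalIntegral.integral_add (intervalIntegrable_inv_sqrt ht.le)
    (intervalIntegrable_inv_sqrt_sub ht.le), integral_inv_sqrt ht.le, integral_inv_sqrt_sub ht.le]
  have := (Real.sqrt_pos.2 ht).ne'
  field_simp
  norm_num

/-- Kernels `H x r s` with an integrable singularity at `r = 0` and `s = 0`. -/
structure IsSingular (T C : ℝ) (H : ℝ → ℝ → ℝ → ℝ) : Prop where
  cont : ContinuousOn (fun p : ℝ × ℝ × ℝ => H p.1 p.2.1 p.2.2) (univ ×ˢ Ioc 0 T ×ˢ Ioc 0 T)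
  bound : ∀ x, ∀ r ∈ Ioc 0 T, ∀ s ∈ Ioc 0 T, |H x r s| ≤ C * singWeight r s

/-- The Duhamel integral of a kernel. -/
noncomputable def duhamel (H : ℝ → ℝ → ℝ → ℝ) (x t : ℝ) : ℝ := ∫ s in (0 : ℝ)..t, H x (t - s) s

section
variable {T C : ℝ} {H : ℝ → ℝ → ℝ → ℝ}

theorem sub_mem_Ioc {t s : ℝ} (ht : t ≤ T) (hs : s ∈ Ioo 0 t) : t - s ∈ Ioc 0 T :=
  ⟨sub_pos.2 hs.2, by linarith [hs.1]⟩

theorem IsSingular.continuousOn_slice (hH : IsSingular T C H) {t : ℝ} (ht : t ≤ T) (x : ℝ) :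
    ContinuousOn (fun s => H x (t - s) s) (Ioo 0 t) :=
  hH.cont.comp (f := fun s => (x, t - s, s)) (by fun_prop) fun s hs =>
    ⟨mem_univ _, sub_mem_Ioc ht hs, hs.1, hs.2.le.trans ht⟩

theorem IsSingular.aestronglyMeasurable (hH : IsSingular T C H) {t : ℝ} (ht0 : 0 ≤ t) (ht : t ≤ T)
    (x : ℝ) : AEStronglyMeasurable (fun s => H x (t - s) s) (volume.restrict (uIoc 0 t)) := by
  rw [uIoc_of_le ht0, ← restrict_Ioo_eq_restrict_Ioc]
  exact (hH.continuousOn_slice ht x).aestronglyMeasurable measurableSet_Ioo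

theorem IsSingular.ae_bound (hH : IsSingular T C H) {t : ℝ} (ht0 : 0 ≤ t) (ht : t ≤ T) :
    ∀ᵐ s, s ∈ uIoc 0 t → ∀ x, ‖H x (t - s) s‖ ≤ C * singWeight (t - s) s := by
  rw [uIoc_of_le ht0, ← ae_restrict_iff' measurableSet_Ioc, ← restrict_Ioo_eq_restrict_Ioc]
  filter_upwards [ae_restrict_mem measurableSet_Ioo] with s hs x
  exact hH.bound x _ (sub_mem_Ioc ht hs) _ ⟨hs.1, hs.2.le.trans ht⟩

theorem IsSingular.intervalIntegrable (hH : IsSingular T C H) {t : ℝ} (ht : t ∈ Ioc 0 T) (x : ℝ) :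
    IntervalIntegrable (fun s => H x (t - s) s) volume 0 t := by
  refine ((intervalIntegrable_singWeight ht.1).const_mul C).mono_fun'
    (hH.aestronglyMeasurable ht.1.le ht.2 x) ?_
  exact (ae_restrict_iff' measurableSet_uIoc).2
    ((hH.ae_bound ht.1.le ht.2).mono fun s h hs => h hs x)

theorem IsSingular.abs_duhamel_le (hH : IsSingular T C H) (hC : 0 ≤ C) {t : ℝ} (ht : t ∈ Ioc 0 T)
    (x : ℝ) : |duhamel H x t| ≤ C * 4 := by
  have h1 := intervalIntegral.norm_integral_le_of_norm_le (μ := volume) ht.1.le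
    (f := fun s => H x (t - s) s) (g := fun s => C * singWeight (t - s) s)
    (by
      have := hH.ae_bound ht.1.le ht.2
      rw [uIoc_of_le ht.1.le] at this
      exact this.mono fun s h hs => h hs x)
    ((intervalIntegrable_singWeight ht.1).const_mul C)
  rw [intervalIntegral.integral_const_mul] at h1
  exact h1.trans (mul_le_mul_of_nonneg_left (integral_singWeight_le ht.1) hC)

/-- The substitution s = t σ fixes the interval of integration. As the singular weight is
homogeneous of degree -1, the scaled integrand has a majorant independent of t, which gives joint
continuity by dominated convergence. -/
theorem duhamel_eq_scaled (H : ℝ → ℝ → ℝ → ℝ) (x t : ℝ) :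
    duhamel H x t = ∫ σ in (0 : ℝ)..1, t * H x (t * (1 - σ)) (t * σ) := by
  have := intervalIntegral.smul_integral_comp_mul_left (a := 0) (b := 1)
    (fun s => H x (t - s) s) t
  rw [mul_zero, mul_one] at this
  rw [duhamel, ← this, smul_eq_mul, ← intervalIntegral.integral_const_mul]
  congr 1; funext σ
  rw [mul_sub, mul_one]

theorem IsSingular.continuousOn_duhamel (hH : IsSingular T C H) :
    ContinuousOn (fun p : ℝ × ℝ => duhamel H p.1 p.2) (univ ×ˢ Ioc 0 T) := by
  simp only [duhamel_eq_scaled]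
  have hmem : ∀ p : ℝ × ℝ, p ∈ (univ : Set ℝ) ×ˢ Ioc 0 T → ∀ σ ∈ Ioo (0 : ℝ) 1,
      (p.1, p.2 * (1 - σ), p.2 * σ) ∈ (univ : Set ℝ) ×ˢ Ioc 0 T ×ˢ Ioc 0 T := by
    intro p hp σ hσ
    have ht := hp.2
    exact ⟨mem_univ _, ⟨mul_pos ht.1 (sub_pos.2 hσ.2), by nlinarith [ht.1, ht.2, hσ.1]⟩,
      ⟨mul_pos ht.1 hσ.1, by nlinarith [ht.1, ht.2, hσ.2]⟩⟩
  have hIoo : ∀ {P : ℝ → Prop}, (∀ σ ∈ Ioo (0 : ℝ) 1, P σ) → ∀ᵐ σ, σ ∈ uIoc (0 : ℝ) 1 → P σ := by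
    intro P hP
    rw [uIoc_of_le zero_le_one, ← ae_restrict_iff' measurableSet_Ioc,
      ← restrict_Ioo_eq_restrict_Ioc]
    filter_upwards [ae_restrict_mem measurableSet_Ioo] with σ hσ using hP σ hσ
  intro p₀ hp₀
  refine intervalIntegral.continuousWithinAt_of_dominated_interval
    (bound := fun σ => C * singWeight (1 - σ) σ) ?_ ?_
    ((intervalIntegrable_singWeight one_pos).const_mul C) ?_
  · filter_upwards [self_mem_nhdsWithin] with p hp
    rw [uIoc_of_le zero_le_one, ← restrict_Ioo_eq_restrict_Ioc]
    refine ContinuousOn.aestronglyMeasurable ?_ measurableSet_Ioo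
    exact continuousOn_const.mul (hH.cont.comp
      (f := fun σ => (p.1, p.2 * (1 - σ), p.2 * σ)) (by fun_prop) (hmem p hp))
  · filter_upwards [self_mem_nhdsWithin] with p hp
    refine hIoo fun σ hσ => ?_
    have h1 := hH.bound p.1 _ (hmem p hp σ hσ).2.1 _ (hmem p hp σ hσ).2.2
    have ht0 : 0 < p.2 := hp.2.1
    have e : p.2 * singWeight (p.2 * (1 - σ)) (p.2 * σ) = singWeight (1 - σ) σ := by
      simp only [singWeight]
      rw [Real.sqrt_mul ht0.le, Real.sqrt_mul ht0.le]
      have h2 := Real.sqrt_pos.2 ht0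
      have h3 := Real.mul_self_sqrt ht0.le
      have h4 : p.2 * ((√p.2)⁻¹ * (√p.2)⁻¹) = 1 := by
        rw [← mul_inv, h3]; exact mul_inv_cancel₀ ht0.ne'
      rw [mul_inv, mul_inv]
      linear_combination (√(1 - σ))⁻¹ * (√σ)⁻¹ * h4
    rw [Real.norm_eq_abs, abs_mul, abs_of_pos ht0, ← e]
    calc p.2 * |H p.1 (p.2 * (1 - σ)) (p.2 * σ)|
        ≤ p.2 * (C * singWeight (p.2 * (1 - σ)) (p.2 * σ)) :=
          mul_le_mul_of_nonneg_left h1 ht0.le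
      _ = _ := by ring
  · refine hIoo fun σ hσ => ?_
    refine continuousWithinAt_snd.mul ?_
    exact (hH.cont _ (hmem p₀ hp₀ σ hσ)).comp
      (f := fun p : ℝ × ℝ => (p.1, p.2 * (1 - σ), p.2 * σ)) (by fun_prop)
      (fun p hp => hmem p hp σ hσ)

theorem IsSingular.hasDerivAt_duhamel {H' : ℝ → ℝ → ℝ → ℝ} {C' : ℝ} (hH : IsSingular T C H)
    (hH' : IsSingular T C' H')
    (hd : ∀ x, ∀ r ∈ Ioc 0 T, ∀ s ∈ Ioc 0 T, HasDerivAt (fun x => H x r s) (H' x r s) x)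
    {t : ℝ} (ht : t ∈ Ioc 0 T) (x : ℝ) :
    HasDerivAt (fun x => duhamel H x t) (duhamel H' x t) x := by
  refine (intervalIntegral.hasDerivAt_integral_of_dominated_loc_of_deriv_le (μ := volume)
    (F := fun x s => H x (t - s) s) (F' := fun x s => H' x (t - s) s)
    (bound := fun s => C' * singWeight (t - s) s) univ_mem ?_ ?_ ?_ ?_ ?_ ?_).2
  · exact Eventually.of_forall fun x => hH.aestronglyMeasurable ht.1.le ht.2 x
  · exact hH.intervalIntegrable ht x
  · exact hH'.aestronglyMeasurable ht.1.le ht.2 x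
  · exact (hH'.ae_bound ht.1.le ht.2).mono fun s h hs x _ => h hs x
  · exact (intervalIntegrable_singWeight ht.1).const_mul C'
  · rw [uIoc_of_le ht.1.le, ← ae_restrict_iff' measurableSet_Ioc, ← restrict_Ioo_eq_restrict_Ioc]
    filter_upwards [ae_restrict_mem measurableSet_Ioo] with s hs x _
    exact hd x _ (sub_mem_Ioc ht.2 hs) _ ⟨hs.1, hs.2.le.trans ht.2⟩

/-- A Duhamel integral as a time integral, by exchanging the order of integration. -/
theorem integral_duhamel_swap {t C : ℝ} (ht : 0 < t) (hC : 0 ≤ C) {k a : ℝ → ℝ → ℝ} {F : ℝ → ℝ}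
    (hk : ContinuousOn (fun p : ℝ × ℝ => k p.1 p.2) (Ioc 0 t ×ˢ Ioc 0 t))
    (hkb : ∀ r ∈ Ioc 0 t, ∀ s ∈ Ioc 0 t, |k r s| ≤ C * singWeight r s)
    (hd : ∀ r ∈ Ioc 0 t, ∀ s ∈ Ioc 0 t, HasDerivAt (fun r => a r s) (k r s) r)
    (hl : ∀ s ∈ Ioc 0 t, Tendsto (fun r => a r s) (𝓝[>] 0) (𝓝 (F s)))
    (hF : IntervalIntegrable F volume 0 t) :
    IntervalIntegrable (fun t' => F t' + ∫ s in (0 : ℝ)..t', k (t' - s) s) volume 0 t ∧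
    ∫ s in (0 : ℝ)..t, a (t - s) s
      = ∫ t' in (0 : ℝ)..t, (F t' + ∫ s in (0 : ℝ)..t', k (t' - s) s) := by
  set μ := volume.restrict (Ioo 0 t) with hμ
  -- The kernel is extended by zero from the triangle s < t' to the square, so that Fubini's theorem
  -- applies to a product measure.
  set J : ℝ → ℝ → ℝ := fun s t' => (Ioi s).indicator (fun t' => k (t' - s) s) t' with hJ
  have hJ' : ∀ s t', J s t' = (Iio t').indicator (fun s => k (t' - s) s) s := by
    intro s t'
    simp only [hJ, indicator, mem_Ioi, mem_Iio]
  have hkr : ∀ s ∈ Ioc 0 t, ContinuousOn (fun r => k r s) (Ioc 0 t) := fun s hs =>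
    hk.comp (f := fun r => (r, s)) (by fun_prop) fun _ hr => ⟨hr, hs⟩
  -- integrability in the inner variable
  have hkint : ∀ s ∈ Ioo 0 t, IntervalIntegrable (fun r => k r s) volume 0 (t - s) := by
    intro s hs
    have hts : 0 ≤ t - s := by linarith [hs.2]
    have hsub : uIoc 0 (t - s) ⊆ Ioc 0 t := by
      rw [uIoc_of_le hts]; exact Ioc_subset_Ioc_right (by linarith [hs.1])
    refine ((intervalIntegrable_inv_sqrt hts).const_mul (C * (√s)⁻¹)).mono_fun'
      (((hkr s (Ioo_subset_Ioc_self hs)).mono hsub).aestronglyMeasurable measurableSet_uIoc) ?_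
    filter_upwards [ae_restrict_mem measurableSet_uIoc] with r hr
    refine (hkb r (hsub hr) s (Ioo_subset_Ioc_self hs)).trans (le_of_eq ?_)
    rw [singWeight]; ring
  have hFTC : ∀ s ∈ Ioo 0 t, a (t - s) s = F s + ∫ r in (0 : ℝ)..(t - s), k r s := by
    intro s hs
    have hts : 0 < t - s := by linarith [hs.2]
    have hs' := Ioo_subset_Ioc_self hs
    have hmem : t - s ∈ Ioc 0 t := ⟨hts, by linarith [hs.1]⟩
    rw [intervalIntegral.integral_eq_sub_of_hasDerivAt_of_tendsto hts
      (fun r hr => hd r ⟨hr.1, hr.2.le.trans hmem.2⟩ s hs') (hkint s hs) (hl s hs')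
      ((hd _ hmem s hs').continuousAt.tendsto.mono_left nhdsWithin_le_nhds)]
    ring
  have hinner₁ : ∀ s ∈ Ioo 0 t, ∀ p : ℝ → ℝ,
      ∫ t', (Ioi s).indicator (fun t' => p (t' - s)) t' ∂μ = ∫ r in (0 : ℝ)..(t - s), p r := by
    intro s hs p
    rw [hμ, integral_indicator measurableSet_Ioi, Measure.restrict_restrict measurableSet_Ioi]
    have e : Ioi s ∩ Ioo 0 t = Ioo s t := by
      ext r; simp only [mem_inter_iff, mem_Ioi, mem_Ioo]
      exact ⟨fun h => ⟨h.1, h.2.2⟩, fun h => ⟨h.1, hs.1.trans h.1, h.2⟩⟩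
    rw [e, ← integral_Ioc_eq_integral_Ioo, ← intervalIntegral.integral_of_le hs.2.le,
      intervalIntegral.integral_comp_sub_right p s, sub_self]
  have hinner₂ : ∀ t' ∈ Ioo 0 t, ∫ s, J s t' ∂μ = ∫ s in (0 : ℝ)..t', k (t' - s) s := by
    intro t' ht'
    simp only [hJ']
    rw [hμ, integral_indicator measurableSet_Iio, Measure.restrict_restrict measurableSet_Iio]
    have e : Iio t' ∩ Ioo 0 t = Ioo 0 t' := by
      ext r; simp only [mem_inter_iff, mem_Iio, mem_Ioo]
      exact ⟨fun h => ⟨h.2.1, h.1⟩, fun h => ⟨h.2, h.1, h.2.trans ht'.2⟩⟩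
    rw [e, ← integral_Ioc_eq_integral_Ioo, ← intervalIntegral.integral_of_le ht'.1.le]
  -- joint integrability
  have hmeas : AEStronglyMeasurable (Function.uncurry J) (μ.prod μ) := by
    set D : Set (ℝ × ℝ) := {p | p.1 < p.2} with hD
    have hDm : MeasurableSet D := (isOpen_lt continuous_fst continuous_snd).measurableSet
    have e : Function.uncurry J = D.indicator fun p => k (p.2 - p.1) p.1 := by
      funext p
      simp only [Function.uncurry, hJ, indicator, mem_Ioi, hD, mem_ofPred_eq]
    rw [e, aestronglyMeasurable_indicator_iff hDm, hμ, Measure.prod_restrict,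
      Measure.restrict_restrict hDm]
    refine ContinuousOn.aestronglyMeasurable ?_
      (hDm.inter (measurableSet_Ioo.prod measurableSet_Ioo))
    refine hk.comp (f := fun p : ℝ × ℝ => (p.2 - p.1, p.1)) (by fun_prop) ?_
    rintro p ⟨hp1, hp2, hp3⟩
    have : p.1 < p.2 := hp1
    exact ⟨⟨by simpa using this, by simp only; linarith [hp3.2, hp2.1]⟩, hp2.1, hp2.2.le⟩
  have hJs : ∀ s ∈ Ioo 0 t, Integrable (J s) μ := by
    intro s hs
    rw [hμ, hJ]
    simp only
    rw [integrable_indicator_iff measurableSet_Ioi, IntegrableOn,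
      Measure.restrict_restrict measurableSet_Ioi]
    have h1 := (hkint s hs).comp_sub_right s
    rw [zero_add, sub_add_cancel, intervalIntegrable_iff_integrableOn_Ioo_of_le hs.2.le] at h1
    refine h1.mono_set ?_
    rintro r ⟨hr1, hr2⟩
    exact ⟨hr1, hr2.2⟩
  -- Integrating the singularity at t' = s costs only a factor √t and leaves (√s)⁻¹, which is
  -- integrable; this gives joint integrability.
  have hnorm : ∀ s ∈ Ioo 0 t, ∫ t', ‖J s t'‖ ∂μ ≤ 2 * C * √t * (√s)⁻¹ := by
    intro s hs
    have hts : 0 ≤ t - s := by linarith [hs.2]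
    have e : (fun t' => ‖J s t'‖) = (Ioi s).indicator fun t' => |k (t' - s) s| := by
      funext t'
      simp only [hJ, indicator]
      split_ifs <;> simp
    rw [e, hinner₁ s hs fun r => |k r s|]
    have h1 := intervalIntegral.integral_mono_on_of_le_Ioo hts (hkint s hs).abs
      ((intervalIntegrable_inv_sqrt hts).const_mul (C * (√s)⁻¹)) (fun r hr => by
        refine (hkb r ⟨hr.1, by linarith [hr.2, hs.1]⟩ s (Ioo_subset_Ioc_self hs)).trans
          (le_of_eq ?_)
        rw [singWeight]; ring)
    rw [intervalIntegral.integral_const_mul, integral_inv_sqrt hts] at h1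
    have h2 : √(t - s) ≤ √t := Real.sqrt_le_sqrt (by linarith [hs.1])
    have h3 := mul_le_mul_of_nonneg_left h2 (by positivity : 0 ≤ 2 * C * (√s)⁻¹)
    linarith
  have hInt : Integrable (Function.uncurry J) (μ.prod μ) := by
    rw [integrable_prod_iff hmeas]
    constructor
    · rw [hμ]
      filter_upwards [ae_restrict_mem measurableSet_Ioo] with s hs
      exact hJs s hs
    · have h1 := ((intervalIntegrable_inv_sqrt ht.le).const_mul (2 * C * √t))
      rw [intervalIntegrable_iff_integrableOn_Ioo_of_le ht.le] at h1
      refine h1.mono' hmeas.norm.integral_prod_right' ?_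
      filter_upwards [ae_restrict_mem measurableSet_Ioo] with s hs
      rw [Real.norm_of_nonneg (integral_nonneg fun _ => norm_nonneg _)]
      exact hnorm s hs
  have hFμ : Integrable F μ := by
    rw [intervalIntegrable_iff_integrableOn_Ioo_of_le ht.le] at hF; exact hF
  have hI1 : Integrable (fun s => ∫ t', J s t' ∂μ) μ := hInt.integral_prod_left
  have hI2 : Integrable (fun t' => ∫ s, J s t' ∂μ) μ := hInt.integral_prod_right
  have hae : ∀ᵐ t' ∂μ, (F t' + ∫ s, J s t' ∂μ) = F t' + ∫ s in (0 : ℝ)..t', k (t' - s) s := by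
    rw [hμ]
    filter_upwards [ae_restrict_mem measurableSet_Ioo] with t' ht'
    rw [hinner₂ t' ht']
  constructor
  · rw [intervalIntegrable_iff_integrableOn_Ioo_of_le ht.le]
    exact (hFμ.add hI2).congr hae
  · rw [intervalIntegral.integral_of_le ht.le, intervalIntegral.integral_of_le ht.le,
      integral_Ioc_eq_integral_Ioo, integral_Ioc_eq_integral_Ioo]
    calc ∫ s, a (t - s) s ∂μ = ∫ s, (F s + ∫ t', J s t' ∂μ) ∂μ := by
          refine integral_congr_ae ?_
          rw [hμ]
          filter_upwards [ae_restrict_mem measurableSet_Ioo] with s hs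
          rw [hFTC s hs, ← hinner₁ s hs fun r => k r s]
      _ = ∫ t', (F t' + ∫ s, J s t' ∂μ) ∂μ := by
          rw [integral_add hFμ hI1, integral_add hFμ hI2, integral_integral_swap hInt]
      _ = _ := integral_congr_ae hae

end
end ViscousHJ

/-! ### Heat potentials of sources and the fixed point principle -/

namespace ViscousHJ

open Filter Topology MeasureTheory

/-- Bounded continuous sources on `ℝ × (0, T]`, Lipschitz in space with constant `K / √t`. -/
structure IsSource (T C K : ℝ) (F : ℝ → ℝ → ℝ) : Prop where
  cont : ContinuousOn (fun p : ℝ × ℝ => F p.1 p.2) (univ ×ˢ Ioc 0 T)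
  bound : ∀ x, ∀ t ∈ Ioc 0 T, |F x t| ≤ C
  lip : ∀ x x', ∀ t ∈ Ioc 0 T, |F x t - F x' t| ≤ K * (√t)⁻¹ * |x - x'|

/-- The heat kernel averages of a source and their space derivatives. -/
noncomputable def heat₀ (ε : ℝ) (F : ℝ → ℝ → ℝ) (x r s : ℝ) : ℝ :=
  avg gauss₀ (fun z => F z s) x √(ε * r)
/-- First space derivative of `heat₀`. -/
noncomputable def heat₁ (ε : ℝ) (F : ℝ → ℝ → ℝ) (x r s : ℝ) : ℝ :=
  avg gauss₁ (fun z => F z s) x √(ε * r) / √(ε * r)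
/-- Second space derivative of `heat₀`. -/
noncomputable def heat₂ (ε : ℝ) (F : ℝ → ℝ → ℝ) (x r s : ℝ) : ℝ :=
  avg gauss₂ (fun z => F z s) x √(ε * r) / (ε * r)

section
variable {ε T C K : ℝ} {F : ℝ → ℝ → ℝ}

theorem continuous_slice (hF : ContinuousOn (fun p : ℝ × ℝ => F p.1 p.2) (univ ×ˢ Ioc 0 T)) {s : ℝ}
    (hs : s ∈ Ioc 0 T) : Continuous fun z => F z s :=
  continuousOn_univ.1 (hF.comp (f := fun z => (z, s)) (by fun_prop) fun _ _ => ⟨mem_univ _, hs⟩)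

theorem continuousOn_avg {m : ℝ → ℝ} (hm : IsRapid m)
    (hF : ContinuousOn (fun p : ℝ × ℝ => F p.1 p.2) (univ ×ˢ Ioc 0 T))
    (hb : ∀ x, ∀ t ∈ Ioc 0 T, |F x t| ≤ C) :
    ContinuousOn (fun p : ℝ × ℝ × ℝ => avg m (fun z => F z p.2.2) p.1 √(ε * p.2.1))
      (univ ×ˢ Ioc 0 T ×ˢ Ioc 0 T) := by
  refine hm.continuousOn_integral
    (Φ := fun (p : ℝ × ℝ × ℝ) ξ => F (p.1 + √(ε * p.2.1) * ξ) p.2.2) ?_ ?_ ?_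
  · intro p hp
    exact (continuous_slice hF hp.2.2).comp (f := fun ξ => p.1 + √(ε * p.2.1) * ξ) (by fun_prop)
  · intro ξ
    exact hF.comp (f := fun p : ℝ × ℝ × ℝ => (p.1 + √(ε * p.2.1) * ξ, p.2.2)) (by fun_prop)
      fun p hp => ⟨mem_univ _, hp.2.2⟩
  · intro p₀ hp₀
    refine ⟨C, ?_⟩
    filter_upwards [self_mem_nhdsWithin] with p hp ξ
    have h1 := hb (p.1 + √(ε * p.2.1) * ξ) p.2.2 hp.2.2
    nlinarith [abs_nonneg ξ, (abs_nonneg _).trans h1]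

theorem one_le_mul_inv_sqrt {s : ℝ} (hs : s ∈ Ioc 0 T) : 1 ≤ √T * (√s)⁻¹ := by
  rw [← div_eq_mul_inv, one_le_div (Real.sqrt_pos.2 hs.1)]
  exact Real.sqrt_le_sqrt hs.2

theorem isSingular_heat₀ (hF : ContinuousOn (fun p : ℝ × ℝ => F p.1 p.2) (univ ×ˢ Ioc 0 T))
    (hb : ∀ x, ∀ t ∈ Ioc 0 T, |F x t| ≤ C) (hC : 0 ≤ C) :
    IsSingular T (C * (∫ ξ, |gauss₀ ξ|) * (√T * √T)) (heat₀ ε F) where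
  cont := continuousOn_avg isRapid_gauss₀ hF hb
  bound x r hr s hs := by
    have h1 := abs_avg_le_of_bounded isRapid_gauss₀ (fun z => hb z s hs) x √(ε * r)
    have hκ : 0 ≤ ∫ ξ, |gauss₀ ξ| := integral_nonneg fun _ => abs_nonneg _
    have h2 := mul_le_mul (one_le_mul_inv_sqrt hr) (one_le_mul_inv_sqrt hs) zero_le_one
      (zero_le_one.trans (one_le_mul_inv_sqrt hr))
    have h3 := mul_le_mul_of_nonneg_left h2 (mul_nonneg hC hκ)
    refine h1.trans (le_trans (by linarith) (h3.trans (le_of_eq ?_)))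
    rw [singWeight]; ring

/-- Only r is singular here. Inserting 1 ≤ √T / √s puts the bound into the common form and supplies
the factor √T that makes the Picard map contract. -/
theorem isSingular_heat₁ (hε : 0 < ε)
    (hF : ContinuousOn (fun p : ℝ × ℝ => F p.1 p.2) (univ ×ˢ Ioc 0 T))
    (hb : ∀ x, ∀ t ∈ Ioc 0 T, |F x t| ≤ C) (hC : 0 ≤ C) :
    IsSingular T (C * (∫ ξ, |gauss₁ ξ|) * (√ε)⁻¹ * √T) (heat₁ ε F) where
  cont := by
    refine (continuousOn_avg isRapid_gauss₁ hF hb).div (by fun_prop) fun p hp => ?_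
    exact (Real.sqrt_pos.2 (mul_pos hε hp.2.1.1)).ne'
  bound x r hr s hs := by
    have h1 := abs_avg_le_of_bounded isRapid_gauss₁ (fun z => hb z s hs) x √(ε * r)
    have hκ : 0 ≤ ∫ ξ, |gauss₁ ξ| := integral_nonneg fun _ => abs_nonneg _
    have h2 := one_le_mul_inv_sqrt hs
    rw [heat₁, abs_div, abs_of_nonneg (Real.sqrt_nonneg _), div_eq_mul_inv, Real.sqrt_mul hε.le,
      mul_inv]
    have h3 : 0 ≤ (√ε)⁻¹ * (√r)⁻¹ := by positivity
    rw [Real.sqrt_mul hε.le] at h1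
    have h4 := mul_le_mul_of_nonneg_right h1 h3
    have h5 := mul_le_mul_of_nonneg_left h2
      (by positivity : 0 ≤ C * (∫ ξ, |gauss₁ ξ|) * ((√ε)⁻¹ * (√r)⁻¹))
    refine h4.trans (le_trans (by linarith) (h5.trans (le_of_eq ?_)))
    rw [singWeight]; ring

theorem div_mul_eq_inv_sqrt (hε : 0 < ε) {r : ℝ} (hr : 0 < r) (A : ℝ) :
    √(ε * r) * A / (ε * r) = A * ((√ε)⁻¹ * (√r)⁻¹) := by
  have h1 := Real.mul_self_sqrt (mul_pos hε hr).le
  have h2 := (Real.sqrt_pos.2 (mul_pos hε hr)).ne'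
  rw [← mul_inv, ← Real.sqrt_mul hε.le, div_eq_iff (mul_pos hε hr).ne']
  have h3 : A * (√(ε * r))⁻¹ * (ε * r) = A * (√(ε * r))⁻¹ * (√(ε * r) * √(ε * r)) := by rw [h1]
  rw [h3]
  field_simp

/-- The second Hermite weight has mean zero, so the spatial Lipschitz constant K/√s of the source
gains a factor √(ε r) and reduces 1/r to the integrable r^(-1/2) s^(-1/2). -/
theorem isSingular_heat₂ (hε : 0 < ε) (hF : IsSource T C K F) :
    IsSingular T (K * (∫ ξ, |ξ| * |gauss₂ ξ|) * (√ε)⁻¹) (heat₂ ε F) where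
  cont := by
    refine (continuousOn_avg isRapid_gauss₂ hF.cont hF.bound).div (by fun_prop) fun p hp => ?_
    exact (mul_pos hε hp.2.1.1).ne'
  bound x r hr s hs := by
    have h1 := abs_avg_sub_le_of_lipschitz isRapid_gauss₂ (continuous_slice hF.cont hs)
      (fun y z => hF.lip y z s hs) x (Real.sqrt_nonneg (ε * r))
    rw [integral_gauss₂, mul_zero, sub_zero] at h1
    have h2 := mul_pos hε hr.1
    rw [heat₂, abs_div, abs_of_pos h2]
    refine (div_le_div_of_nonneg_right h1 h2.le).trans (le_of_eq ?_)
    rw [mul_assoc, div_mul_eq_inv_sqrt hε hr.1, singWeight]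
    ring

theorem hasDerivAt_heat₀ (hε : 0 < ε) (hF : IsSource T C K F) (x : ℝ) {r s : ℝ} (hr : 0 < r)
    (hs : s ∈ Ioc 0 T) : HasDerivAt (fun x => heat₀ ε F x r s) (heat₁ ε F x r s) x :=
  hasDerivAt_avg_gauss₀ (continuous_slice hF.cont hs)
    (linGrowth_of_bounded fun z => hF.bound z s hs) (Real.sqrt_pos.2 (mul_pos hε hr)) x

theorem div_sqrt_div_sqrt (hε : 0 < ε) {r : ℝ} (hr : 0 < r) (A : ℝ) :
    A / √(ε * r) / √(ε * r) = A / (ε * r) := by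
  rw [div_div, Real.mul_self_sqrt (mul_pos hε hr).le]

theorem hasDerivAt_heat₁ (hε : 0 < ε) (hF : IsSource T C K F) (x : ℝ) {r s : ℝ} (hr : 0 < r)
    (hs : s ∈ Ioc 0 T) : HasDerivAt (fun x => heat₁ ε F x r s) (heat₂ ε F x r s) x := by
  have := (hasDerivAt_avg_gauss₁ (continuous_slice hF.cont hs)
    (linGrowth_of_bounded fun z => hF.bound z s hs) (Real.sqrt_pos.2 (mul_pos hε hr)) x).div_const
    √(ε * r)
  rwa [div_sqrt_div_sqrt hε hr] at this

theorem hasDerivAt_avg_gauss₀_time {φ : ℝ → ℝ} (hε : 0 < ε) (hφ : Continuous φ)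
    (hg : LinGrowth φ) (x : ℝ) {r : ℝ} (hr : 0 < r) :
    HasDerivAt (fun r => avg gauss₀ φ x √(ε * r)) (ε / 2 * (avg gauss₂ φ x √(ε * r) / (ε * r)))
      r := by
  have h0 := mul_pos hε hr
  have h1 := hasDerivAt_avg_gauss₀_right hφ hg (Real.sqrt_pos.2 h0) x
  have h2 : HasDerivAt (fun r => √(ε * r)) (ε * 1 / (2 * √(ε * r))) r :=
    ((hasDerivAt_id r).const_mul ε).sqrt h0.ne'
  refine (HasDerivAt.comp (h := fun r => √(ε * r)) r h1 h2).congr_deriv ?_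
  rw [← div_sqrt_div_sqrt hε hr]
  ring

/-- The kernel `heat₀` tends to F as r tends to 0 and has r-derivative (ε/2) `heat₂`. Writing the
potential as a time integral makes it differentiable in t without differentiating at the singular
moving endpoint. -/
theorem IsSource.duhamel_eq (hε : 0 < ε) (hF : IsSource T C K F) (hK : 0 ≤ K) (x : ℝ) {t : ℝ}
    (ht : t ∈ Ioc 0 T) :
    IntervalIntegrable (fun t' => F x t' + ε / 2 * duhamel (heat₂ ε F) x t') volume 0 t ∧
    duhamel (heat₀ ε F) x t
      = ∫ t' in (0 : ℝ)..t, (F x t' + ε / 2 * duhamel (heat₂ ε F) x t') := by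
  have hsub : Ioc 0 t ⊆ Ioc 0 T := Ioc_subset_Ioc_right ht.2
  have hs2 := isSingular_heat₂ hε hF
  have hκ : 0 ≤ ∫ ξ, |ξ| * |gauss₂ ξ| := integral_nonneg fun _ => by positivity
  have := integral_duhamel_swap (t := t) (C := ε / 2 * (K * (∫ ξ, |ξ| * |gauss₂ ξ|) * (√ε)⁻¹)) ht.1
    (by positivity) (k := fun r s => ε / 2 * heat₂ ε F x r s) (a := fun r s => heat₀ ε F x r s)
    (F := fun s => F x s)
    (continuousOn_const.mul (hs2.cont.comp (f := fun p : ℝ × ℝ => (x, p.1, p.2)) (by fun_prop)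
      fun p hp => ⟨mem_univ _, hsub hp.1, hsub hp.2⟩))
    (fun r hr s hs => by
      rw [abs_mul, abs_of_pos (by positivity : 0 < ε / 2), mul_assoc]
      exact mul_le_mul_of_nonneg_left (hs2.bound x r (hsub hr) s (hsub hs)) (by positivity))
    (fun r hr s hs => hasDerivAt_avg_gauss₀_time hε (continuous_slice hF.cont (hsub hs))
      (linGrowth_of_bounded fun z => hF.bound z s (hsub hs)) x hr.1)
    (fun s hs => by
      have h1 := (isRapid_gauss₀.continuous_avg (continuous_slice hF.cont (hsub hs))
        (linGrowth_of_bounded fun z => hF.bound z s (hsub hs)))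
      have h2 : Continuous fun r => heat₀ ε F x r s :=
        h1.comp (f := fun r => (x, √(ε * r))) (by fun_prop)
      have h3 := h2.tendsto 0
      have h4 : heat₀ ε F x 0 s = F x s := by
        simp only [heat₀, avg, mul_zero, Real.sqrt_zero, zero_mul, add_zero]
        rw [integral_const_mul, integral_gauss₀, mul_one]
      rw [h4] at h3
      exact h3.mono_left nhdsWithin_le_nhds)
    (by
      refine (intervalIntegrable_const (c := C)).mono_fun' ?_ ?_
      · rw [uIoc_of_le ht.1.le]
        exact ((hF.cont.comp (f := fun s => (x, s)) (by fun_prop)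
          fun s hs => ⟨mem_univ _, hsub hs⟩).aestronglyMeasurable measurableSet_Ioc)
      · rw [uIoc_of_le ht.1.le]
        filter_upwards [ae_restrict_mem measurableSet_Ioc] with s hs
        exact hF.bound x s (hsub hs))
  simp only [intervalIntegral.integral_const_mul] at this
  exact this

end

/-- Banach's fixed point theorem for maps contracting the supremum distance on `ℝ × (0, T]`. -/
theorem exists_fixed_of_contraction {T M : ℝ} {P : (ℝ → ℝ → ℝ) → Prop}
    {Φ : (ℝ → ℝ → ℝ) → ℝ → ℝ → ℝ} {q₀ : ℝ → ℝ → ℝ} (h₀ : P q₀) (hP : ∀ q, P q → P (Φ q))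
    (hM : ∀ q, P q → ∀ x, ∀ t ∈ Ioc 0 T, |q x t| ≤ M)
    (hΦ : ∀ q q' δ, P q → P q' → (∀ x, ∀ t ∈ Ioc 0 T, |q x t - q' x t| ≤ δ) →
      ∀ x, ∀ t ∈ Ioc 0 T, |Φ q x t - Φ q' x t| ≤ δ / 2)
    (hlim : ∀ (u : ℕ → ℝ → ℝ → ℝ) (q : ℝ → ℝ → ℝ) (A : ℝ), (∀ n, P (u n)) →
      (∀ n x, ∀ t ∈ Ioc 0 T, |u n x t - q x t| ≤ A / 2 ^ n) → P q) :
    ∃ q, P q ∧ ∀ x, ∀ t ∈ Ioc 0 T, q x t = Φ q x t := by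
  set u : ℕ → ℝ → ℝ → ℝ := fun n => Φ^[n] q₀ with hu
  have hus : ∀ n, u (n + 1) = Φ (u n) := fun n => Function.iterate_succ_apply' Φ n q₀
  have huP : ∀ n, P (u n) := by
    intro n
    induction n with
    | zero => exact h₀
    | succ n ih => rw [hus]; exact hP _ ih
  -- The first two iterates are at distance at most 2M; the form 4M/2/2^n is the one expected by the
  -- geometric Cauchy criterion.
  have hdist : ∀ n, ∀ x, ∀ t ∈ Ioc 0 T, |u n x t - u (n + 1) x t| ≤ 4 * M / 2 / 2 ^ n := by
    intro n
    induction n with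
    | zero =>
      intro x t ht
      have h1 := hM _ (huP 0) x t ht
      have h2 := hM _ (huP 1) x t ht
      have h3 := abs_sub (u 0 x t) (u 1 x t)
      simp only [zero_add, pow_zero, div_one]
      linarith
    | succ n ih =>
      intro x t ht
      have := hΦ _ _ _ (huP n) (huP (n + 1)) ih x t ht
      rw [← hus, ← hus] at this
      refine this.trans (le_of_eq ?_)
      rw [pow_succ]; field_simp
  -- Outside (0, T] the requirement is vacuous; those values play no role.
  have hconv : ∀ x t, ∃ a, t ∈ Ioc 0 T → Tendsto (fun n => u n x t) atTop (𝓝 a) := by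
    intro x t
    by_cases ht : t ∈ Ioc 0 T
    · obtain ⟨a, ha⟩ := cauchySeq_tendsto_of_complete
        (cauchySeq_of_le_geometric_two (C := 4 * M) (f := fun n => u n x t)
          fun n => hdist n x t ht)
      exact ⟨a, fun _ => ha⟩
    · exact ⟨0, fun h => absurd h ht⟩
  choose q hq using hconv
  have happrox : ∀ n x, ∀ t ∈ Ioc 0 T, |u n x t - q x t| ≤ 4 * M / 2 ^ n := fun n x t ht =>
    dist_le_of_le_geometric_two_of_tendsto (f := fun n => u n x t)
      (fun n => hdist n x t ht) (hq x t ht) n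
  have hPq := hlim u q (4 * M) huP happrox
  refine ⟨q, hPq, fun x t ht => ?_⟩
  have h1 : Tendsto (fun n => u (n + 1) x t) atTop (𝓝 (q x t)) :=
    (hq x t ht).comp (tendsto_add_atTop_nat 1)
  have h2 : Tendsto (fun n => u (n + 1) x t) atTop (𝓝 (Φ q x t)) := by
    rw [tendsto_iff_dist_tendsto_zero]
    have h3 : Tendsto (fun n : ℕ => 4 * M / 2 ^ n / 2) atTop (𝓝 0) := by
      have h4 : Tendsto (fun n : ℕ => 4 * M / 2 * (1 / 2) ^ n) atTop (𝓝 (4 * M / 2 * 0)) :=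
        (tendsto_pow_atTop_nhds_zero_of_lt_one (by norm_num) (by norm_num)).const_mul _
      rw [mul_zero] at h4
      refine h4.congr fun n => ?_
      rw [one_div_pow]; ring
    refine squeeze_zero (fun _ => dist_nonneg) (fun n => ?_) h3
    rw [hus, Real.dist_eq]
    exact hΦ _ _ _ (huP n) hPq (happrox n) x t ht
  exact tendsto_nhds_unique h1 h2

/-- The class is closed under uniform limits, Lipschitz bound included, so contraction in the
supremum distance alone suffices. -/
theorem IsSource.of_approx {T C K A : ℝ} {u : ℕ → ℝ → ℝ → ℝ} {q : ℝ → ℝ → ℝ}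
    (hu : ∀ n, IsSource T C K (u n))
    (h : ∀ n x, ∀ t ∈ Ioc 0 T, |u n x t - q x t| ≤ A / 2 ^ n) : IsSource T C K q := by
  have h0 : Tendsto (fun n : ℕ => A / 2 ^ n) atTop (𝓝 0) := by
    have h4 : Tendsto (fun n : ℕ => A * (1 / 2) ^ n) atTop (𝓝 (A * 0)) :=
      (tendsto_pow_atTop_nhds_zero_of_lt_one (by norm_num) (by norm_num)).const_mul _
    rw [mul_zero] at h4
    refine h4.congr fun n => ?_
    rw [one_div_pow]; ring
  have hlim : ∀ x, ∀ t ∈ Ioc 0 T, Tendsto (fun n => u n x t) atTop (𝓝 (q x t)) := by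
    intro x t ht
    rw [tendsto_iff_dist_tendsto_zero]
    exact squeeze_zero (fun _ => dist_nonneg) (fun n => h n x t ht) h0
  refine ⟨?_, fun x t ht => ?_, fun x x' t ht => ?_⟩
  · have : TendstoUniformlyOn (fun n (p : ℝ × ℝ) => u n p.1 p.2) (fun p => q p.1 p.2) atTop
        (univ ×ˢ Ioc 0 T) := by
      rw [Metric.tendstoUniformlyOn_iff]
      intro δ hδ
      filter_upwards [h0.eventually (gt_mem_nhds hδ)] with n hn p hp
      rw [dist_comm]
      exact (h n p.1 p.2 hp.2).trans_lt hn
    exact this.continuousOn (Eventually.of_forall fun n => (hu n).cont).frequently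
  · exact le_of_tendsto (hlim x t ht).abs (Eventually.of_forall fun n => (hu n).bound x t ht)
  · exact le_of_tendsto ((hlim x t ht).sub (hlim x' t ht)).abs
      (Eventually.of_forall fun n => (hu n).lip x x' t ht)

end ViscousHJ

/-! ### Picard iteration for the space derivative -/

namespace ViscousHJ

open Filter Topology MeasureTheory

theorem abs_sub_le_of_hasDerivAt {φ φ' : ℝ → ℝ} {C : ℝ} (h : ∀ x, HasDerivAt φ (φ' x) x)
    (hb : ∀ x, |φ' x| ≤ C) (x y : ℝ) : |φ x - φ y| ≤ C * |x - y| :=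
  convex_univ.norm_image_sub_le_of_norm_hasDerivWithin_le
    (fun z _ => (h z).hasDerivWithinAt) (fun z _ => hb z) (mem_univ y) (mem_univ x)

/-- Coefficients of the equation for the space derivative, with a common bound and Lipschitz
constant `D`. -/
structure IsCoeff (D : ℝ) (g : ℝ → ℝ) (b S : ℝ → ℝ → ℝ) : Prop where
  nonneg : 0 ≤ D
  cont_g : Continuous g
  bound_g : ∀ x, |g x| ≤ D
  lip_g : ∀ x x', |g x - g x'| ≤ D * |x - x'|
  cont_b : ContinuousOn (fun p : ℝ × ℝ => b p.1 p.2) (univ ×ˢ Ici 0)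
  bound_b : ∀ x, ∀ t ∈ Ici (0 : ℝ), |b x t| ≤ D
  lip_b : ∀ x x', ∀ t ∈ Ici (0 : ℝ), |b x t - b x' t| ≤ D * |x - x'|
  cont_S : ContinuousOn (fun p : ℝ × ℝ => S p.1 p.2) (univ ×ˢ Ici 0)
  bound_S : ∀ x, ∀ t ∈ Ici (0 : ℝ), |S x t| ≤ D
  lip_S : ∀ x x', ∀ t ∈ Ici (0 : ℝ), |S x t - S x' t| ≤ D * |x - x'|

/-- The quadratic source. -/
noncomputable def source (g : ℝ → ℝ) (S q : ℝ → ℝ → ℝ) (x t : ℝ) : ℝ :=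
  -(1 / 2) * q x t ^ 2 - g x * q x t + S x t

/-- The space derivative of the heat evolution of the initial value. -/
noncomputable def init₁ (ε : ℝ) (u₀ : ℝ → ℝ) (x t : ℝ) : ℝ :=
  avg gauss₁ u₀ x √(ε * t) / √(ε * t)

/-- The Picard map for the space derivative. -/
noncomputable def picard (ε : ℝ) (u₀ g : ℝ → ℝ) (b S q : ℝ → ℝ → ℝ) (x t : ℝ) : ℝ :=
  b x t + init₁ ε u₀ x t + duhamel (heat₁ ε (source g S q)) x t

section
variable {ε T D M N : ℝ} {u₀ g : ℝ → ℝ} {b S q q' : ℝ → ℝ → ℝ}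

theorem hasDerivAt_init₁ (hε : 0 < ε) (hc : Continuous u₀) (hg : LinGrowth u₀) (x : ℝ) {t : ℝ}
    (ht : 0 < t) : HasDerivAt (fun x => init₁ ε u₀ x t) (avg gauss₂ u₀ x √(ε * t) / (ε * t)) x := by
  have := (hasDerivAt_avg_gauss₁ hc hg (Real.sqrt_pos.2 (mul_pos hε ht)) x).div_const √(ε * t)
  rwa [div_sqrt_div_sqrt hε ht] at this

/-- Both Hermite weights have mean zero, so a Lipschitz datum controls the first derivative
uniformly and the second by a multiple of 1/√t. This fixes the blow-up rate built into `IsSource`.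
-/
theorem isSource_init₁ (hε : 0 < ε) (hc : Continuous u₀)
    (hl : ∀ x y, |u₀ x - u₀ y| ≤ D * |x - y|) :
    IsSource T (D * ∫ ξ, |ξ| * |gauss₁ ξ|) (D * (∫ ξ, |ξ| * |gauss₂ ξ|) * (√ε)⁻¹)
      (init₁ ε u₀) where
  cont := by
    refine (((isRapid_gauss₁.continuous_avg hc (linGrowth_of_lipschitz hl)).comp
      (f := fun p : ℝ × ℝ => (p.1, √(ε * p.2))) (by fun_prop)).continuousOn).div (by fun_prop)
      fun p hp => ?_
    exact (Real.sqrt_pos.2 (mul_pos hε hp.2.1)).ne'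
  bound x t ht := by
    have h0 := Real.sqrt_pos.2 (mul_pos hε ht.1)
    have h1 := abs_avg_sub_le_of_lipschitz isRapid_gauss₁ hc hl x h0.le
    rw [integral_gauss₁, mul_zero, sub_zero] at h1
    rw [init₁, abs_div, abs_of_pos h0, div_le_iff₀ h0]
    linarith
  lip x x' t ht := by
    refine abs_sub_le_of_hasDerivAt
      (fun x => hasDerivAt_init₁ hε hc (linGrowth_of_lipschitz hl) x ht.1) (fun x => ?_) x x'
    have h1 := abs_avg_sub_le_of_lipschitz isRapid_gauss₂ hc hl x (Real.sqrt_nonneg (ε * t))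
    rw [integral_gauss₂, mul_zero, sub_zero] at h1
    have h2 := mul_pos hε ht.1
    rw [abs_div, abs_of_pos h2]
    refine (div_le_div_of_nonneg_right h1 h2.le).trans (le_of_eq ?_)
    rw [mul_assoc, div_mul_eq_inv_sqrt hε ht.1]
    ring

theorem one_le_inv_sqrt {t : ℝ} (hT1 : T ≤ 1) (ht : t ∈ Ioc 0 T) : 1 ≤ (√t)⁻¹ := by
  refine (one_le_inv₀ (Real.sqrt_pos.2 ht.1)).2 ?_
  exact Real.sqrt_le_iff.2 ⟨zero_le_one, by simpa using ht.2.trans hT1⟩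

theorem continuousOn_source (h : IsCoeff D g b S)
    (hq : ContinuousOn (fun p : ℝ × ℝ => q p.1 p.2) (univ ×ˢ Ioc 0 T)) :
    ContinuousOn (fun p : ℝ × ℝ => source g S q p.1 p.2) (univ ×ˢ Ioc 0 T) := by
  have h1 := h.cont_S.mono (prod_mono (le_refl (univ : Set ℝ))
    (show Ioc 0 T ⊆ Ici 0 from fun t ht => ht.1.le))
  have h2 := h.cont_g
  unfold source
  fun_prop

/-- The source is quadratic in q, but on functions bounded by M it is Lipschitz in q; Lipschitz
constants without singularity are absorbed by 1 ≤ 1/√t, from T ≤ 1. -/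
theorem isSource_source (h : IsCoeff D g b S) (hM : 0 ≤ M) (hT1 : T ≤ 1)
    (hq : IsSource T M N q) :
    IsSource T (1 / 2 * M ^ 2 + D * M + D) ((M + D) * N + M * D + D) (source g S q) where
  cont := continuousOn_source h hq.cont
  bound x t ht := by
    have h1 := hq.bound x t ht
    have h2 : |-(1 / 2) * q x t ^ 2| ≤ 1 / 2 * M ^ 2 := by
      rw [abs_mul, abs_pow, abs_neg, abs_of_pos (by norm_num : (0 : ℝ) < 1 / 2)]
      gcongr
    have h3 : |g x * q x t| ≤ D * M := by
      rw [abs_mul]; exact mul_le_mul (h.bound_g x) h1 (abs_nonneg _) h.nonneg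
    exact (abs_add_le _ _).trans (add_le_add ((abs_sub _ _).trans (add_le_add h2 h3))
      (h.bound_S x t ht.1.le))
  lip x x' t ht := by
    have hD := h.nonneg
    have h1 := hq.bound x t ht
    have h1' := hq.bound x' t ht
    have h2 := hq.lip x x' t ht
    have h5 := one_le_inv_sqrt hT1 ht
    have e : source g S q x t - source g S q x' t
        = -((q x t + q x' t) / 2 + g x) * (q x t - q x' t) - q x' t * (g x - g x')
          + (S x t - S x' t) := by
      simp only [source]; ring
    have a1 : |-((q x t + q x' t) / 2 + g x)| ≤ M + D := by
      rw [abs_neg]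
      refine (abs_add_le _ _).trans (add_le_add ?_ (h.bound_g x))
      rw [abs_div, abs_two]
      linarith [abs_add_le (q x t) (q x' t)]
    have a2 : |-((q x t + q x' t) / 2 + g x) * (q x t - q x' t)|
        ≤ (M + D) * (N * (√t)⁻¹ * |x - x'|) := by
      rw [abs_mul]; exact mul_le_mul a1 h2 (abs_nonneg _) (by positivity)
    have a3 : |q x' t * (g x - g x')| ≤ M * (D * |x - x'|) := by
      rw [abs_mul]; exact mul_le_mul h1' (h.lip_g x x') (abs_nonneg _) hM
    have a4 := h.lip_S x x' t ht.1.le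
    rw [e]
    refine (abs_add_le _ _).trans ((add_le_add ((abs_sub _ _).trans
      (add_le_add a2 a3)) a4).trans ?_)
    have h6 := mul_le_mul_of_nonneg_left h5 (by positivity : 0 ≤ (M * D + D) * |x - x'|)
    linarith

theorem abs_source_sub_le (h : IsCoeff D g b S) (hq : IsSource T M N q)
    (hq' : IsSource T M N q') {δ : ℝ} (hM : 0 ≤ M)
    (hδ : ∀ x, ∀ t ∈ Ioc 0 T, |q x t - q' x t| ≤ δ) (x : ℝ) {t : ℝ} (ht : t ∈ Ioc 0 T) :
    |source g S q x t - source g S q' x t| ≤ (M + D) * δ := by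
  have hD := h.nonneg
  have e : source g S q x t - source g S q' x t
      = -((q x t + q' x t) / 2 + g x) * (q x t - q' x t) := by
    simp only [source]; ring
  rw [e, abs_mul, abs_neg]
  refine mul_le_mul ?_ (hδ x t ht) (abs_nonneg _) (by positivity)
  refine (abs_add_le _ _).trans (add_le_add ?_ (h.bound_g x))
  rw [abs_div, abs_two]
  linarith [abs_add_le (q x t) (q' x t), hq.bound x t ht, hq'.bound x t ht]

theorem isSource_coeff (h : IsCoeff D g b S) (hT1 : T ≤ 1) : IsSource T D D b where
  cont := h.cont_b.mono (prod_mono (le_refl (univ : Set ℝ))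
    (show Ioc 0 T ⊆ Ici 0 from fun t ht => ht.1.le))
  bound x t ht := h.bound_b x t ht.1.le
  lip x x' t ht := by
    have h5 := one_le_inv_sqrt hT1 ht
    have hD := h.nonneg
    have h6 := mul_le_mul_of_nonneg_left h5 (by positivity : 0 ≤ D * |x - x'|)
    linarith [h.lip_b x x' t ht.1.le]

theorem IsSource.add {C C' K K' : ℝ} {F F' : ℝ → ℝ → ℝ} (h : IsSource T C K F)
    (h' : IsSource T C' K' F') : IsSource T (C + C') (K + K') fun x t => F x t + F' x t where
  cont := h.cont.add h'.cont
  bound x t ht := (abs_add_le _ _).trans (add_le_add (h.bound x t ht) (h'.bound x t ht))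
  lip x x' t ht := by
    rw [add_sub_add_comm]
    refine (abs_add_le _ _).trans ((add_le_add (h.lip x x' t ht) (h'.lip x x' t ht)).trans ?_)
    linarith

/-- Both constants carry a factor √T, so for small T the nonlinear part hardly enlarges the bounds
coming from the data. -/
theorem isSource_duhamel_heat₁ (hε : 0 < ε) {C K : ℝ} (hC : 0 ≤ C) (hK : 0 ≤ K)
    {F : ℝ → ℝ → ℝ} (hF : IsSource T C K F) :
    IsSource T (C * (∫ ξ, |gauss₁ ξ|) * (√ε)⁻¹ * √T * 4)
      (K * (∫ ξ, |ξ| * |gauss₂ ξ|) * (√ε)⁻¹ * 4 * √T) (duhamel (heat₁ ε F)) where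
  cont := (isSingular_heat₁ hε hF.cont hF.bound hC).continuousOn_duhamel
  bound x t ht := by
    have hκ : 0 ≤ ∫ ξ, |gauss₁ ξ| := integral_nonneg fun _ => abs_nonneg _
    exact (isSingular_heat₁ hε hF.cont hF.bound hC).abs_duhamel_le (by positivity) ht x
  lip x x' t ht := by
    have hκ : 0 ≤ ∫ ξ, |ξ| * |gauss₂ ξ| := integral_nonneg fun _ => by positivity
    have h2 := isSingular_heat₂ hε hF
    have h3 := abs_sub_le_of_hasDerivAt (fun x =>
      (isSingular_heat₁ hε hF.cont hF.bound hC).hasDerivAt_duhamel h2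
        (fun x r hr s hs => hasDerivAt_heat₁ hε hF x hr.1 hs) ht x)
      (fun x => h2.abs_duhamel_le (by positivity) ht x) x x'
    have h4 := mul_le_mul_of_nonneg_left (one_le_mul_inv_sqrt ht)
      (by positivity : 0 ≤ K * (∫ ξ, |ξ| * |gauss₂ ξ|) * (√ε)⁻¹ * 4 * |x - x'|)
    linarith

theorem IsSource.mono {C C' K K' : ℝ} {F : ℝ → ℝ → ℝ} (h : IsSource T C K F) (hC : C ≤ C')
    (hK : K ≤ K') : IsSource T C' K' F where
  cont := h.cont
  bound x t ht := (h.bound x t ht).trans hC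
  lip x x' t ht := (h.lip x x' t ht).trans (by gcongr)

theorem heat₁_sub (hε : 0 < ε) {C : ℝ} {F F' : ℝ → ℝ → ℝ}
    (hF : ContinuousOn (fun p : ℝ × ℝ => F p.1 p.2) (univ ×ˢ Ioc 0 T))
    (hb : ∀ x, ∀ t ∈ Ioc 0 T, |F x t| ≤ C)
    (hF' : ContinuousOn (fun p : ℝ × ℝ => F' p.1 p.2) (univ ×ˢ Ioc 0 T))
    (hb' : ∀ x, ∀ t ∈ Ioc 0 T, |F' x t| ≤ C) (hC : 0 ≤ C) {t : ℝ} (ht : t ∈ Ioc 0 T) (x : ℝ) :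
    duhamel (heat₁ ε F) x t - duhamel (heat₁ ε F') x t
      = duhamel (heat₁ ε fun x t => F x t - F' x t) x t := by
  simp only [duhamel]
  rw [← intervalIntegral.integral_sub
    ((isSingular_heat₁ hε hF hb hC).intervalIntegrable ht x)
    ((isSingular_heat₁ hε hF' hb' hC).intervalIntegrable ht x)]
  refine intervalIntegral.integral_congr_ae ?_
  rw [uIoc_of_le ht.1.le]
  refine ae_of_all _ fun s hs => ?_
  have hs' : s ∈ Ioc 0 T := ⟨hs.1, hs.2.trans ht.2⟩
  simp only [heat₁]
  rw [← sub_div]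
  congr 1
  simp only [avg]
  rw [← integral_sub]
  · congr 1; funext ξ; ring
  · exact isRapid_gauss₁.integrable_avg (continuous_slice hF hs')
      (linGrowth_of_bounded fun z => hb z s hs') _ _
  · exact isRapid_gauss₁.integrable_avg (continuous_slice hF' hs')
      (linGrowth_of_bounded fun z => hb' z s hs') _ _

/-- Short-time solvability of the equation for the space derivative. -/
theorem exists_picard_fixed (hε : 0 < ε) (h : IsCoeff D g b S) (hc : Continuous u₀)
    (hl : ∀ x y, |u₀ x - u₀ y| ≤ D * |x - y|) :
    ∃ Z M N, 0 ≤ Z ∧ 0 ≤ M ∧ 0 ≤ N ∧ ∀ T, 0 < T → T ≤ 1 → √T * Z ≤ 1 →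
      ∃ q, IsSource T M N q ∧ ∀ x, ∀ t ∈ Ioc 0 T, q x t = picard ε u₀ g b S q x t := by
  obtain ⟨κ, hκ⟩ : ∃ κ, κ = ∫ ξ, |gauss₁ ξ| := ⟨_, rfl⟩
  obtain ⟨κ', hκ'⟩ : ∃ κ, κ = ∫ ξ, |ξ| * |gauss₁ ξ| := ⟨_, rfl⟩
  obtain ⟨κ₂, hκ₂⟩ : ∃ κ, κ = ∫ ξ, |ξ| * |gauss₂ ξ| := ⟨_, rfl⟩
  have hκ0 : 0 ≤ κ := hκ ▸ integral_nonneg fun _ => abs_nonneg _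
  have hκ'0 : 0 ≤ κ' := hκ' ▸ integral_nonneg fun _ => by positivity
  have hκ₂0 : 0 ≤ κ₂ := hκ₂ ▸ integral_nonneg fun _ => by positivity
  have hD := h.nonneg
  -- M and N are the bounds of the data terms plus 1; the summand 1 is room for the Duhamel term,
  -- and neither depends on T.
  obtain ⟨M, hM⟩ : ∃ M, M = D + D * κ' + 1 := ⟨_, rfl⟩
  obtain ⟨N, hN⟩ : ∃ N, N = D + D * κ₂ * (√ε)⁻¹ + 1 := ⟨_, rfl⟩
  have hM0 : 0 ≤ M := by rw [hM]; positivity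
  have hN0 : 0 ≤ N := by rw [hN]; positivity
  obtain ⟨CF, hCF⟩ : ∃ C, C = 1 / 2 * M ^ 2 + D * M + D := ⟨_, rfl⟩
  obtain ⟨KF, hKF⟩ : ∃ C, C = (M + D) * N + M * D + D := ⟨_, rfl⟩
  have hCF0 : 0 ≤ CF := by rw [hCF]; positivity
  have hKF0 : 0 ≤ KF := by rw [hKF]; positivity
  obtain ⟨z₁, hz₁⟩ : ∃ z, z = CF * κ * (√ε)⁻¹ * 4 := ⟨_, rfl⟩
  obtain ⟨z₂, hz₂⟩ : ∃ z, z = KF * κ₂ * (√ε)⁻¹ * 4 := ⟨_, rfl⟩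
  -- The constant 8 is the 4 from the singular integral times 2, giving contraction by the factor
  -- 1/2.
  obtain ⟨z₃, hz₃⟩ : ∃ z, z = (M + D) * κ * (√ε)⁻¹ * 8 := ⟨_, rfl⟩
  have hz₁0 : 0 ≤ z₁ := by rw [hz₁]; positivity
  have hz₂0 : 0 ≤ z₂ := by rw [hz₂]; positivity
  have hz₃0 : 0 ≤ z₃ := by rw [hz₃]; positivity
  refine ⟨z₁ + z₂ + z₃, M, N, by positivity, hM0, hN0, fun T hT hT1 hTZ => ?_⟩
  have hsT := Real.sqrt_nonneg T
  have hT₁ : √T * z₁ ≤ 1 := le_trans (mul_le_mul_of_nonneg_left (by linarith) hsT) hTZ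
  have hT₂ : √T * z₂ ≤ 1 := le_trans (mul_le_mul_of_nonneg_left (by linarith) hsT) hTZ
  have hT₃ : √T * z₃ ≤ 1 := le_trans (mul_le_mul_of_nonneg_left (by linarith) hsT) hTZ
  refine exists_fixed_of_contraction (M := M) (P := IsSource T M N) (Φ := picard ε u₀ g b S)
    (q₀ := fun _ _ => 0) ?_ ?_ (fun q hq => hq.bound) ?_ ?_
  · refine ⟨continuousOn_const, fun _ _ _ => by simpa using hM0, fun x x' t _ => ?_⟩
    simp only [sub_self, abs_zero]
    positivity
  · intro q hq
    have hs := isSource_source h hM0 hT1 hq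
    rw [← hCF, ← hKF] at hs
    have h1 := ((isSource_coeff h hT1).add (isSource_init₁ hε hc hl)).add
      (isSource_duhamel_heat₁ hε hCF0 hKF0 hs)
    rw [← hκ, ← hκ', ← hκ₂] at h1
    refine h1.mono ?_ ?_
    · rw [hM]
      have : CF * κ * (√ε)⁻¹ * √T * 4 = √T * z₁ := by rw [hz₁]; ring
      linarith
    · rw [hN]
      have : KF * κ₂ * (√ε)⁻¹ * 4 * √T = √T * z₂ := by rw [hz₂]; ring
      linarith
  · intro q q' δ hq hq' hδ x t ht
    have hs := isSource_source h hM0 hT1 hq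
    have hs' := isSource_source h hM0 hT1 hq'
    rw [← hCF, ← hKF] at hs hs'
    have hδ0 : 0 ≤ δ := (abs_nonneg _).trans (hδ x t ht)
    have e : picard ε u₀ g b S q x t - picard ε u₀ g b S q' x t
        = duhamel (heat₁ ε fun x t => source g S q x t - source g S q' x t) x t := by
      rw [← heat₁_sub hε hs.cont hs.bound hs'.cont hs'.bound hCF0 ht x]
      simp only [picard]; ring
    rw [e]
    have h1 := (isSingular_heat₁ hε (hs.cont.sub hs'.cont)
      (fun x t ht => abs_source_sub_le h hq hq' hM0 hδ x ht)
      (by positivity)).abs_duhamel_le (by rw [← hκ]; positivity) ht x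
    rw [← hκ] at h1
    refine h1.trans ?_
    have h2 := mul_le_mul_of_nonneg_right hT₃ (by positivity : 0 ≤ δ / 2)
    rw [hz₃] at h2
    linarith
  · intro u q A hu hA
    exact IsSource.of_approx hu hA

end
end ViscousHJ

/-! ### From the fixed point to a classical solution -/

namespace ViscousHJ

open Filter Topology MeasureTheory

section
variable {ε T D : ℝ} {u₀ g : ℝ → ℝ} {b S : ℝ → ℝ → ℝ}

/-- The time integral representation has an integrand continuous on (0, T], so the fundamental
theorem of calculus applies. -/
theorem hasDerivWithinAt_duhamel_heat₀ (hε : 0 < ε) {C K : ℝ} {F : ℝ → ℝ → ℝ}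
    (hF : IsSource T C K F) (hK : 0 ≤ K) (x : ℝ) {t : ℝ} (ht : t ∈ Ioc 0 T) :
    HasDerivWithinAt (fun t => duhamel (heat₀ ε F) x t)
      (F x t + ε / 2 * duhamel (heat₂ ε F) x t) (Icc 0 T) t := by
  have hcont : ContinuousOn (fun t => F x t + ε / 2 * duhamel (heat₂ ε F) x t) (Ioc 0 T) := by
    have h1 := hF.cont.comp (f := fun s => (x, s)) (s := Ioc 0 T) (by fun_prop)
      fun s hs => ⟨mem_univ _, hs⟩
    have h2 := (isSingular_heat₂ hε hF).continuousOn_duhamel.comp (f := fun s => (x, s))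
      (s := Ioc 0 T) (by fun_prop) fun s hs => ⟨mem_univ _, hs⟩
    exact h1.add (continuousOn_const.mul h2)
  have hnhds : Ioc 0 T ∈ 𝓝[Icc 0 T] t :=
    mem_nhdsWithin.2 ⟨Ioi 0, isOpen_Ioi, ht.1, fun s hs => ⟨hs.1, hs.2.2⟩⟩
  -- This selects the version of the fundamental theorem relative to [0, T], one-sided at t = T.
  have : Fact (t ∈ Icc 0 T) := ⟨Ioc_subset_Icc_self ht⟩
  have h := intervalIntegral.integral_hasDerivWithinAt_right (s := Icc 0 T) (t := Icc 0 T)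
    (hF.duhamel_eq hε hK x ht).1
    ⟨Ioc 0 T, hnhds, hcont.aestronglyMeasurable measurableSet_Ioc⟩
    ((hcont t ht).mono_of_mem_nhdsWithin hnhds)
  refine h.congr_of_mem (fun s hs => ?_) (Ioc_subset_Icc_self ht)
  rcases eq_or_lt_of_le hs.1 with rfl | hs0
  · simp [duhamel]
  · exact (hF.duhamel_eq hε hK x ⟨hs0, hs.2⟩).2

theorem IsSource.abs_duhamel_heat₀_le {C K : ℝ} {F : ℝ → ℝ → ℝ} (hF : IsSource T C K F) (x : ℝ)
    {t : ℝ} (ht : t ∈ Icc 0 T) :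
    |duhamel (heat₀ ε F) x t| ≤ C * (∫ ξ, |gauss₀ ξ|) * t := by
  have h1 := intervalIntegral.norm_integral_le_of_norm_le_const (a := 0) (b := t)
    (f := fun s => heat₀ ε F x (t - s) s) (C := C * (∫ ξ, |gauss₀ ξ|)) fun s hs => by
      rw [uIoc_of_le ht.1] at hs
      exact abs_avg_le_of_bounded isRapid_gauss₀
        (fun z => hF.bound z s ⟨hs.1, hs.2.trans ht.2⟩) _ _
  rwa [sub_zero, abs_of_nonneg ht.1] at h1

/-- The singular-kernel theory covers t > 0; at t = 0 the linear bound in t, uniform in x, gives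
continuity. -/
theorem IsSource.continuousOn_duhamel_heat₀ {C K : ℝ} {F : ℝ → ℝ → ℝ} (hF : IsSource T C K F)
    (hC : 0 ≤ C) :
    ContinuousOn (fun p : ℝ × ℝ => duhamel (heat₀ ε F) p.1 p.2) (univ ×ˢ Icc 0 T) := by
  have hpos := (isSingular_heat₀ (ε := ε) hF.cont hF.bound hC).continuousOn_duhamel
  rintro ⟨x, t⟩ hp
  rcases eq_or_lt_of_le hp.2.1 with h0 | h0
  · have h0' : t = 0 := h0.symm
    subst h0'
    have hz : duhamel (heat₀ ε F) x 0 = 0 := by simp [duhamel]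
    rw [ContinuousWithinAt]
    simp only [hz]
    have hlim : Tendsto (fun p : ℝ × ℝ => C * (∫ ξ, |gauss₀ ξ|) * p.2)
        (𝓝[univ ×ˢ Icc 0 T] (x, 0)) (𝓝 0) := by
      have h1 : Continuous fun p : ℝ × ℝ => C * (∫ ξ, |gauss₀ ξ|) * p.2 := by fun_prop
      have h2 := h1.tendsto (x, 0)
      simp only [mul_zero] at h2
      exact h2.mono_left nhdsWithin_le_nhds
    refine squeeze_zero_norm' ?_ hlim
    filter_upwards [self_mem_nhdsWithin] with p hp
    exact hF.abs_duhamel_heat₀_le p.1 hp.2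
  · refine (hpos (x, t) ⟨mem_univ _, h0, hp.2.2⟩).mono_of_mem_nhdsWithin ?_
    exact mem_nhdsWithin.2 ⟨univ ×ˢ Ioi 0, isOpen_univ.prod isOpen_Ioi, ⟨mem_univ _, h0⟩,
      fun p hp => ⟨mem_univ _, hp.1.2, hp.2.2.2⟩⟩

/-- Short-time existence of a classical solution. -/
theorem exists_hasC21 (hε : 0 < ε) (h : IsCoeff D g b S) (hc : Continuous u₀)
    (hl : ∀ x y, |u₀ x - u₀ y| ≤ D * |x - y|) :
    ∃ Z, 0 ≤ Z ∧ ∀ T, 0 < T → T ≤ 1 → √T * Z ≤ 1 →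
      ∃ u ut ux uxx, ∃ K, HasC21 T u ut ux uxx ∧ (∀ x, u x 0 = u₀ x) ∧
        (∀ x, ∀ t ∈ Ioc 0 T, ut x t = ε / 2 * uxx x t - 1 / 2 * (ux x t + b x t) ^ 2
          - g x * (ux x t + b x t) + S x t) ∧
        (∀ x, ∀ t ∈ Icc 0 T, |u x t - u₀ x| ≤ K) ∧
        ∀ x, ∀ t ∈ Ioc 0 T, |ux x t + b x t| ≤ K := by
  obtain ⟨Z, M, N, hZ, hM, hN, hfix⟩ := exists_picard_fixed hε h hc hl
  refine ⟨Z, hZ, fun T hT hT1 hTZ => ?_⟩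
  obtain ⟨q, hq, hqfix⟩ := hfix T hT hT1 hTZ
  have hD := h.nonneg
  have hgrow := linGrowth_of_lipschitz hl
  obtain ⟨F, hFdef⟩ : ∃ F, F = source g S q := ⟨_, rfl⟩
  obtain ⟨CF, hCF⟩ : ∃ C, C = 1 / 2 * M ^ 2 + D * M + D := ⟨_, rfl⟩
  obtain ⟨KF, hKF⟩ : ∃ C, C = (M + D) * N + M * D + D := ⟨_, rfl⟩
  have hCF0 : 0 ≤ CF := by rw [hCF]; positivity
  have hKF0 : 0 ≤ KF := by rw [hKF]; positivity
  have hF : IsSource T CF KF F := by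
    rw [hFdef, hCF, hKF]; exact isSource_source h hM hT1 hq
  have hs0 := isSingular_heat₀ (ε := ε) hF.cont hF.bound hCF0
  have hs1 := isSingular_heat₁ hε hF.cont hF.bound hCF0
  have hs2 := isSingular_heat₂ hε hF
  have hb := isSource_coeff h hT1
  -- The fixed point equation says that q - b is the space derivative of the function u built below
  -- from the source of q, which closes the nonlinear equation.
  have hux : ∀ x, ∀ t ∈ Ioc 0 T, q x t - b x t
      = init₁ ε u₀ x t + duhamel (heat₁ ε F) x t := fun x t ht => by
    rw [hqfix x t ht, picard, ← hFdef]; ring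
  have hcr : ContinuousOn (fun p : ℝ × ℝ => avg gauss₂ u₀ p.1 √(ε * p.2) / (ε * p.2)
      + duhamel (heat₂ ε F) p.1 p.2) (univ ×ˢ Ioc 0 T) := by
    refine ContinuousOn.add (ContinuousOn.div ?_ (by fun_prop) fun p hp =>
      (mul_pos hε hp.2.1).ne') hs2.continuousOn_duhamel
    exact ((isRapid_gauss₂.continuous_avg hc hgrow).comp
      (f := fun p : ℝ × ℝ => (p.1, √(ε * p.2))) (by fun_prop)).continuousOn
  refine ⟨fun x t => avg gauss₀ u₀ x √(ε * t) + duhamel (heat₀ ε F) x t,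
    fun x t => ε / 2 * (avg gauss₂ u₀ x √(ε * t) / (ε * t))
      + (F x t + ε / 2 * duhamel (heat₂ ε F) x t),
    fun x t => q x t - b x t,
    fun x t => avg gauss₂ u₀ x √(ε * t) / (ε * t) + duhamel (heat₂ ε F) x t,
    √ε * D * (∫ ξ, |ξ| * |gauss₀ ξ|) + CF * (∫ ξ, |gauss₀ ξ|) + M, ?_, ?_, ?_, ?_, ?_⟩
  · refine ⟨?_, ?_, ?_, ?_, ?_, hq.cont.sub hb.cont, hcr⟩
    · refine ContinuousOn.add ?_ (hF.continuousOn_duhamel_heat₀ hCF0)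
      exact ((isRapid_gauss₀.continuous_avg hc hgrow).comp
        (f := fun p : ℝ × ℝ => (p.1, √(ε * p.2))) (by fun_prop)).continuousOn
    · intro x t ht
      exact (hasDerivAt_avg_gauss₀_time hε hc hgrow x ht.1).hasDerivWithinAt.fun_add
        (hasDerivWithinAt_duhamel_heat₀ hε hF hKF0 x ht)
    · intro x t ht
      simp only [hux x t ht]
      exact (hasDerivAt_avg_gauss₀ hc hgrow (Real.sqrt_pos.2 (mul_pos hε ht.1)) x).fun_add
        (hs0.hasDerivAt_duhamel hs1 (fun x r hr s hs => hasDerivAt_heat₀ hε hF x hr.1 hs) ht x)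
    · intro x t ht
      have e : (fun z => q z t - b z t)
          = fun z => init₁ ε u₀ z t + duhamel (heat₁ ε F) z t := funext fun z => hux z t ht
      rw [e]
      exact (hasDerivAt_init₁ hε hc hgrow x ht.1).fun_add
        (hs1.hasDerivAt_duhamel hs2 (fun x r hr s hs => hasDerivAt_heat₁ hε hF x hr.1 hs) ht x)
    · have := (hF.cont.add ((continuousOn_const (c := ε / 2)).mul hcr))
      refine this.congr fun p _ => ?_
      simp only [Pi.add_apply, Pi.mul_apply]
      ring
  · intro x
    simp only [avg, duhamel, mul_zero, Real.sqrt_zero, zero_mul, add_zero,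
      intervalIntegral.integral_same]
    rw [integral_const_mul, integral_gauss₀, mul_one]
  · intro x t ht
    simp only [hFdef, source, sub_add_cancel]
    ring
  · intro x t ht
    have h1 := abs_avg_sub_le_of_lipschitz isRapid_gauss₀ hc hl x (Real.sqrt_nonneg (ε * t))
    rw [integral_gauss₀, mul_one] at h1
    have h2 := hF.abs_duhamel_heat₀_le (ε := ε) x ht
    have ht1 : t ≤ 1 := ht.2.trans hT1
    have h3 : √(ε * t) ≤ √ε := Real.sqrt_le_sqrt (by nlinarith)
    have hκ0 : 0 ≤ ∫ ξ, |gauss₀ ξ| := integral_nonneg fun _ => abs_nonneg _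
    have hκ1 : 0 ≤ ∫ ξ, |ξ| * |gauss₀ ξ| := integral_nonneg fun _ => by positivity
    have h4 := mul_le_mul_of_nonneg_right h3 (by positivity : 0 ≤ D * ∫ ξ, |ξ| * |gauss₀ ξ|)
    have h5 := mul_le_mul_of_nonneg_left ht1 (by positivity : 0 ≤ CF * ∫ ξ, |gauss₀ ξ|)
    rw [add_sub_right_comm]
    refine (abs_add_le _ _).trans ?_
    linarith
  · intro x t ht
    rw [sub_add_cancel]
    have hκ0 : 0 ≤ ∫ ξ, |gauss₀ ξ| := integral_nonneg fun _ => abs_nonneg _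
    have hκ1 : 0 ≤ ∫ ξ, |ξ| * |gauss₀ ξ| := integral_nonneg fun _ => by positivity
    have h1 : 0 ≤ √ε * D * (∫ ξ, |ξ| * |gauss₀ ξ|) + CF * (∫ ξ, |gauss₀ ξ|) := by positivity
    linarith [hq.bound x t ht]

end
end ViscousHJ

/-! ### The corrector and existence for the original equation -/

namespace ViscousHJ

open Filter Topology MeasureTheory

theorem HasC21.add {T : ℝ} {ψ ψt ψx ψxx χ χt χx χxx : ℝ → ℝ → ℝ} (h₁ : HasC21 T ψ ψt ψx ψxx)
    (h₂ : HasC21 T χ χt χx χxx) :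
    HasC21 T (fun x t => ψ x t + χ x t) (fun x t => ψt x t + χt x t)
      (fun x t => ψx x t + χx x t) (fun x t => ψxx x t + χxx x t) where
  cont := h₁.cont.add h₂.cont
  hasDeriv_t x t ht := (h₁.hasDeriv_t x t ht).add (h₂.hasDeriv_t x t ht)
  hasDeriv_x x t ht := (h₁.hasDeriv_x x t ht).add (h₂.hasDeriv_x x t ht)
  hasDeriv_xx x t ht := (h₁.hasDeriv_xx x t ht).add (h₂.hasDeriv_xx x t ht)
  cont_t := h₁.cont_t.add h₂.cont_t
  cont_x := h₁.cont_x.add h₂.cont_x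
  cont_xx := h₁.cont_xx.add h₂.cont_xx

theorem HasC21.isSmoothSolution {ε T : ℝ} {f h y w₀ : ℝ → ℝ} {w wt wx wxx : ℝ → ℝ → ℝ}
    (hw : HasC21 T w wt wx wxx) (h0 : ∀ x, w x 0 = w₀ x)
    (heq : ∀ x, ∀ t ∈ Ioc 0 T,
      wt x t + symHamiltonian ε f h y x t (wx x t) = ε / 2 * wxx x t) :
    IsSmoothSolution ε f h y w₀ T w := by
  have et : ∀ x, ∀ t ∈ Ioc 0 T, derivWithin (fun s => w x s) (Icc 0 T) t = wt x t :=
    fun x t ht => (hw.hasDeriv_t x t ht).derivWithin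
      (uniqueDiffOn_Icc (ht.1.trans_le ht.2) t (Ioc_subset_Icc_self ht))
  have ex : ∀ x, ∀ t ∈ Ioc 0 T, deriv (fun z => w z t) x = wx x t :=
    fun x t ht => (hw.hasDeriv_x x t ht).deriv
  have ex' : ∀ t ∈ Ioc 0 T, deriv (fun z => w z t) = fun x => wx x t :=
    fun t ht => funext fun x => ex x t ht
  have exx : ∀ x, ∀ t ∈ Ioc 0 T, iteratedDeriv 2 (fun z => w z t) x = wxx x t := by
    intro x t ht
    rw [iteratedDeriv_succ, iteratedDeriv_one, ex' t ht]
    exact (hw.hasDeriv_xx x t ht).deriv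
  refine ⟨hw.cont, fun t ht => ?_, fun x t ht => (hw.hasDeriv_t x t ht).differentiableWithinAt,
    hw.cont_t.congr fun p hp => et p.1 p.2 hp.2, hw.cont_x.congr fun p hp => ex p.1 p.2 hp.2,
    hw.cont_xx.congr fun p hp => exx p.1 p.2 hp.2, fun x t ht => ?_, h0⟩
  · have h1 : ContDiff ℝ 1 (fun x => wx x t) := by
      rw [contDiff_one_iff_deriv]
      refine ⟨fun x => (hw.hasDeriv_xx x t ht).differentiableAt, ?_⟩
      have e : deriv (fun x => wx x t) = fun x => wxx x t :=
        funext fun x => (hw.hasDeriv_xx x t ht).deriv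
      rw [e]
      exact continuousOn_univ.1 (continuousOn_slice_fst hw.cont_xx ht)
    refine (contDiff_succ_iff_deriv (n := 1)).2
      ⟨fun x => (hw.hasDeriv_x x t ht).differentiableAt, by simp, ?_⟩
    rw [ex' t ht]; exact h1
  · rw [et x t ht, ex x t ht, exx x t ht]
    exact heq x t ht

/-- The smoothed absolute value `√(1 + x²)` and its derivatives. -/
theorem hasDerivAt_sqrt_one_add_sq (x : ℝ) :
    HasDerivAt (fun x : ℝ => √(1 + x ^ 2)) (x * (√(1 + x ^ 2))⁻¹) x := by
  have h0 : (1 : ℝ) + x ^ 2 ≠ 0 := by positivity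
  refine (((hasDerivAt_pow 2 x).const_add 1).sqrt h0).congr_deriv ?_
  have : √(1 + x ^ 2) ≠ 0 := by positivity
  field_simp
  simp

theorem hasDerivAt_inv_sqrt_one_add_sq (x : ℝ) :
    HasDerivAt (fun x : ℝ => (√(1 + x ^ 2))⁻¹) (-(x * (√(1 + x ^ 2))⁻¹ ^ 3)) x := by
  have h0 : √(1 + x ^ 2) ≠ 0 := by positivity
  refine ((hasDerivAt_sqrt_one_add_sq x).fun_inv h0).congr_deriv ?_
  field_simp

theorem hasDerivAt_mul_inv_sqrt_one_add_sq (x : ℝ) :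
    HasDerivAt (fun x : ℝ => x * (√(1 + x ^ 2))⁻¹) ((√(1 + x ^ 2))⁻¹ ^ 3) x := by
  refine ((hasDerivAt_id x).fun_mul (hasDerivAt_inv_sqrt_one_add_sq x)).congr_deriv ?_
  have h0 : √(1 + x ^ 2) ≠ 0 := by positivity
  have h1 : √(1 + x ^ 2) ^ 2 = 1 + x ^ 2 := Real.sq_sqrt (by positivity)
  simp only [id]
  field_simp
  linarith

theorem inv_sqrt_one_add_sq_le_one (x : ℝ) : (√(1 + x ^ 2))⁻¹ ≤ 1 := by
  refine inv_le_one_of_one_le₀ ?_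
  rw [Real.one_le_sqrt]; nlinarith [sq_nonneg x]

theorem abs_mul_inv_sqrt_one_add_sq_le_one (x : ℝ) : |x * (√(1 + x ^ 2))⁻¹| ≤ 1 := by
  have h0 : 0 < √(1 + x ^ 2) := by positivity
  rw [abs_mul, abs_inv, abs_of_pos h0, ← div_eq_mul_inv, div_le_one h0]
  exact Real.abs_le_sqrt (by linarith)

theorem hasDerivAt_inv_sqrt_one_add_sq_pow (x : ℝ) :
    HasDerivAt (fun x : ℝ => (√(1 + x ^ 2))⁻¹ ^ 3)
      (-3 * ((x * (√(1 + x ^ 2))⁻¹) * (√(1 + x ^ 2))⁻¹ ^ 4)) x := by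
  refine ((hasDerivAt_inv_sqrt_one_add_sq x).fun_pow 3).congr_deriv ?_
  simp only [Nat.cast_ofNat, Nat.add_one_sub_one]
  ring

/-- A `C²` function on the line which differs from `h |x|` by a bounded multiple of a smoothing of
`|x|`. -/
noncomputable def smoothEven (h : ℝ → ℝ) (x : ℝ) : ℝ :=
  h |x| - derivWithin h (Ici 0) 0 * |x| + derivWithin h (Ici 0) 0 * √(1 + x ^ 2)

/-- The derivative of `smoothEven`. -/
noncomputable def smoothEven₁ (h : ℝ → ℝ) (x : ℝ) : ℝ :=
  Real.sign x * (derivWithin h (Ici 0) |x| - derivWithin h (Ici 0) 0)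
    + derivWithin h (Ici 0) 0 * (x * (√(1 + x ^ 2))⁻¹)

/-- The second derivative of `smoothEven`. -/
noncomputable def smoothEven₂ (h : ℝ → ℝ) (x : ℝ) : ℝ :=
  iteratedDerivWithin 2 h (Ici 0) |x| + derivWithin h (Ici 0) 0 * (√(1 + x ^ 2))⁻¹ ^ 3

section
variable {h : ℝ → ℝ}

/-- Removing h'(0)|x| gives zero slope at the origin, so the even extension is differentiable; √(1 +
x²) restores boundedness at infinity. -/
theorem hasDerivAt_smoothEven (hh : IsCb 2 h) (x : ℝ) :
    HasDerivAt (smoothEven h) (smoothEven₁ h x) x := by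
  refine HasDerivAt.fun_add ?_ ((hasDerivAt_sqrt_one_add_sq x).const_mul _)
  exact hasDerivAt_even_extension (φ := fun x => h x - derivWithin h (Ici 0) 0 * x)
    (φ' := fun x => derivWithin h (Ici 0) x - derivWithin h (Ici 0) 0)
    (fun x hx => ((hh.hasDerivWithinAt one_le_two x hx).fun_sub
      ((hasDerivWithinAt_id x _).const_mul _)).congr_deriv (by simp)) (sub_self _) x

theorem hasDerivAt_smoothEven₁ (hh : IsCb 2 h) (x : ℝ) :
    HasDerivAt (smoothEven₁ h) (smoothEven₂ h x) x := by
  refine HasDerivAt.fun_add ?_ ((hasDerivAt_mul_inv_sqrt_one_add_sq x).const_mul _)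
  exact hasDerivAt_odd_extension
    (φ := fun x => derivWithin h (Ici 0) x - derivWithin h (Ici 0) 0)
    (fun x hx => (hh.hasDerivWithinAt_deriv x hx).sub_const _) (sub_self _) x

theorem continuous_smoothEven₂ (hh : IsCb 2 h) : Continuous (smoothEven₂ h) := by
  have h1 := continuous_comp_abs hh.continuousOn_deriv_two
  have h2 : Continuous fun x : ℝ => (√(1 + x ^ 2))⁻¹ :=
    continuous_iff_continuousAt.2 fun x => (hasDerivAt_inv_sqrt_one_add_sq x).continuousAt
  unfold smoothEven₂
  fun_prop

theorem exists_bound_smoothEven (hh : IsCb 2 h) :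
    ∃ B, 0 ≤ B ∧ (∀ x, |smoothEven h x| ≤ B) ∧ (∀ x, |smoothEven₁ h x| ≤ B) ∧
      ∀ x, |smoothEven₂ h x| ≤ B := by
  obtain ⟨H, hH0, hH⟩ := hh.bounded
  obtain ⟨H₁, hH₁0, hH₁⟩ := hh.bounded_deriv one_le_two
  obtain ⟨H₂, hH₂0, hH₂⟩ := hh.exists_bound (le_refl 2)
  obtain ⟨c, hc⟩ : ∃ c, c = derivWithin h (Ici 0) 0 := ⟨_, rfl⟩
  have hcH : |c| ≤ H₁ := hc ▸ hH₁ 0 self_mem_Ici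
  refine ⟨H + H₂ + 3 * H₁, by positivity, fun x => ?_, fun x => ?_, fun x => ?_⟩
  · have e : smoothEven h x = h |x| + c * (√(1 + x ^ 2) - |x|) := by
      rw [smoothEven, hc]; ring
    have h1 : |(√(1 + x ^ 2) - |x|)| ≤ 1 := by
      have h2 : |x| ≤ √(1 + x ^ 2) := Real.abs_le_sqrt (by linarith)
      have h3 : √(1 + x ^ 2) ≤ 1 + |x| := Real.sqrt_le_iff.2
        ⟨by positivity, by nlinarith [sq_abs x, abs_nonneg x]⟩
      rw [abs_le]; constructor <;> linarith
    rw [e]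
    refine (abs_add_le _ _).trans ?_
    rw [abs_mul]
    have := mul_le_mul hcH h1 (abs_nonneg _) hH₁0
    linarith [hH |x| (abs_nonneg x)]
  · rw [smoothEven₁, ← hc]
    refine (abs_add_le _ _).trans ?_
    have h1 : |Real.sign x * (derivWithin h (Ici 0) |x| - c)| ≤ H₁ + H₁ :=
      abs_sign_mul_le.trans ((abs_sub _ _).trans (add_le_add (hH₁ |x| (abs_nonneg x)) hcH))
    have h2 : |c * (x * (√(1 + x ^ 2))⁻¹)| ≤ H₁ * 1 := by
      rw [abs_mul]
      exact mul_le_mul hcH (abs_mul_inv_sqrt_one_add_sq_le_one x) (abs_nonneg _) hH₁0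
    linarith
  · rw [smoothEven₂, ← hc]
    refine (abs_add_le _ _).trans ?_
    have h2 : |c * (√(1 + x ^ 2))⁻¹ ^ 3| ≤ H₁ * 1 := by
      have h0 : 0 ≤ (√(1 + x ^ 2))⁻¹ := by positivity
      rw [abs_mul, abs_pow, abs_of_nonneg h0]
      exact mul_le_mul hcH (pow_le_one₀ h0 (inv_sqrt_one_add_sq_le_one x)) (by positivity) hH₁0
    linarith [hH₂ |x| (abs_nonneg x)]

end

/-- The part of the potential that remains after subtracting the corrector. -/
noncomputable def reducedPotential (ε : ℝ) (h y : ℝ → ℝ) (x t : ℝ) : ℝ :=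
  1 / 2 * (h |x|) ^ 2 - derivWithin y (Ici 0) t * h |x|
    - derivWithin y (Ici 0) t * smoothEven h x
    + ε / 2 * y t * (derivWithin h (Ici 0) 0 * (√(1 + x ^ 2))⁻¹ ^ 3)

/-- The space derivative of the corrector `-2 ∫ g + y(t) k(x)`. -/
noncomputable def correctorDx (f h y : ℝ → ℝ) (x t : ℝ) : ℝ :=
  -2 * symDrift f x + y t * smoothEven₁ h x

/-- The corrector `-2 ∫ g + y(t) k(x)`. -/
noncomputable def corrector (f h y : ℝ → ℝ) (x t : ℝ) : ℝ :=
  -2 * (∫ z in (0 : ℝ)..x, symDrift f z) + y t * smoothEven h x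

section
variable {ε : ℝ} {f h y : ℝ → ℝ}

/-- The coefficients are chosen so that (ε/2) Q_xx contains -ε f'(|x|) and (ε/2) y h''(|x|),
cancelling the two terms of the potential that need not be Lipschitz in x. -/
theorem hasC21_corrector (hf : IsCb 1 f) (hf0 : f 0 = 0) (hh : IsCb 2 h) (hy : IsCb 1 y) (T : ℝ) :
    HasC21 T (corrector f h y) (fun x t => derivWithin y (Ici 0) t * smoothEven h x)
      (correctorDx f h y)
      (fun x t => -2 * derivWithin f (Ici 0) |x| + y t * smoothEven₂ h x) := by
  have hg := continuous_symDrift hf hf0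
  have hd : ∀ x, HasDerivAt (fun x => ∫ z in (0 : ℝ)..x, symDrift f z) (symDrift f x) x :=
    fun x => intervalIntegral.integral_hasDerivAt_right (hg.intervalIntegrable _ _)
      (hg.stronglyMeasurableAtFilter _ _) hg.continuousAt
  have c1 : Continuous fun x => ∫ z in (0 : ℝ)..x, symDrift f z :=
    continuous_iff_continuousAt.2 fun x => (hd x).continuousAt
  have c2 : Continuous (smoothEven h) :=
    continuous_iff_continuousAt.2 fun x => (hasDerivAt_smoothEven hh x).continuousAt
  have c3 : Continuous (smoothEven₁ h) :=
    continuous_iff_continuousAt.2 fun x => (hasDerivAt_smoothEven₁ hh x).continuousAt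
  have c4 := continuous_smoothEven₂ hh
  have c5 := continuous_comp_abs (hf.continuousOn_deriv le_rfl)
  have hyc : ContinuousOn (fun p : ℝ × ℝ => y p.2) (univ ×ˢ Icc 0 T) :=
    hy.1.continuousOn.comp (by fun_prop) fun p hp => hp.2.1
  have hyc' : ContinuousOn (fun p : ℝ × ℝ => y p.2) (univ ×ˢ Ioc 0 T) :=
    hyc.mono (prod_mono (le_refl _) Ioc_subset_Icc_self)
  have hydc : ContinuousOn (fun p : ℝ × ℝ => derivWithin y (Ici 0) p.2) (univ ×ˢ Ioc 0 T) :=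
    (hy.continuousOn_deriv le_rfl).comp (by fun_prop) fun p hp => hp.2.1.le
  refine ⟨?_, fun x t ht => ?_, fun x t _ => ?_, fun x t _ => ?_, ?_, ?_, ?_⟩
  · exact (continuous_const.mul (c1.comp continuous_fst)).continuousOn.add
      (hyc.mul (c2.comp continuous_fst).continuousOn)
  · exact (((hy.hasDerivWithinAt le_rfl t ht.1.le).mono fun s hs => hs.1).mul_const _).const_add _
  · exact ((hd x).const_mul _).fun_add ((hasDerivAt_smoothEven hh x).const_mul _)
  · exact ((hasDerivAt_symDrift hf hf0 x).const_mul _).fun_add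
      ((hasDerivAt_smoothEven₁ hh x).const_mul _)
  · exact hydc.mul (c2.comp continuous_fst).continuousOn
  · exact (continuous_const.mul (hg.comp continuous_fst)).continuousOn.add
      (hyc'.mul (c3.comp continuous_fst).continuousOn)
  · exact (continuous_const.mul (c5.comp continuous_fst)).continuousOn.add
      (hyc'.mul (c4.comp continuous_fst).continuousOn)

/-- The reduced potential involves h only through Lipschitz functions of x. The extra condition on D
makes it a Lipschitz constant for w₀ minus the initial corrector, where L is that of w₀. -/
theorem exists_isCoeff (hf : IsCb 1 f) (hf0 : f 0 = 0) (hh : IsCb 2 h) (hy : IsCb 1 y)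
    {L : ℝ} (hL : 0 ≤ L) :
    ∃ D, L ≤ D ∧ (∀ x, |correctorDx f h y x 0| + L ≤ D) ∧
      IsCoeff D (symDrift f) (correctorDx f h y) (reducedPotential ε h y) := by
  obtain ⟨G, hG0, hG, hG'⟩ := exists_bound_symDrift hf
  obtain ⟨B, hB0, hB, hB₁, hB₂⟩ := exists_bound_smoothEven hh
  obtain ⟨H, hH0, hH⟩ := hh.bounded
  obtain ⟨H₁, hH₁0, hH₁⟩ := hh.bounded_deriv one_le_two
  obtain ⟨Y, hY0, hY⟩ := hy.bounded
  obtain ⟨Z, hZ0, hZ⟩ := hy.bounded_deriv le_rfl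
  have hgc := continuous_symDrift hf hf0
  have c2 : Continuous (smoothEven h) :=
    continuous_iff_continuousAt.2 fun x => (hasDerivAt_smoothEven hh x).continuousAt
  have c3 : Continuous (smoothEven₁ h) :=
    continuous_iff_continuousAt.2 fun x => (hasDerivAt_smoothEven₁ hh x).continuousAt
  have c6 := continuous_comp_abs hh.1.continuousOn
  have c7 : Continuous fun x : ℝ => (√(1 + x ^ 2))⁻¹ :=
    continuous_iff_continuousAt.2 fun x => (hasDerivAt_inv_sqrt_one_add_sq x).continuousAt
  have hyc : ContinuousOn (fun p : ℝ × ℝ => y p.2) (univ ×ˢ Ici 0) :=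
    hy.1.continuousOn.comp (by fun_prop) fun p hp => hp.2
  have hydc : ContinuousOn (fun p : ℝ × ℝ => derivWithin y (Ici 0) p.2) (univ ×ˢ Ici 0) :=
    (hy.continuousOn_deriv le_rfl).comp (by fun_prop) fun p hp => hp.2
  obtain ⟨c, hc⟩ : ∃ c, c = derivWithin h (Ici 0) 0 := ⟨_, rfl⟩
  have hcH : |c| ≤ H₁ := hc ▸ hH₁ 0 self_mem_Ici
  have hρ0 : ∀ x : ℝ, |(√(1 + x ^ 2))⁻¹ ^ 3| ≤ 1 := fun x => by
    have h0 : 0 ≤ (√(1 + x ^ 2))⁻¹ := by positivity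
    rw [abs_pow, abs_of_nonneg h0]
    exact pow_le_one₀ h0 (inv_sqrt_one_add_sq_le_one x)
  have hρ1 : ∀ x x' : ℝ, |(√(1 + x ^ 2))⁻¹ ^ 3 - (√(1 + x' ^ 2))⁻¹ ^ 3| ≤ 3 * |x - x'| := by
    refine abs_sub_le_of_hasDerivAt hasDerivAt_inv_sqrt_one_add_sq_pow fun x => ?_
    have h0 : 0 ≤ (√(1 + x ^ 2))⁻¹ := by positivity
    have h1 := abs_mul_inv_sqrt_one_add_sq_le_one x
    have h2 : |(√(1 + x ^ 2))⁻¹ ^ 4| ≤ 1 := by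
      rw [abs_pow, abs_of_nonneg h0]
      exact pow_le_one₀ h0 (inv_sqrt_one_add_sq_le_one x)
    have h3 := mul_le_mul h1 h2 (abs_nonneg _) zero_le_one
    rw [abs_mul, abs_mul]
    norm_num at h3 ⊢
    linarith
  have hhl : ∀ x x' : ℝ, |(h |x| - h |x'|)| ≤ H₁ * |x - x'| := by
    intro x x'
    have h1 := (convex_Ici (0 : ℝ)).norm_image_sub_le_of_norm_hasDerivWithin_le
      (hh.hasDerivWithinAt one_le_two) hH₁ (abs_nonneg x') (abs_nonneg x)
    exact h1.trans (mul_le_mul_of_nonneg_left (abs_abs_sub_abs_le_abs_sub x x') hH₁0)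
  have hgl := abs_sub_le_of_hasDerivAt (hasDerivAt_symDrift hf hf0) hG'
  have hkl := abs_sub_le_of_hasDerivAt (hasDerivAt_smoothEven hh) hB₁
  have hk₁l := abs_sub_le_of_hasDerivAt (hasDerivAt_smoothEven₁ hh) hB₂
  have hbb : ∀ x, ∀ t ∈ Ici (0 : ℝ), |correctorDx f h y x t| ≤ 2 * G + Y * B := by
    intro x t ht
    refine (abs_add_le _ _).trans (add_le_add ?_ ?_)
    · rw [abs_mul, abs_neg, abs_two]
      exact mul_le_mul_of_nonneg_left (hG x) zero_le_two
    · rw [abs_mul]; exact mul_le_mul (hY t ht) (hB₁ x) (abs_nonneg _) hY0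
  have hε2 : 0 ≤ |ε| / 2 * Y := by positivity
  have hey : ∀ t ∈ Ici (0 : ℝ), |ε / 2 * y t| ≤ |ε| / 2 * Y := fun t ht => by
    rw [abs_mul, abs_div, abs_two]
    exact mul_le_mul_of_nonneg_left (hY t ht) (by positivity)
  obtain ⟨S₀, hS₀⟩ : ∃ S, S = 1 / 2 * H ^ 2 + Z * H + Z * B + |ε| / 2 * Y * (H₁ * 1) := ⟨_, rfl⟩
  obtain ⟨S₁, hS₁⟩ : ∃ S, S = H * H₁ + Z * H₁ + Z * B + |ε| / 2 * Y * (H₁ * 3) := ⟨_, rfl⟩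
  have hS₀0 : 0 ≤ S₀ := by rw [hS₀]; positivity
  have hS₁0 : 0 ≤ S₁ := by rw [hS₁]; positivity
  have hYB : 0 ≤ Y * B := by positivity
  obtain ⟨D, hD⟩ : ∃ D, D = L + (2 * G + Y * B) + S₀ + S₁ := ⟨_, rfl⟩
  have d1 : L ≤ D := by rw [hD]; linarith
  have d2 : 2 * G + Y * B + L ≤ D := by rw [hD]; linarith
  have d3 : S₀ ≤ D := by rw [hD]; linarith
  have d4 : S₁ ≤ D := by rw [hD]; linarith
  refine ⟨D, d1, fun x => by linarith [hbb x 0 self_mem_Ici], by linarith, hgc,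
    fun x => by linarith [hG x],
    fun x x' => (hgl x x').trans (mul_le_mul_of_nonneg_right (by linarith) (abs_nonneg _)),
    ?_, fun x t ht => by linarith [hbb x t ht], fun x x' t ht => ?_, ?_,
    fun x t ht => le_trans ?_ d3, fun x x' t ht => le_trans ?_
      (mul_le_mul_of_nonneg_right d4 (abs_nonneg (x - x')))⟩
  · exact (continuous_const.mul (hgc.comp continuous_fst)).continuousOn.add
      (hyc.mul (c3.comp continuous_fst).continuousOn)
  · have e : correctorDx f h y x t - correctorDx f h y x' t
        = -2 * (symDrift f x - symDrift f x') + y t * (smoothEven₁ h x - smoothEven₁ h x') := by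
      simp only [correctorDx]; ring
    rw [e]
    refine (abs_add_le _ _).trans ?_
    rw [abs_mul, abs_mul, abs_neg, abs_two]
    have h1 := mul_le_mul (hY t ht) (hk₁l x x') (abs_nonneg _) hY0
    have h2 := hgl x x'
    have h3 := mul_le_mul_of_nonneg_right (by linarith : 2 * G + Y * B ≤ D) (abs_nonneg (x - x'))
    linarith
  · have k6 := c6.comp (continuous_fst (X := ℝ) (Y := ℝ))
    have k7 := c7.comp (continuous_fst (X := ℝ) (Y := ℝ))
    exact (((continuous_const.mul (k6.pow 2)).continuousOn.sub (hydc.mul k6.continuousOn)).sub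
      (hydc.mul (c2.comp continuous_fst).continuousOn)).add
      ((continuousOn_const.mul hyc).mul (continuous_const.mul (k7.pow 3)).continuousOn)
  · rw [reducedPotential, ← hc, hS₀]
    refine (abs_add_le _ _).trans (add_le_add ((abs_sub _ _).trans (add_le_add
      ((abs_sub _ _).trans (add_le_add ?_ ?_)) ?_)) ?_)
    · rw [abs_mul, abs_pow, abs_of_pos (by norm_num : (0 : ℝ) < 1 / 2)]
      have := hH |x| (abs_nonneg x)
      gcongr
    · rw [abs_mul]; exact mul_le_mul (hZ t ht) (hH _ (abs_nonneg x)) (abs_nonneg _) hZ0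
    · rw [abs_mul]; exact mul_le_mul (hZ t ht) (hB x) (abs_nonneg _) hZ0
    · rw [abs_mul, abs_mul c]
      exact mul_le_mul (hey t ht) (mul_le_mul hcH (hρ0 x) (abs_nonneg _) hH₁0) (by positivity) hε2
  · have e : reducedPotential ε h y x t - reducedPotential ε h y x' t
        = (h |x| + h |x'|) / 2 * (h |x| - h |x'|) - derivWithin y (Ici 0) t * (h |x| - h |x'|)
          - derivWithin y (Ici 0) t * (smoothEven h x - smoothEven h x')
          + ε / 2 * y t * (c * ((√(1 + x ^ 2))⁻¹ ^ 3 - (√(1 + x' ^ 2))⁻¹ ^ 3)) := by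
      simp only [reducedPotential, hc]; ring
    have e2 : S₁ * |x - x'| = H * (H₁ * |x - x'|) + Z * (H₁ * |x - x'|) + Z * (B * |x - x'|)
        + |ε| / 2 * Y * (H₁ * (3 * |x - x'|)) := by rw [hS₁]; ring
    rw [e, e2]
    refine (abs_add_le _ _).trans (add_le_add ((abs_sub _ _).trans (add_le_add
      ((abs_sub _ _).trans (add_le_add ?_ ?_)) ?_)) ?_)
    · rw [abs_mul]
      refine mul_le_mul ?_ (hhl x x') (abs_nonneg _) hH0
      rw [abs_div, abs_two]
      linarith [abs_add_le (h |x|) (h |x'|), hH |x| (abs_nonneg x), hH |x'| (abs_nonneg x')]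
    · rw [abs_mul]; exact mul_le_mul (hZ t ht) (hhl x x') (abs_nonneg _) hZ0
    · rw [abs_mul]; exact mul_le_mul (hZ t ht) (hkl x x') (abs_nonneg _) hZ0
    · rw [abs_mul, abs_mul c]
      exact mul_le_mul (hey t ht) (mul_le_mul hcH (hρ1 x x') (abs_nonneg _) hH₁0)
        (by positivity) hε2

/-- Short-time existence of bounded classical solutions with bounded space derivative. -/
theorem exists_isSmoothSolution (hε : 0 < ε) (hf : IsCb 1 f) (hf0 : f 0 = 0) (hh : IsCb 2 h)
    (hy : IsCb 1 y) {w₀ : ℝ → ℝ} (hbdd : ∃ C : ℝ, ∀ x, |w₀ x| ≤ C)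
    (hlip : ∃ L : NNReal, LipschitzWith L w₀) :
    ∃ Z, 0 ≤ Z ∧ ∀ T, 0 < T → T ≤ 1 → √T * Z ≤ 1 → ∃ w, IsSmoothSolution ε f h y w₀ T w ∧
      ∃ K : ℝ, (∀ x, ∀ t ∈ Icc 0 T, |w x t| ≤ K) ∧
        ∀ x, ∀ t ∈ Ioc 0 T, |deriv (fun z => w z t) x| ≤ K := by
  obtain ⟨C, hC⟩ := hbdd
  obtain ⟨L, hL⟩ := hlip
  obtain ⟨D, hLD, hbD, hcoeff⟩ := exists_isCoeff (ε := ε) hf hf0 hh hy L.coe_nonneg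
  obtain ⟨B, hB0, hB, -, -⟩ := exists_bound_smoothEven hh
  obtain ⟨Y, hY0, hY⟩ := hy.bounded
  have hg := continuous_symDrift hf hf0
  have hQd : ∀ x, HasDerivAt (fun x => corrector f h y x 0) (correctorDx f h y x 0) x := by
    intro x
    have hd : HasDerivAt (fun x => ∫ z in (0 : ℝ)..x, symDrift f z) (symDrift f x) x :=
      intervalIntegral.integral_hasDerivAt_right (hg.intervalIntegrable _ _)
        (hg.stronglyMeasurableAtFilter _ _) hg.continuousAt
    exact (hd.const_mul _).fun_add ((hasDerivAt_smoothEven hh x).const_mul _)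
  have hu₀l : ∀ x x', |(w₀ x - corrector f h y x 0) - (w₀ x' - corrector f h y x' 0)|
      ≤ D * |x - x'| := by
    intro x x'
    have h1 : |w₀ x - w₀ x'| ≤ L * |x - x'| := hL.dist_le_mul x x'
    have h2 := abs_sub_le_of_hasDerivAt hQd (C := D - L) (fun x => by linarith [hbD x]) x x'
    have e : (w₀ x - corrector f h y x 0) - (w₀ x' - corrector f h y x' 0)
      = (w₀ x - w₀ x') - (corrector f h y x 0 - corrector f h y x' 0) := by ring
    rw [e]
    refine (abs_sub _ _).trans ?_
    linarith
  have hu₀c : Continuous fun x => w₀ x - corrector f h y x 0 :=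
    hL.continuous.sub (continuous_iff_continuousAt.2 fun x => (hQd x).continuousAt)
  obtain ⟨Z, hZ, hex⟩ := exists_hasC21 hε hcoeff hu₀c hu₀l
  refine ⟨Z, hZ, fun T hT hT1 hTZ => ?_⟩
  obtain ⟨u, ut, ux, uxx, K, hu, hu0, hueq, huK, huxK⟩ := hex T hT hT1 hTZ
  have hQ := hasC21_corrector hf hf0 hh hy T
  have hw := hu.add hQ
  refine ⟨_, hw.isSmoothSolution (w₀ := w₀) (fun x => by rw [hu0]; ring) (fun x t ht => ?_),
    max (C + K + 2 * Y * B) K, fun x t ht => ?_, fun x t ht => ?_⟩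
  · rw [hueq x t ht]
    simp only [symHamiltonian, symPotential, reducedPotential, smoothEven₂]
    ring
  · refine le_trans ?_ (le_max_left _ _)
    -- The integral of g cancels between times 0 and t, leaving only bounded terms.
    have e : u x t + corrector f h y x t = w₀ x + (u x t - (w₀ x - corrector f h y x 0))
        + (y t - y 0) * smoothEven h x := by
      simp only [corrector]; ring
    rw [e]
    have h1 : |(y t - y 0) * smoothEven h x| ≤ 2 * Y * B := by
      rw [abs_mul]
      refine mul_le_mul ?_ (hB x) (abs_nonneg _) (by positivity)
      linarith [abs_sub (y t) (y 0), hY t ht.1, hY 0 self_mem_Ici]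
    exact (abs_add_le _ _).trans (add_le_add ((abs_add_le _ _).trans
      (add_le_add (hC x) (huK x t ht))) h1)
  · rw [(hw.hasDeriv_x x t ht).deriv]
    exact (huxK x t ht).trans (le_max_right _ _)

end
end ViscousHJ

theorem mainTheorem6 (ε : ℝ) (hε : 0 < ε) (f h y : ℝ → ℝ)
    (hf : ViscousHJ.IsCb 1 f) (hf0 : f 0 = 0) (hh : ViscousHJ.IsCb 2 h) (hy : ViscousHJ.IsCb 1 y)
    (w₀ : ℝ → ℝ) (hw₀_bdd : ∃ C : ℝ, ∀ x, |w₀ x| ≤ C)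
    (hw₀_lip : ∃ L : NNReal, LipschitzWith L w₀) :
    ∃ T : ℝ, 0 < T ∧ ∃ w : ℝ → ℝ → ℝ,
      ViscousHJ.IsSmoothSolution ε f h y w₀ T w ∧
      (∃ K : ℝ, (∀ x, ∀ t ∈ Set.Icc 0 T, |w x t| ≤ K) ∧
        ∀ x, ∀ t ∈ Set.Ioc 0 T, |deriv (fun z => w z t) x| ≤ K) ∧
      ∀ w' : ℝ → ℝ → ℝ, ViscousHJ.IsSmoothSolution ε f h y w₀ T w' →
        ∀ x, ∀ t ∈ Set.Icc 0 T, w' x t = w x t := by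
  obtain ⟨Z, hZ, hex⟩ :=
    ViscousHJ.exists_isSmoothSolution hε hf hf0 hh hy hw₀_bdd hw₀_lip
  obtain ⟨G, hG0, hG, hG'⟩ := ViscousHJ.exists_bound_symDrift hf
  obtain ⟨V, hV0, hV⟩ := ViscousHJ.exists_bound_symPotential ε hf hh hy
  have hε' : 0 < ε⁻¹ := inv_pos.2 hε
  obtain ⟨A, hA⟩ : ∃ A, A = 2 + 2 * ε⁻¹ * G + (G + ε⁻¹ * V) := ⟨_, rfl⟩
  have hA0 : 0 < A := by rw [hA]; positivity
  -- With √T = 1/B, the choice B ≥ 1 gives T ≤ √T ≤ 1, B ≥ Z gives the existence condition, and B ≥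
  -- A ε gives T A ≤ 1/ε for uniqueness.
  obtain ⟨B, hB⟩ : ∃ B, B = 1 + Z + A * ε := ⟨_, rfl⟩
  have hB0 : 1 ≤ B := by rw [hB]; have : 0 < A * ε := by positivity
                         linarith
  obtain ⟨T, hTd⟩ : ∃ T, T = (B ^ 2)⁻¹ := ⟨_, rfl⟩
  have hT : 0 < T := by rw [hTd]; positivity
  have hTB : T ≤ B⁻¹ := by
    rw [hTd]; exact inv_anti₀ (by positivity) (by nlinarith)
  have hB1 : B⁻¹ ≤ 1 := inv_le_one_of_one_le₀ hB0
  have hsT : √T = B⁻¹ := by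
    rw [hTd, Real.sqrt_inv, Real.sqrt_sq (by linarith)]
  obtain ⟨w, hw, K, hwK, hwxK⟩ := hex T hT (hTB.trans hB1) (by
    rw [hsT, inv_mul_le_iff₀ (by linarith), hB]
    have : 0 < A * ε := by positivity
    linarith)
  refine ⟨T, hT, w, hw, ⟨K, hwK, hwxK⟩, fun w' hw' => ?_⟩
  refine hw.unique hε hf hf0 (K := ε⁻¹ * V) (by positivity) hG hG' (fun x t ht => ?_)
    (hTB.trans hB1) ?_ hwK hw'
  · rw [abs_mul, abs_of_pos hε']
    exact mul_le_mul_of_nonneg_left (hV x t ht) hε'.le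
  · rw [← hA]
    refine (mul_le_mul_of_nonneg_right hTB hA0.le).trans ?_
    rw [inv_mul_le_iff₀ (by linarith), ← div_eq_mul_inv, le_div_iff₀ hε, hB]
    linarith
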